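/- **One-sided tasks.** A one-sided task is a family $\{U^x\}_x$ of unitaries on $A_0A_1$, where $A_0,A_1$ are finite-dimensional systems. Both $A_0$ and $A_1$ are given on the left, the classical string $x$ is given on the right, and after one round of simultaneous communication $A_0$ must be on the left and $A_1$ on the right, with $U^x$ applied. (As $x$ is classical it can be copied and sent to both sides, so second-round operations may depend on $x$.) **Non-local protocols.** A non-local protocol for the task with $E$ EPR pairs consists of isometries $V^L_{A_0A_1V_0\to X_0X_1}$, $V^{R,x}_{V_1\to Y_0Y_1}$, $W^{L,x}_{X_0Y_0\to A_0Z_0}$, $W^{R,x}_{X_1Y_1\to A_1Z_1}$ between finite-dimensional systems, where $V_0,V_1$ are $E$ qubits each, such that for every $x$ preparing $|\Psi^+\rangle_{V_0V_1}$ ($E$ EPR pairs), applying $V^L\otimes V^{R,x}$, then $W^{L,x}\otimes W^{R,x}$, and tracing out $Z_0Z_1$ implements exactly the channel $\rho\mapsto U^x\rho\,(U^x)^\dagger$ on $A_0A_1$. **Interaction-class complexity.** Let $\epsilon>0$. The $\epsilon$-approximate interaction class of the task is the set of unitaries $U^I$ on $A_0'A_1'$ ($a$ and $b$ qubits, for arbitrary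 $a,b\ge 0$) for which there are finite-dimensional systems and isometries $V^L_{A_0A_1\to A_0'X_0X_1}$, $W^{L,x}_{X_0Y_0A_0'\to A_0Z_0}$, $W^{R,x}_{X_1Y_1A_1'\to A_1Z_1}$ and pure states $V^{R,x}$ of $A_1'Y_0Y_1$ such that for every $x$ the channel $$\rho\mapsto \operatorname{tr}_{Z_0Z_1}\left(K^x\rho\,(K^x)^\dagger\right),\qquad K^x=[W^{L,x}\otimes W^{R,x}]\;U^I\;[V^L\otimes V^{R,x}],$$ is at diamond-norm distance at most $\epsilon$ from $\rho\mapsto U^x\rho\,(U^x)^\dagger$. Let $\mathcal G$ be a universal gate set: its circuits on $n$ qubits are, up to global phase, dense in the unitary group for all sufficiently large $n$. The circuit complexity of a unitary is the least number of gates from $\mathcal G$ in a circuit that equals it ($\infty$ if there is none). The interaction-class circuit complexity $\mathscr C$ of the task is the minimum of the circuit complexity over the $\epsilon$-approximate interaction class. **Lemma 1.** For every universal gate set $\mathcal G$ and every $\epsilon>0$ there is a constant $c>0$, depending only on $\mathcal G$ and $\epsilon$, such that for every one-sided task and every non-local protocol for it with $E$ EPR pairs, $\mathscr C$ is finite and,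 if $\mathscr C\ge 2$, $$E\;\ge\;c\,\log_2\log_2\mathscr C .$$ That is, $E=\Omega(\log\log\mathscr C)$. -/

import Mathlib

open Matrix
open scoped Kronecker ENNReal

noncomputable section

namespace NLQC

/-! ### Circuits and circuit complexity -/

/-- The computational basis of a register of qubits whose qubits are labelled by `q`. -/
abbrev Qubits (q : Type) : Type := q → Fin 2

/-- A gate set: for every arity `k`, a set of unitaries on `k` qubits. -/
abbrev GateSet : Type := (k : ℕ) → Set (unitaryGroup (Qubits (Fin k)) ℂ)

/-- The operator on the register `q` that applies the `k`-qubit gate `g` to the distinct qubits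
`f 0, …, f (k - 1)` and the identity to all other qubits. -/
def applyGate {q : Type} [Fintype q] [DecidableEq q] {k : ℕ}
    (g : unitaryGroup (Qubits (Fin k)) ℂ) (f : Fin k ↪ q) :
    Matrix (Qubits q) (Qubits q) ℂ :=
  fun s t =>
    if ∀ j, (∀ i, f i ≠ j) → s j = t j then
      (g : Matrix (Qubits (Fin k)) (Qubits (Fin k)) ℂ) (fun i => s (f i)) (fun i => t (f i))
    else 0

/-- `HasCircuit G n M`: some circuit of `n` gates from `G` on the register `q`
has the matrix `M`. -/
inductive HasCircuit (G : GateSet) {q : Type} [Fintype q] [DecidableEq q] :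
    ℕ → Matrix (Qubits q) (Qubits q) ℂ → Prop
  | nil : HasCircuit G 0 1
  | cons {n : ℕ} {M : Matrix (Qubits q) (Qubits q) ℂ} {k : ℕ}
      (g : unitaryGroup (Qubits (Fin k)) ℂ) (hg : g ∈ G k) (f : Fin k ↪ q)
      (h : HasCircuit G n M) : HasCircuit G (n + 1) (applyGate g f * M)

/-- The circuit complexity of a unitary: the least number of gates from `G` in a circuit for it,
`⊤` if there is no such circuit. -/
def circuitComplexity (G : GateSet) {q : Type} [Fintype q] [DecidableEq q]
    (U : unitaryGroup (Qubits q) ℂ) : ℕ∞ :=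
  ⨅ (n : ℕ) (_ : HasCircuit G n (U : Matrix (Qubits q) (Qubits q) ℂ)), (n : ℕ∞)

/-- A gate set is universal if, on every sufficiently large number of qubits, its circuits are
dense in the unitary group up to global phases. -/
def GateSet.IsUniversal (G : GateSet) : Prop :=
  ∃ n₀ : ℕ, ∀ n ≥ n₀, ∀ U : unitaryGroup (Qubits (Fin n)) ℂ,
    (U : Matrix (Qubits (Fin n)) (Qubits (Fin n)) ℂ) ∈
      closure {M | ∃ (z : ℂ) (m : ℕ), ‖z‖ = 1 ∧ HasCircuit G m (z • M)}

/-! ### Superoperators and the diamond norm -/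

section Norms

variable {m n : Type} [Fintype m] [DecidableEq m] [Fintype n] [DecidableEq n]

/-- The trace norm: the sum of the singular values. -/
def traceNorm (M : Matrix n n ℂ) : ℝ :=
  ∑ i, √((isHermitian_conjTranspose_mul_self M).eigenvalues i)

/-- `Φ ⊗ id` with the identity on an ancilla of dimension `k`. -/
def amplify (Φ : Matrix n n ℂ →ₗ[ℂ] Matrix m m ℂ) (k : ℕ)
    (X : Matrix (n × Fin k) (n × Fin k) ℂ) : Matrix (m × Fin k) (m × Fin k) ℂ :=
  fun p r => Φ (fun i j => X (i, p.2) (j, r.2)) p.1 r.1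

/-- The diamond norm of a superoperator. -/
def diamondNorm (Φ : Matrix n n ℂ →ₗ[ℂ] Matrix m m ℂ) : ℝ≥0∞ :=
  ⨆ (k : ℕ) (X : Matrix (n × Fin k) (n × Fin k) ℂ) (_ : traceNorm X ≤ 1),
    ENNReal.ofReal (traceNorm (amplify Φ k X))

end Norms

/-- The superoperator `ρ ↦ K ρ K†`. -/
def conjMap {m n : Type} [Fintype n] (K : Matrix m n ℂ) : Matrix n n ℂ →ₗ[ℂ] Matrix m m ℂ where
  toFun ρ := K * ρ * Kᴴ
  map_add' ρ σ := by rw [Matrix.mul_add, Matrix.add_mul]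
  map_smul' c ρ := by simp

/-- The partial trace over `Z₀` and `Z₁` of an operator on `(A₀ Z₀) (A₁ Z₁)`. -/
def traceOut {A₀ A₁ Z₀ Z₁ : Type} [Fintype Z₀] [Fintype Z₁] :
    Matrix ((A₀ × Z₀) × (A₁ × Z₁)) ((A₀ × Z₀) × (A₁ × Z₁)) ℂ →ₗ[ℂ]
      Matrix (A₀ × A₁) (A₀ × A₁) ℂ where
  toFun M := of fun i j => ∑ z₀, ∑ z₁, M ((i.1, z₀), (i.2, z₁)) ((j.1, z₀), (j.2, z₁))
  map_add' M N := by
    ext i j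
    simp [Finset.sum_add_distrib]
  map_smul' c M := by
    ext i j
    simp [Finset.mul_sum]

/-- A matrix `V` is an isometry if `V† V = 1`. -/
def IsIsometry {m n : Type} [Fintype m] [DecidableEq n] (V : Matrix m n ℂ) : Prop :=
  Vᴴ * V = 1

/-! ### One-sided tasks

The input systems `A₀`, `A₁` have dimensions `d₀`, `d₁` and both start on the left; the classical
input `x : ι` is given on the right. The task is specified by the unitaries `U x` on `A₀ A₁`;
after it has been completed, `A₀` is on the left and `A₁` is on the right. -/

/-- A one-sided task. -/
abbrev Task (d₀ d₁ : ℕ) (ι : Type) : Type := ι → unitaryGroup (Fin d₀ × Fin d₁) ℂ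

/-- The channel that a task asks for on the classical input `x`. -/
def Task.channel {d₀ d₁ : ℕ} {ι : Type} (U : Task d₀ d₁ ι) (x : ι) :
    Matrix (Fin d₀ × Fin d₁) (Fin d₀ × Fin d₁) ℂ →ₗ[ℂ]
      Matrix (Fin d₀ × Fin d₁) (Fin d₀ × Fin d₁) ℂ :=
  conjMap (U x : Matrix (Fin d₀ × Fin d₁) (Fin d₀ × Fin d₁) ℂ)

/-- The isometry `|ψ⟩ ↦ |ψ⟩ ⊗ |Ψ⁺⟩` that adjoins `E` EPR pairs, that is, the state
`2 ^ (-E / 2) ∑ v, |v⟩ |v⟩` on two registers `V₀`, `V₁` of `E` qubits each. -/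
def attachEPR (A : Type) [DecidableEq A] (E : ℕ) :
    Matrix ((A × Qubits (Fin E)) × Qubits (Fin E)) A ℂ :=
  fun p a => if p.1.1 = a ∧ p.1.2 = p.2 then (((√2 : ℝ) ^ E)⁻¹ : ℝ) else 0

/-- A non-local protocol with `E` EPR pairs for a one-sided task. The left applies `VL` to
`A₀ A₁ V₀`, keeps `X₀` and sends `X₁`; the right applies `VR x` to `V₁`, keeps `Y₁` and sends `Y₀`.
After this exchange, which also makes the classical `x` known on both sides, the left applies
`WL x` to `X₀ Y₀` and the right applies `WR x` to `X₁ Y₁`. -/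
structure NonlocalProtocol (d₀ d₁ : ℕ) (ι : Type) (E : ℕ) where
  (x₀ x₁ y₀ y₁ z₀ z₁ : ℕ)
  VL : Matrix (Fin x₀ × Fin x₁) ((Fin d₀ × Fin d₁) × Qubits (Fin E)) ℂ
  VR : ι → Matrix (Fin y₀ × Fin y₁) (Qubits (Fin E)) ℂ
  WL : ι → Matrix (Fin d₀ × Fin z₀) (Fin x₀ × Fin y₀) ℂ
  WR : ι → Matrix (Fin d₁ × Fin z₁) (Fin x₁ × Fin y₁) ℂ
  isometry_VL : IsIsometry VL
  isometry_VR : ∀ x, IsIsometry (VR x)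
  isometry_WL : ∀ x, IsIsometry (WL x)
  isometry_WR : ∀ x, IsIsometry (WR x)

namespace NonlocalProtocol

variable {d₀ d₁ : ℕ} {ι : Type} {E : ℕ} (P : NonlocalProtocol d₀ d₁ ι E)

/-- The isometry `A₀ A₁ → X₀ X₁ Y₀ Y₁` of the first round, on the classical input `x`. -/
def firstRound (x : ι) :
    Matrix ((Fin P.x₀ × Fin P.x₁) × (Fin P.y₀ × Fin P.y₁)) (Fin d₀ × Fin d₁) ℂ :=
  (P.VL ⊗ₖ P.VR x) * attachEPR (Fin d₀ × Fin d₁) E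

/-- The first round, with its outputs regrouped as `(X₀ Y₀) (X₁ Y₁)` by the exchange. -/
def exchanged (x : ι) :
    Matrix ((Fin P.x₀ × Fin P.y₀) × (Fin P.x₁ × Fin P.y₁)) (Fin d₀ × Fin d₁) ℂ :=
  (P.firstRound x).submatrix (fun s => ((s.1.1, s.2.1), (s.1.2, s.2.2))) id

/-- The overall isometry `A₀ A₁ → A₀ Z₀ A₁ Z₁` of the protocol on the classical input `x`. -/
def total (x : ι) :
    Matrix ((Fin d₀ × Fin P.z₀) × (Fin d₁ × Fin P.z₁)) (Fin d₀ × Fin d₁) ℂ :=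
  (P.WL x ⊗ₖ P.WR x) * P.exchanged x

/-- The channel on `A₀ A₁` performed by the protocol on the classical input `x`. -/
def channel (x : ι) :
    Matrix (Fin d₀ × Fin d₁) (Fin d₀ × Fin d₁) ℂ →ₗ[ℂ]
      Matrix (Fin d₀ × Fin d₁) (Fin d₀ × Fin d₁) ℂ :=
  traceOut ∘ₗ conjMap (P.total x)

/-- The protocol completes the task. -/
def Completes (U : Task d₀ d₁ ι) : Prop := ∀ x, P.channel x = U.channel x

end NonlocalProtocol

/-- The local pre- and post-processing around an interaction unitary on `a + b` qubits, of which
`a` qubits (the system `A₀'`) come from and return to the left and `b` qubits (the system `A₁'`)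
come from and return to the right. The left applies `VL` to `A₀ A₁`, producing `A₀'`, a system `X₀`
that it keeps and a system `X₁` that it sends; the right, which has no quantum input, prepares the
state `VR x` of `A₁'`, `Y₀` (sent) and `Y₁` (kept). After the interaction, the left applies `WL x` to
`X₀ Y₀ A₀'` and the right applies `WR x` to `X₁ Y₁ A₁'`. -/
structure LocalProcessing (d₀ d₁ : ℕ) (ι : Type) (a b : ℕ) where
  (x₀ x₁ y₀ y₁ z₀ z₁ : ℕ)
  VL : Matrix (Qubits (Fin a) × (Fin x₀ × Fin x₁)) (Fin d₀ × Fin d₁) ℂ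
  VR : ι → Matrix (Qubits (Fin b) × (Fin y₀ × Fin y₁)) Unit ℂ
  WL : ι → Matrix (Fin d₀ × Fin z₀) ((Fin x₀ × Fin y₀) × Qubits (Fin a)) ℂ
  WR : ι → Matrix (Fin d₁ × Fin z₁) ((Fin x₁ × Fin y₁) × Qubits (Fin b)) ℂ
  isometry_VL : IsIsometry VL
  isometry_VR : ∀ x, IsIsometry (VR x)
  isometry_WL : ∀ x, IsIsometry (WL x)
  isometry_WR : ∀ x, IsIsometry (WR x)

namespace LocalProcessing

variable {d₀ d₁ : ℕ} {ι : Type} {a b : ℕ} (L : LocalProcessing d₀ d₁ ι a b)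

/-- The isometry `A₀ A₁ → (A₀' A₁') (X₀ X₁ Y₀ Y₁)` of the pre-processing, on the classical
input `x`. -/
def prepared (x : ι) :
    Matrix (Qubits (Fin a ⊕ Fin b) × ((Fin L.x₀ × Fin L.x₁) × (Fin L.y₀ × Fin L.y₁)))
      (Fin d₀ × Fin d₁) ℂ :=
  (L.VL ⊗ₖ L.VR x).submatrix
    (fun s => ((fun i => s.1 (Sum.inl i), s.2.1), (fun i => s.1 (Sum.inr i), s.2.2)))
    (fun i => (i, ()))

/-- The pre-processing followed by the interaction unitary `V` on `A₀' A₁'`. -/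
def interacted (V : unitaryGroup (Qubits (Fin a ⊕ Fin b)) ℂ) (x : ι) :
    Matrix (Qubits (Fin a ⊕ Fin b) × ((Fin L.x₀ × Fin L.x₁) × (Fin L.y₀ × Fin L.y₁)))
      (Fin d₀ × Fin d₁) ℂ :=
  ((V : Matrix (Qubits (Fin a ⊕ Fin b)) (Qubits (Fin a ⊕ Fin b)) ℂ) ⊗ₖ
    (1 : Matrix ((Fin L.x₀ × Fin L.x₁) × (Fin L.y₀ × Fin L.y₁))
      ((Fin L.x₀ × Fin L.x₁) × (Fin L.y₀ × Fin L.y₁)) ℂ)) * L.prepared x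

/-- The state after the interaction, with the systems regrouped as `(X₀ Y₀ A₀') (X₁ Y₁ A₁')`. -/
def exchanged (V : unitaryGroup (Qubits (Fin a ⊕ Fin b)) ℂ) (x : ι) :
    Matrix (((Fin L.x₀ × Fin L.y₀) × Qubits (Fin a)) × ((Fin L.x₁ × Fin L.y₁) × Qubits (Fin b)))
      (Fin d₀ × Fin d₁) ℂ :=
  (L.interacted V x).submatrix
    (fun s => (Sum.elim s.1.2 s.2.2, ((s.1.1.1, s.2.1.1), (s.1.1.2, s.2.1.2)))) id

/-- The overall isometry `A₀ A₁ → A₀ Z₀ A₁ Z₁` on the classical input `x`, when `V` is the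
interaction unitary. -/
def total (V : unitaryGroup (Qubits (Fin a ⊕ Fin b)) ℂ) (x : ι) :
    Matrix ((Fin d₀ × Fin L.z₀) × (Fin d₁ × Fin L.z₁)) (Fin d₀ × Fin d₁) ℂ :=
  (L.WL x ⊗ₖ L.WR x) * L.exchanged V x

/-- The channel on `A₀ A₁` performed on the classical input `x`, when `V` is the interaction
unitary. -/
def channel (V : unitaryGroup (Qubits (Fin a ⊕ Fin b)) ℂ) (x : ι) :
    Matrix (Fin d₀ × Fin d₁) (Fin d₀ × Fin d₁) ℂ →ₗ[ℂ]
      Matrix (Fin d₀ × Fin d₁) (Fin d₀ × Fin d₁) ℂ :=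
  traceOut ∘ₗ conjMap (L.total V x)

end LocalProcessing

/-- The `ε`-approximate interaction class of a one-sided task: the unitaries `V` on `a + b` qubits
that, with suitable local pre- and post-processing, complete the task up to `ε` in diamond norm. -/
def interactionClass {d₀ d₁ : ℕ} {ι : Type} (ε : ℝ) (U : Task d₀ d₁ ι) (a b : ℕ) :
    Set (unitaryGroup (Qubits (Fin a ⊕ Fin b)) ℂ) :=
  {V | ∃ L : LocalProcessing d₀ d₁ ι a b, ∀ x,
    diamondNorm (U.channel x - L.channel V x) ≤ ENNReal.ofReal ε}

/-- The interaction-class circuit complexity of a one-sided task: the least circuit complexity of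
a unitary in its `ε`-approximate interaction class. -/
def interactionComplexity (G : GateSet) (ε : ℝ) {d₀ d₁ : ℕ} {ι : Type} (U : Task d₀ d₁ ι) : ℕ∞ :=
  ⨅ (a : ℕ) (b : ℕ) (V ∈ interactionClass ε U a b), circuitComplexity G V

end NLQC

end

/-!
A non-local protocol with `E` EPR pairs already contains a decomposition of the task into local
processing and an interaction: the EPR pairs have to be created between the two sides, and this can
be done by teleporting the halves of locally created pairs. With port-based teleportation through
`N` ports the only correction is the selection of a port, which commutes with the operations that
the right applies to its halves before the interaction, one copy for each port. The interaction is
thus the unitary factor in the polar decomposition of one operator, `portMatrix`, which depends on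
`E` and `N` only, and neither on the task nor on the dimensions of the protocol. With the operator
itself in place of the interaction, the local processing `portProcessing` performs exactly the
channel of the protocol (`channel_totalWith_portOperator`). The operator is an isometry up to a mean
square deviation of `4 ^ E / N` (`sum_sq_sub_portMatch_le`), hence as close to its polar factor
(`exists_unitary_sum_norm_sq_col_le`). As the registers that enter the interaction are maximally
mixed, the mean square deviation is all that counts, and it bounds the diamond distance of the
channels (`exists_unitary_diamondNorm_portProcessing_le`). A fixed precision therefore needs only
`N = 2 ^ k` ports with `k = 2 * E + O(1)`, and an interaction on `n = 2 ^ O(E)` qubits.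

On `n` qubits, every unitary is approximated to a fixed precision by `2 ^ O(n)` gates from a
universal set (`GateSet.IsUniversal.exists_circuit_bound`). It is first written exactly as a product
of `2 ^ O(n)` unitaries on two qubits (`mem_pow_twoQubit`), which are then approximated to
precision `2 ^ (-O(n))` by circuits on a fixed number of qubits. Circuits polynomial in the inverse
precision are enough for this, and a weak form of the Solovay–Kitaev theorem provides them
(`exists_isNet_pow`): group commutators of elements of a net give a finer net, by words of constant
length. A gate set need not contain inverses, so the inverses in these words are replaced by powers
(`exists_pow_near_inv`), which keeps the lengths polynomial.

The complexity is defined by exact circuits, but the interaction may be approximate. So the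
interaction is taken to be the unitary of the approximating circuit, and the complexity is at most
`2 ^ 2 ^ O(E)`. Without EPR pairs, a single port makes the interaction trivial and the complexity
is `0` (`interactionComplexity_eq_zero`).
-/

noncomputable section

namespace NLQC

open scoped Matrix.Norms.L2Operator Pointwise

/-! ### Solovay–Kitaev without inverses -/

section SolovayKitaev

variable {n : Type} [Fintype n] [DecidableEq n]

theorem norm_unitary_le (U : unitaryGroup n ℂ) : ‖(U : Matrix n n ℂ)‖ ≤ 1 := by
  nontriviality Matrix n n ℂ
  exact (CStarRing.norm_of_mem_unitary U.2).le

theorem norm_unitary_sub_inv (U V : unitaryGroup n ℂ) :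
    ‖((U⁻¹ : unitaryGroup n ℂ) : Matrix n n ℂ) - (V⁻¹ : unitaryGroup n ℂ)‖ =
      ‖(U : Matrix n n ℂ) - V‖ := by
  rw [UnitaryGroup.inv_val, UnitaryGroup.inv_val, ← star_sub, norm_star]

theorem norm_unitary_mul_sub_mul_le (U U' V V' : unitaryGroup n ℂ) :
    ‖((U * V : unitaryGroup n ℂ) : Matrix n n ℂ) - (U' * V' : unitaryGroup n ℂ)‖ ≤
      ‖(U : Matrix n n ℂ) - U'‖ + ‖(V : Matrix n n ℂ) - V'‖ := by
  have h : ((U * V : unitaryGroup n ℂ) : Matrix n n ℂ) - (U' * V' : unitaryGroup n ℂ) =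
      ((U : Matrix n n ℂ) - U') * V + U' * ((V : Matrix n n ℂ) - V') := by
    simp only [UnitaryGroup.mul_val]; noncomm_ring
  rw [h]
  refine (norm_add_le _ _).trans (add_le_add ?_ ?_)
  · exact (CStarRing.norm_mul_coe_unitary _ V).le
  · exact (CStarRing.norm_coe_unitary_mul U' _).le

theorem norm_exp_sub_one_sub_le (x : Matrix n n ℂ) (hx : ‖x‖ ≤ 1) :
    ‖NormedSpace.exp x - 1 - x‖ ≤ ‖x‖ ^ 2 := by
  have h := NormedSpace.exp_series_hasSum_exp' (𝕂 := ℂ) x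
  have h2 := (hasSum_nat_add_iff' 2).2 h
  have h3 := (hasSum_nat_add_iff' 2).2 (NormedSpace.exp_series_hasSum_exp' (𝕂 := ℝ) ‖x‖)
  rw [← Real.exp_eq_exp_ℝ] at h3
  have h4 := Real.abs_exp_sub_one_sub_id_le (x := ‖x‖) (by rwa [abs_of_nonneg (norm_nonneg x)])
  simp only [Finset.sum_range_succ, Finset.sum_range_zero, Nat.factorial, pow_zero, pow_one,
    Nat.cast_one, inv_one, one_smul, zero_add, mul_one] at h2 h3
  rw [sub_sub]
  refine (h2.norm_le_of_bounded h3 fun i => ?_).trans ?_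
  · rw [norm_smul, smul_eq_mul, norm_inv, Complex.norm_natCast]
    gcongr
    exact norm_pow_le' x (by omega)
  · rw [← sub_sub]
    exact (le_abs_self _).trans h4

/-- A set `N` of unitaries is a `δ`-net. -/
def IsNet (N : Set (unitaryGroup n ℂ)) (δ : ℝ) : Prop :=
  ∀ U : unitaryGroup n ℂ, ∃ W ∈ N, ‖(U : Matrix n n ℂ) - W‖ ≤ δ

theorem IsNet.mono {N : Set (unitaryGroup n ℂ)} {δ δ' : ℝ} (h : IsNet N δ) (hδ : δ ≤ δ') :
    IsNet N δ' := fun U => (h U).imp fun _ hW => ⟨hW.1, hW.2.trans hδ⟩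

/-- If `a ≈ 1 + s P` and `b ≈ 1 + s Q` to order `s²`, then the group commutator of `a` and `b` is
`1 + s² [P, Q]` to order `s³`: precision `s²` of the factors becomes precision `s³`. -/
theorem norm_commutator_sub_le (P Q : Matrix n n ℂ) (hP : ‖P‖ ≤ 1) (hQ : ‖Q‖ ≤ 1) {s : ℝ}
    (hs0 : 0 ≤ s) (hs1 : s ≤ 1) (a b : unitaryGroup n ℂ)
    (ha : ‖(a : Matrix n n ℂ) - 1 - (s : ℂ) • P‖ ≤ 2 * s ^ 2)
    (hb : ‖(b : Matrix n n ℂ) - 1 - (s : ℂ) • Q‖ ≤ 2 * s ^ 2) :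
    ‖((a * b * a⁻¹ * b⁻¹ : unitaryGroup n ℂ) : Matrix n n ℂ) - 1 -
      ((s ^ 2 : ℝ) : ℂ) • (P * Q - Q * P)‖ ≤ 124 * s ^ 3 := by
  set p : Matrix n n ℂ := (a : Matrix n n ℂ) - 1 with hp
  set q : Matrix n n ℂ := (b : Matrix n n ℂ) - 1 with hq
  have hsP : ‖(s : ℂ) • P‖ ≤ s := by
    rw [norm_smul, Complex.norm_real, Real.norm_of_nonneg hs0]; nlinarith
  have hsQ : ‖(s : ℂ) • Q‖ ≤ s := by
    rw [norm_smul, Complex.norm_real, Real.norm_of_nonneg hs0]; nlinarith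
  have hpn : ‖p‖ ≤ 3 * s := by
    have := norm_add_le (p - (s : ℂ) • P) ((s : ℂ) • P)
    rw [sub_add_cancel] at this
    nlinarith
  have hqn : ‖q‖ ≤ 3 * s := by
    have := norm_add_le (q - (s : ℂ) • Q) ((s : ℂ) • Q)
    rw [sub_add_cancel] at this
    nlinarith
  have key : ∀ (x y X Y : Matrix n n ℂ), ‖x - X‖ ≤ 2 * s ^ 2 → ‖y - Y‖ ≤ 2 * s ^ 2 → ‖y‖ ≤ 3 * s →
      ‖X‖ ≤ s → ‖x * y - X * Y‖ ≤ 8 * s ^ 3 := by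
    intro x y X Y h1 h2 h3 h4
    have h : x * y - X * Y = (x - X) * y + X * (y - Y) := by noncomm_ring
    rw [h]
    calc _ ≤ ‖x - X‖ * ‖y‖ + ‖X‖ * ‖y - Y‖ :=
          (norm_add_le _ _).trans (add_le_add (norm_mul_le _ _) (norm_mul_le _ _))
      _ ≤ (2 * s ^ 2) * (3 * s) + s * (2 * s ^ 2) := by gcongr
      _ = 8 * s ^ 3 := by ring
  have h1 := key p q _ _ ha hb hqn hsP
  have h2 := key q p _ _ hb ha hpn hsQ
  have hba : ‖((a⁻¹ * b⁻¹ : unitaryGroup n ℂ) : Matrix n n ℂ) - 1‖ ≤ 6 * s := by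
    have := norm_unitary_mul_sub_mul_le a⁻¹ 1 b⁻¹ 1
    have e1 := norm_unitary_sub_inv a 1
    have e2 := norm_unitary_sub_inv b 1
    rw [inv_one] at e1 e2
    rw [e1, e2, mul_one] at this
    simp only [UnitaryGroup.one_val] at this
    linarith
  have hcomm : ‖p * q - q * p‖ ≤ 18 * s ^ 2 := by
    calc _ ≤ ‖p‖ * ‖q‖ + ‖q‖ * ‖p‖ :=
          (norm_sub_le _ _).trans (add_le_add (norm_mul_le _ _) (norm_mul_le _ _))
      _ ≤ (3 * s) * (3 * s) + (3 * s) * (3 * s) := by gcongr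
      _ = 18 * s ^ 2 := by ring
  set W : Matrix n n ℂ := ((a⁻¹ * b⁻¹ : unitaryGroup n ℂ) : Matrix n n ℂ) with hW
  have hone : (b : Matrix n n ℂ) * a * W = 1 := by
    have : b * a * (a⁻¹ * b⁻¹) = 1 := by group
    have h : ((b * a * (a⁻¹ * b⁻¹) : unitaryGroup n ℂ) : Matrix n n ℂ) = 1 := by rw [this]; rfl
    exact h
  have hg : ((a * b * a⁻¹ * b⁻¹ : unitaryGroup n ℂ) : Matrix n n ℂ) =
      (a : Matrix n n ℂ) * b * W := by
    rw [mul_assoc (a * b)]; rfl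
  have hdec : (a : Matrix n n ℂ) * b * W - 1 - ((s ^ 2 : ℝ) : ℂ) • (P * Q - Q * P) =
      (p * q - ((s : ℂ) • P) * ((s : ℂ) • Q)) - (q * p - ((s : ℂ) • Q) * ((s : ℂ) • P)) +
        (p * q - q * p) * (W - 1) := by
    have e : (p * q - q * p) * (W - 1) =
        (a : Matrix n n ℂ) * b * W - (b : Matrix n n ℂ) * a * W - (p * q - q * p) := by
      rw [hp, hq]; noncomm_ring
    rw [e, hone]
    simp only [smul_mul_smul_comm, smul_sub]
    push_cast
    rw [← sq]
    abel
  rw [hg, hdec]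
  calc _ ≤ 8 * s ^ 3 + 8 * s ^ 3 + (18 * s ^ 2) * (6 * s) := by
        refine (norm_add_le _ _).trans (add_le_add ((norm_sub_le _ _).trans (add_le_add h1 h2)) ?_)
        refine (norm_mul_le _ _).trans ?_
        gcongr
    _ = 124 * s ^ 3 := by ring

/-- `IsReachable t K Y`: from every `s²`-net, a word of length `t` in the net and its inverses
realises the infinitesimal rotation `1 + s² Y` up to an error of order `s³`. -/
def IsReachable (t : ℕ) (K : ℝ) (Y : Matrix n n ℂ) : Prop :=
  ∀ s : ℝ, 0 < s → s ≤ 1 → ∀ N : Set (unitaryGroup n ℂ), IsNet N (s ^ 2) →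
    ∃ g ∈ (N ∪ N⁻¹) ^ t, ‖(g : Matrix n n ℂ) - 1 - ((s ^ 2 : ℝ) : ℂ) • Y‖ ≤ K * s ^ 3

/-- Elements of the net close to `exp (s P)` and `exp (s Q)` have a group commutator that realises
`[P, Q]`. -/
theorem isReachable_commutator (P Q : Matrix n n ℂ) (hP : P ∈ skewAdjoint (Matrix n n ℂ))
    (hQ : Q ∈ skewAdjoint (Matrix n n ℂ)) (hP1 : ‖P‖ ≤ 1) (hQ1 : ‖Q‖ ≤ 1) :
    IsReachable 4 124 (P * Q - Q * P) := by
  intro s hs0 hs1 N hN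
  have key : ∀ X : Matrix n n ℂ, X ∈ skewAdjoint (Matrix n n ℂ) → ‖X‖ ≤ 1 →
      ∃ a ∈ N, ‖(a : Matrix n n ℂ) - 1 - (s : ℂ) • X‖ ≤ 2 * s ^ 2 := by
    intro X hX hX1
    have hsX : (s : ℂ) • X ∈ skewAdjoint (Matrix n n ℂ) := by
      rw [skewAdjoint.mem_iff] at hX ⊢
      rw [star_smul, hX]; simp
    have hn : ‖(s : ℂ) • X‖ ≤ s := by
      rw [norm_smul, Complex.norm_real, Real.norm_of_nonneg hs0.le]; nlinarith
    let +nondep : NormedAlgebra ℚ (Matrix n n ℂ) := .restrictScalars ℚ ℂ _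
    obtain ⟨a, ha, hab⟩ := hN ⟨NormedSpace.exp ((s : ℂ) • X),
      NormedSpace.exp_mem_unitary_of_mem_skewAdjoint hsX⟩
    refine ⟨a, ha, ?_⟩
    have h1 := norm_exp_sub_one_sub_le ((s : ℂ) • X) (hn.trans hs1)
    have h2 : ‖(s : ℂ) • X‖ ^ 2 ≤ s ^ 2 := by gcongr
    rw [norm_sub_rev] at hab
    have := norm_add_le ((a : Matrix n n ℂ) - NormedSpace.exp ((s : ℂ) • X))
      (NormedSpace.exp ((s : ℂ) • X) - 1 - (s : ℂ) • X)
    rw [show ∀ x y z w : Matrix n n ℂ, x - y + (y - z - w) = x - z - w by intros; abel] at this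
    simp only at hab
    linarith
  obtain ⟨a, ha, ha'⟩ := key P hP hP1
  obtain ⟨b, hb, hb'⟩ := key Q hQ hQ1
  refine ⟨a * b * a⁻¹ * b⁻¹, ?_, norm_commutator_sub_le P Q hP1 hQ1 hs0.le hs1 a b ha' hb'⟩
  rw [show (N ∪ N⁻¹) ^ 4 = (N ∪ N⁻¹) * (N ∪ N⁻¹) * (N ∪ N⁻¹) * (N ∪ N⁻¹) by
    simp only [pow_succ, pow_zero, one_mul]]
  exact Set.mul_mem_mul (Set.mul_mem_mul (Set.mul_mem_mul (Or.inl ha) (Or.inl hb))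
    (Or.inr (Set.inv_mem_inv.2 ha))) (Or.inr (Set.inv_mem_inv.2 hb))

theorem IsReachable.add {t₁ t₂ : ℕ} {K₁ K₂ : ℝ} {Y₁ Y₂ : Matrix n n ℂ} {B : ℝ}
    (h₁ : IsReachable t₁ K₁ Y₁) (h₂ : IsReachable t₂ K₂ Y₂) (hK₂ : 0 ≤ K₂) (hY₁ : ‖Y₁‖ ≤ B)
    {B' : ℝ} (hY₂ : ‖Y₂‖ ≤ B') :
    IsReachable (t₁ + t₂) (K₁ + K₂ + B * (K₂ + B')) (Y₁ + Y₂) := by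
  intro s hs0 hs1 N hN
  obtain ⟨g, hg, hg'⟩ := h₁ s hs0 hs1 N hN
  obtain ⟨h, hh, hh'⟩ := h₂ s hs0 hs1 N hN
  refine ⟨g * h, by rw [pow_add]; exact Set.mul_mem_mul hg hh, ?_⟩
  have hB : 0 ≤ B := (norm_nonneg _).trans hY₁
  have hB' : 0 ≤ B' := (norm_nonneg _).trans hY₂
  have hsn : ∀ Y : Matrix n n ℂ, ∀ B, ‖Y‖ ≤ B → ‖((s ^ 2 : ℝ) : ℂ) • Y‖ ≤ s ^ 2 * B := by
    intro Y B hY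
    rw [norm_smul, Complex.norm_real, Real.norm_of_nonneg (by positivity)]
    gcongr
  have h3 : ‖(h : Matrix n n ℂ) - 1‖ ≤ s * (K₂ + B') := by
    have := norm_add_le ((h : Matrix n n ℂ) - 1 - ((s ^ 2 : ℝ) : ℂ) • Y₂) (((s ^ 2 : ℝ) : ℂ) • Y₂)
    rw [sub_add_cancel] at this
    have h4 := hsn Y₂ B' hY₂
    have h5 : K₂ * s ^ 3 ≤ K₂ * s := by
      gcongr; nlinarith [mul_nonneg hs0.le hs0.le]
    have h6 : s ^ 2 * B' ≤ s * B' := by gcongr; nlinarith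
    nlinarith
  have hdec : ((g * h : unitaryGroup n ℂ) : Matrix n n ℂ) - 1 - ((s ^ 2 : ℝ) : ℂ) • (Y₁ + Y₂) =
      ((g : Matrix n n ℂ) - 1 - ((s ^ 2 : ℝ) : ℂ) • Y₁) * h +
        ((h : Matrix n n ℂ) - 1 - ((s ^ 2 : ℝ) : ℂ) • Y₂) +
        (((s ^ 2 : ℝ) : ℂ) • Y₁) * ((h : Matrix n n ℂ) - 1) := by
    rw [UnitaryGroup.mul_val, smul_add]; noncomm_ring
  rw [hdec]
  calc _ ≤ K₁ * s ^ 3 + K₂ * s ^ 3 + (s ^ 2 * B) * (s * (K₂ + B')) := by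
        refine (norm_add_le _ _).trans (add_le_add ((norm_add_le _ _).trans (add_le_add ?_ hh')) ?_)
        · exact (CStarRing.norm_mul_coe_unitary _ h).le.trans hg'
        · refine (norm_mul_le _ _).trans ?_
          have := hsn Y₁ B hY₁
          gcongr
    _ = _ := by ring

theorem isReachable_zero : IsReachable 0 0 (0 : Matrix n n ℂ) := by
  intro s _ _ N _
  exact ⟨1, by simp, by simp⟩

theorem exists_isReachable_sum {ι : Type*} [DecidableEq ι] (S : Finset ι) (t : ℕ) (K B : ℝ)
    (hK : 0 ≤ K) (hB : 0 ≤ B) :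
    ∃ K' : ℝ, 0 ≤ K' ∧ ∀ Y : ι → Matrix n n ℂ, (∀ i ∈ S, IsReachable t K (Y i) ∧ ‖Y i‖ ≤ B) →
      IsReachable (t * S.card) K' (∑ i ∈ S, Y i) := by
  induction S using Finset.induction_on with
  | empty => exact ⟨0, le_rfl, fun Y _ => by simpa using isReachable_zero⟩
  | insert a S ha ih =>
    obtain ⟨K', hK', h⟩ := ih
    refine ⟨K + K' + B * (K' + S.card • B), by positivity, fun Y hY => ?_⟩
    rw [Finset.sum_insert ha, Finset.card_insert_of_notMem ha, mul_add, mul_one, add_comm]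
    have hS : ∀ i ∈ S, IsReachable t K (Y i) ∧ ‖Y i‖ ≤ B :=
      fun i hi => hY i (Finset.mem_insert_of_mem hi)
    have ha' := hY a (Finset.mem_insert_self a S)
    exact ha'.1.add (h Y hS) hK' ha'.2 (norm_sum_le_of_le S (fun i hi => (hS i hi).2) |>.trans
      (by simp))

theorem norm_single_le {m : Type} [Fintype m] [DecidableEq m] (i : m) (j : n) (c : ℂ) :
    ‖(single i j c : Matrix m n ℂ)‖ ≤ ‖c‖ := by
  have h := l2_opNorm_conjTranspose_mul_self (single i j c : Matrix m n ℂ)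
  rw [conjTranspose_single, single_mul_single_same, ← diagonal_single, l2_opNorm_diagonal,
    Pi.norm_single, norm_mul, norm_star] at h
  nlinarith [norm_nonneg (single i j c : Matrix m n ℂ), norm_nonneg c]

theorem norm_entry_le (M : Matrix n n ℂ) (i j : n) : ‖M i j‖ ≤ ‖M‖ := by
  have h := l2_opNorm_mulVec M (EuclideanSpace.single j 1)
  refine le_trans ?_ (h.trans_eq (by simp))
  refine le_trans (le_of_eq ?_) (PiLp.norm_apply_le _ i)
  simp

theorem norm_le_sum_entries (M : Matrix n n ℂ) : ‖M‖ ≤ ∑ i, ∑ j, ‖M i j‖ := by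
  conv_lhs => rw [matrix_eq_sum_single M]
  exact norm_sum_le_of_le _ fun i _ => norm_sum_le_of_le _ fun j _ => norm_single_le i j _

omit [Fintype n] in
theorem single_sub_single_mem_skewAdjoint (i j : n) (c : ℂ) :
    single i j c - single j i (star c) ∈ skewAdjoint (Matrix n n ℂ) := by
  rw [skewAdjoint.mem_iff, star_sub, star_eq_conjTranspose, star_eq_conjTranspose,
    conjTranspose_single, conjTranspose_single, star_star, neg_sub]

/-- A commutator with the diagonal matrix unit `i E_jj` gives the off-diagonal two-level matrices. -/
theorem isReachable_offDiag {j k : n} (hjk : j ≠ k) (c : ℂ) (hc : ‖c‖ ≤ 1 / 2) :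
    IsReachable 4 124 (single j k c - single k j (star c)) := by
  have hP : (single j j Complex.I : Matrix n n ℂ) ∈ skewAdjoint (Matrix n n ℂ) := by
    rw [skewAdjoint.mem_iff, star_eq_conjTranspose, conjTranspose_single, single_neg]
    simp
  have h := isReachable_commutator _ _ hP
    (single_sub_single_mem_skewAdjoint j k (-Complex.I * c))
    ((norm_single_le _ _ _).trans (by simp)) ?_
  · convert h using 1
    simp only [mul_sub, sub_mul, single_mul_single_same, single_mul_single_of_ne _ _ _ _ hjk,
      single_mul_single_of_ne _ _ _ _ hjk.symm]
    have e : Complex.I * (starRingEnd ℂ) c * Complex.I = -(starRingEnd ℂ) c := by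
      linear_combination (starRingEnd ℂ) c * Complex.I_mul_I
    simp [← mul_assoc, e, single_neg, sub_eq_add_neg]
  · refine (norm_sub_le _ _).trans ((add_le_add (norm_single_le _ _ _)
        (norm_single_le _ _ _)).trans ?_)
    simp
    linarith

/-- A commutator of two off-diagonal matrices on the levels `j` and `o` gives the traceless diagonal
ones. -/
theorem isReachable_diag {j o : n} (hjo : j ≠ o) (d : ℝ) (hd : |d| ≤ 1 / 2) :
    IsReachable 4 124 (single j j (d * Complex.I) - single o o (d * Complex.I)) := by
  have h := isReachable_commutator _ _ (single_sub_single_mem_skewAdjoint j o (d : ℂ))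
    (single_sub_single_mem_skewAdjoint j o (Complex.I / 2)) ?_ ?_
  · convert h using 1
    simp only [mul_sub, sub_mul, single_mul_single_same, single_mul_single_of_ne _ _ _ _ hjo,
      single_mul_single_of_ne _ _ _ _ hjo.symm]
    ext a b
    simp [single_apply]
    split_ifs <;> ring
  · refine (norm_sub_le _ _).trans ((add_le_add (norm_single_le _ _ _)
        (norm_single_le _ _ _)).trans ?_)
    simp
    linarith
  · refine (norm_sub_le _ _).trans ((add_le_add (norm_single_le _ _ _)
        (norm_single_le _ _ _)).trans ?_)
    simp
    norm_num

/-- Traceless skew-adjoint directions are sums of commutators of two-level matrices, hence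
uniformly reachable. -/
theorem exists_isReachable_of_trace_eq_zero (n : Type) [Fintype n] [DecidableEq n] [Nonempty n] :
    ∃ (t : ℕ) (K : ℝ), 0 ≤ K ∧ ∀ Y : Matrix n n ℂ, Y ∈ skewAdjoint (Matrix n n ℂ) → Y.trace = 0 →
      ‖Y‖ ≤ 1 / 2 → IsReachable t K Y := by
  obtain ⟨o⟩ := ‹Nonempty n›
  obtain ⟨K, hK, h⟩ := exists_isReachable_sum (n := n) (Finset.univ : Finset (n × n)) 4 124 1
    (by norm_num) (by norm_num)
  refine ⟨4 * (Finset.univ : Finset (n × n)).card, K, hK, fun Y hY hT hn => ?_⟩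
  have hstar : ∀ i j, star (Y i j) = - Y j i := fun i j => by
    have := congrArg (fun M : Matrix n n ℂ => M j i) (skewAdjoint.mem_iff.1 hY)
    simpa [star_apply] using this
  set Z : n × n → Matrix n n ℂ := fun p => if p.1 = p.2 then
      single p.1 p.1 (Y p.1 p.1) - single o o (Y p.1 p.1)
    else single p.1 p.2 (Y p.1 p.2 / 2) - single p.2 p.1 (star (Y p.1 p.2 / 2)) with hZ
  have hsum : Y = ∑ p, Z p := by
    have hZ' : ∀ p, Z p = single p.1 p.2 (Y p.1 p.2 / 2) + single p.2 p.1 (Y p.2 p.1 / 2) -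
        if p.1 = p.2 then single o o (Y p.1 p.1) else 0 := by
      rintro ⟨j, k⟩
      simp only [hZ]
      split_ifs with hjk
      · subst hjk
        rw [← single_add, add_halves]
      · rw [sub_zero, show star (Y j k / 2) = -(Y k j / 2) by
          rw [star_div₀, hstar, neg_div]; simp, ← single_neg, sub_neg_eq_add]
    have h1 : ∑ p : n × n, single p.1 p.2 (Y p.1 p.2 / 2) = (1 / 2 : ℂ) • Y := by
      rw [Fintype.sum_prod_type]
      conv_rhs => rw [matrix_eq_sum_single Y]
      simp only [Finset.smul_sum, smul_single, smul_eq_mul]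
      simp only [div_eq_inv_mul, mul_one]
    have h2 : ∑ p : n × n, single p.2 p.1 (Y p.2 p.1 / 2) = (1 / 2 : ℂ) • Y := by
      rw [← h1]
      exact Equiv.sum_comp (Equiv.prodComm n n) (fun p : n × n => single p.1 p.2 (Y p.1 p.2 / 2))
    have h3 : ∑ p : n × n, (if p.1 = p.2 then single o o (Y p.1 p.1) else (0 : Matrix n n ℂ)) =
        0 := by
      rw [Fintype.sum_prod_type]
      simp only [Finset.sum_ite_eq, Finset.mem_univ, if_true]
      have := (map_sum (singleAddMonoidHom o o : ℂ →+ Matrix n n ℂ)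
          (fun x => Y x x) Finset.univ).symm
      rw [show ∑ x, Y x x = 0 from hT, map_zero] at this
      exact this
    rw [Finset.sum_congr rfl fun p _ => hZ' p, Finset.sum_sub_distrib, Finset.sum_add_distrib,
      h1, h2, h3, sub_zero, ← add_smul]
    norm_num
  rw [hsum]
  refine h Z fun p _ => ?_
  have hent : ‖Y p.1 p.2‖ ≤ 1 / 2 := (norm_entry_le _ _ _).trans hn
  have hn1 : ‖Z p‖ ≤ 1 := by
    simp only [hZ]
    split_ifs with hp
    · rw [← hp] at hent
      exact (norm_sub_le _ _).trans ((add_le_add (norm_single_le _ _ _)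
        (norm_single_le _ _ _)).trans
        (by linarith))
    · refine (norm_sub_le _ _).trans ((add_le_add (norm_single_le _ _ _)
          (norm_single_le _ _ _)).trans ?_)
      rw [norm_star, norm_div, Complex.norm_ofNat]
      linarith
  refine ⟨?_, hn1⟩
  simp only [hZ]
  split_ifs with hp
  · by_cases hpo : p.1 = o
    · rw [hpo, sub_self]
      have := isReachable_commutator (0 : Matrix n n ℂ) 0 (zero_mem _) (zero_mem _)
        (by simp) (by simp)
      simpa using this
    · have him : Y p.1 p.1 = ((Y p.1 p.1).im : ℂ) * Complex.I := by
        have := hstar p.1 p.1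
        apply Complex.ext
        · have := congrArg Complex.re this
          simp at this ⊢
          linarith
        · simp
      rw [him]
      rw [← hp] at hent
      exact isReachable_diag hpo _ ((Complex.abs_im_le_norm _).trans hent)
  · exact isReachable_offDiag hp _ (by rw [norm_div, Complex.norm_ofNat]; linarith)

/-- The scalar unitary `exp (iθ)`. -/
def phase (n : Type) [Fintype n] [DecidableEq n] (θ : ℝ) : unitaryGroup n ℂ :=
  ⟨Complex.exp (θ * Complex.I) • (1 : Matrix n n ℂ), by
    rw [mem_unitaryGroup_iff, star_smul, star_one, smul_mul_smul_comm, mul_one]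
    simp [Complex.mul_conj, Complex.normSq_eq_norm_sq, Complex.norm_exp_ofReal_mul_I]⟩

theorem phase_mul_coe (θ : ℝ) (U : unitaryGroup n ℂ) :
    ((phase n θ * U : unitaryGroup n ℂ) : Matrix n n ℂ) =
      Complex.exp (θ * Complex.I) • (U : Matrix n n ℂ) := by
  simp [phase]

/-- Stability of a set of unitaries under multiplication by global phases. -/
def PhaseClosed (N : Set (unitaryGroup n ℂ)) : Prop :=
  ∀ θ : ℝ, ∀ U ∈ N, phase n θ * U ∈ N

theorem PhaseClosed.pow {N : Set (unitaryGroup n ℂ)} (h : PhaseClosed N) {t : ℕ} (ht : t ≠ 0) :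
    PhaseClosed (N ^ t) := by
  obtain ⟨t, rfl⟩ := Nat.exists_eq_succ_of_ne_zero ht
  intro θ U hU
  rw [Nat.succ_eq_add_one, pow_succ'] at hU ⊢
  obtain ⟨V, hV, W, hW, rfl⟩ := Set.mem_mul.1 hU
  rw [← mul_assoc]
  exact Set.mul_mem_mul (h θ V hV) hW

theorem phase_mul_comm (θ : ℝ) (U : unitaryGroup n ℂ) : phase n θ * U = U * phase n θ := by
  apply Subtype.ext
  simp [phase]

theorem phase_neg (θ : ℝ) : (phase n θ)⁻¹ = phase n (-θ) := by
  apply Subtype.ext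
  simp [phase, ← Complex.exp_conj]

theorem PhaseClosed.union_inv {N : Set (unitaryGroup n ℂ)} (h : PhaseClosed N) :
    PhaseClosed (N ∪ N⁻¹) := by
  rintro θ U (hU | hU)
  · exact Or.inl (h θ U hU)
  · right
    rw [Set.mem_inv] at hU ⊢
    rw [_root_.mul_inv_rev, phase_neg, ← phase_mul_comm]
    exact h _ _ hU

/-- One step of the Solovay–Kitaev iteration: a sufficiently fine net is refined by a constant
factor, at the price of words of constant length. -/
theorem exists_net_refinement (n : Type) [Fintype n] [DecidableEq n] [Nonempty n] :
    ∃ (t : ℕ) (s₀ : ℝ), t ≠ 0 ∧ 0 < s₀ ∧ s₀ ≤ 1 ∧ ∀ s, 0 < s → s ≤ s₀ →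
      ∀ N : Set (unitaryGroup n ℂ), PhaseClosed N → IsNet N (s ^ 2) →
        IsNet ((N ∪ N⁻¹) ^ t) ((s / 2) ^ 2) := by
  obtain ⟨t, K, hK, hreach⟩ := exists_isReachable_of_trace_eq_zero n
  refine ⟨t + 1, 1 / (32 * K + 32), by simp, by positivity, ?_, ?_⟩
  · rw [div_le_one (by positivity)]; linarith
  intro s hs0 hs N hph hN U
  have hsK : s * (32 * K + 32) ≤ 1 := by rwa [le_div_iff₀ (by positivity)] at hs
  have hs1 : s ≤ 1 / 2 := by nlinarith [mul_nonneg hs0.le hK]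
  obtain ⟨W, hW, hUW⟩ := hN U
  -- `U * W⁻¹ = 1 + X` with `‖X‖ ≤ s²`; up to order `s⁴`, `X` is its skew-adjoint part `Y`.
  set X : Matrix n n ℂ := ((U * W⁻¹ : unitaryGroup n ℂ) : Matrix n n ℂ) - 1 with hX
  have hXn : ‖X‖ ≤ s ^ 2 := by
    have e : X = ((U : Matrix n n ℂ) - W) * (W⁻¹ : unitaryGroup n ℂ) := by
      have : (1 : Matrix n n ℂ) = ((W * W⁻¹ : unitaryGroup n ℂ) : Matrix n n ℂ) := by
        rw [mul_inv_cancel]; rfl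
      rw [hX, this]
      simp only [UnitaryGroup.mul_val]; noncomm_ring
    rw [e]
    exact (CStarRing.norm_mul_coe_unitary _ W⁻¹).le.trans hUW
  set Y : Matrix n n ℂ := (1 / 2 : ℂ) • (X - star X) with hY
  have hYskew : Y ∈ skewAdjoint (Matrix n n ℂ) := by
    rw [skewAdjoint.mem_iff, hY, star_smul, star_sub, star_star, ← smul_neg, neg_sub]
    simp
  have hYn : ‖Y‖ ≤ s ^ 2 := by
    rw [hY, norm_smul]
    have := norm_sub_le X (star X)
    rw [norm_star] at this
    norm_num
    linarith
  have hXY : ‖X - Y‖ ≤ s ^ 4 := by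
    have e : X - Y = -((1 / 2 : ℂ) • (star X * X)) := by
      have h1 : star X * X = -(star X + X) := by
        have := UnitaryGroup.star_mul_self (U * W⁻¹)
        rw [show (U * W⁻¹ : unitaryGroup n ℂ).1 = X + 1 by rw [hX]; abel] at this
        rw [star_add, star_one] at this
        have h2 : (star X + 1) * (X + 1) = star X * X + star X + X + 1 := by noncomm_ring
        rw [h2] at this
        rw [eq_neg_iff_add_eq_zero, ← add_assoc]
        exact add_eq_right.1 this
      rw [h1, hY]
      module
    rw [e, norm_neg, norm_smul]
    have := norm_mul_le (star X) X
    rw [norm_star] at this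
    have h2 : ‖X‖ * ‖X‖ ≤ s ^ 2 * s ^ 2 := by gcongr
    norm_num
    nlinarith [sq_nonneg (s ^ 2)]
  -- the trace of the skew-adjoint part is removed by a global phase
  set β : ℝ := (Y.trace / Fintype.card n).im with hβ
  have hcard : (0 : ℝ) < Fintype.card n := by exact_mod_cast Fintype.card_pos
  have hcardC : (Fintype.card n : ℂ) ≠ 0 := by exact_mod_cast hcard.ne'
  have hβI : (β : ℂ) * Complex.I = Y.trace / Fintype.card n := by
    have h1 : star (Y.trace / Fintype.card n) = -(Y.trace / Fintype.card n) := by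
      rw [star_div₀, ← trace_conjTranspose, ← star_eq_conjTranspose, skewAdjoint.mem_iff.1 hYskew,
        trace_neg, neg_div]
      simp
    apply Complex.ext
    · have := congrArg Complex.re h1
      simp only [Complex.star_def, Complex.conj_re, Complex.neg_re] at this
      rw [show (Y.trace / Fintype.card n).re = 0 by linarith]
      simp
    · simp [hβ]
  have hβs : |β| ≤ s ^ 2 := by
    have h1 : ‖Y.trace‖ ≤ Fintype.card n * s ^ 2 := by
      refine (norm_sum_le_of_le (f := fun i => Y i i) Finset.univ (n := fun _ => s ^ 2)
        fun i _ => (norm_entry_le Y i i).trans hYn).trans ?_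
      simp
    refine (Complex.abs_im_le_norm _).trans ?_
    rw [norm_div, Complex.norm_natCast, div_le_iff₀ hcard]
    linarith
  set Y' : Matrix n n ℂ := Y - (β * Complex.I) • 1 with hY'
  have hY'n : ‖Y'‖ ≤ 2 * s ^ 2 := by
    have h1 : ‖((β : ℂ) * Complex.I) • (1 : Matrix n n ℂ)‖ ≤ s ^ 2 := by
      rw [norm_smul, CStarRing.norm_one, mul_one, norm_mul, Complex.norm_I, mul_one,
        Complex.norm_real]
      exact hβs
    exact (norm_sub_le _ _).trans (by linarith)
  have hs2 : (((2 * s) ^ 2 : ℝ) : ℂ) ≠ 0 := by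
    exact_mod_cast (by positivity : (2 * s) ^ 2 ≠ 0)
  set Z : Matrix n n ℂ := (((2 * s) ^ 2 : ℝ) : ℂ)⁻¹ • Y' with hZ
  have hYZ : (((2 * s) ^ 2 : ℝ) : ℂ) • Z = Y' := by rw [hZ, smul_inv_smul₀ hs2]
  have hskewZ : Z ∈ skewAdjoint (Matrix n n ℂ) := by
    rw [skewAdjoint.mem_iff, hZ, hY', star_smul, star_sub, skewAdjoint.mem_iff.1 hYskew, star_smul,
      star_one, star_inv₀, show star (((2 * s) ^ 2 : ℝ) : ℂ) = (((2 * s) ^ 2 : ℝ) : ℂ) from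
        Complex.conj_ofReal _, show star ((β : ℂ) * Complex.I) = -(β * Complex.I) by simp]
    module
  have htrZ : Z.trace = 0 := by
    rw [hZ, hY', trace_smul, trace_sub, trace_smul (_ * _), trace_one, hβI, smul_eq_mul,
      smul_eq_mul,
      div_mul_cancel₀ _ hcardC, sub_self, mul_zero]
  have hZn : ‖Z‖ ≤ 1 / 2 := by
    rw [hZ, norm_smul, norm_inv, Complex.norm_real, Real.norm_of_nonneg (by positivity),
      inv_mul_le_iff₀ (by positivity)]
    linarith
  obtain ⟨g, hg, hgZ⟩ := hreach Z hskewZ htrZ hZn (2 * s) (by positivity) (by linarith) N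
    (hN.mono (by nlinarith))
  rw [hYZ] at hgZ
  refine ⟨g * (phase n β * W), ?_, ?_⟩
  · rw [pow_succ]
    exact Set.mul_mem_mul hg (Or.inl (hph β W hW))
  set z : ℂ := Complex.exp (β * Complex.I) with hz
  have hz1 : ‖z‖ = 1 := Complex.norm_exp_ofReal_mul_I β
  have hzβ : ‖z - 1 - β * Complex.I‖ ≤ s ^ 4 := by
    have hn : ‖(β : ℂ) * Complex.I‖ = |β| := by simp
    have := Complex.norm_exp_sub_one_sub_id_le (x := β * Complex.I) (by rw [hn]; nlinarith)
    rw [hn] at this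
    refine this.trans ?_
    have h3 : |β| ^ 2 ≤ (s ^ 2) ^ 2 := by gcongr
    linarith [h3]
  have hz' : ‖z - 1‖ ≤ 2 * s ^ 2 := by
    have := norm_add_le (z - 1 - β * Complex.I) (β * Complex.I)
    rw [sub_add_cancel] at this
    have hn : ‖(β : ℂ) * Complex.I‖ = |β| := by simp
    rw [hn] at this
    have h4 : s ^ 4 ≤ s ^ 2 := pow_le_pow_of_le_one hs0.le (by linarith) (by norm_num)
    linarith
  have hfac : (U : Matrix n n ℂ) - ((g * (phase n β * W) : unitaryGroup n ℂ) : Matrix n n ℂ) =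
      (X + 1 - z • (g : Matrix n n ℂ)) * W := by
    rw [hX, sub_add_cancel, sub_mul]
    congr 1
    · rw [← UnitaryGroup.mul_val, inv_mul_cancel_right]
    · rw [UnitaryGroup.mul_val, phase_mul_coe, mul_smul_comm, smul_mul_assoc]
  have hdec : X + 1 - z • (g : Matrix n n ℂ) =
      (X - Y) - (z • ((g : Matrix n n ℂ) - 1 - Y') + (z - 1 - β * Complex.I) • 1 + (z - 1) • Y') := by
    rw [hY']; module
  rw [hfac, CStarRing.norm_mul_coe_unitary, hdec]
  calc _ ≤ s ^ 4 + (K * (2 * s) ^ 3 + s ^ 4 + (2 * s ^ 2) * (2 * s ^ 2)) := by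
        refine (norm_sub_le _ _).trans (add_le_add hXY ?_)
        refine (norm_add₃_le).trans (add_le_add (add_le_add ?_ ?_) ?_)
        · rw [norm_smul, hz1, one_mul]; exact hgZ
        · rw [norm_smul, CStarRing.norm_one, mul_one]; exact hzβ
        · rw [norm_smul]; gcongr
    _ = s ^ 2 * (s * (8 * K + 6 * s)) := by ring
    _ ≤ s ^ 2 * (1 / 4) := by
        gcongr
        nlinarith
    _ = (s / 2) ^ 2 := by ring

/-- Iterating the refinement: the precision `2⁻ᵏ` is reached by words whose length is exponential
in `k`. -/
theorem exists_isNet_union_inv_pow (n : Type) [Fintype n] [DecidableEq n] [Nonempty n] :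
    ∃ (t : ℕ) (δ : ℝ), t ≠ 0 ∧ 0 < δ ∧ ∀ A : Set (unitaryGroup n ℂ), PhaseClosed A → IsNet A δ →
      ∀ k : ℕ, IsNet ((A ∪ A⁻¹) ^ (t ^ k)) ((1 / 2) ^ k) := by
  obtain ⟨t, s₀, ht, hs0, hs1, h⟩ := exists_net_refinement n
  refine ⟨t, s₀ ^ 2, ht, by positivity, fun A hA hnet k => ?_⟩
  have key : ∀ k : ℕ, IsNet ((A ∪ A⁻¹) ^ (t ^ k)) ((s₀ / 2 ^ k) ^ 2) := by
    intro k
    induction k with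
    | zero =>
      intro U
      obtain ⟨W, hW, hUW⟩ := hnet U
      exact ⟨W, by simpa using Or.inl hW, by simpa using hUW⟩
    | succ k ih =>
      have hsymm : ((A ∪ A⁻¹) ^ (t ^ k))⁻¹ = (A ∪ A⁻¹) ^ (t ^ k) := by
        rw [← inv_pow, Set.union_inv, inv_inv, Set.union_comm]
      have := h (s₀ / 2 ^ k) (by positivity) (div_le_self hs0.le (one_le_pow₀ (by norm_num)))
        ((A ∪ A⁻¹) ^ (t ^ k)) (hA.union_inv.pow (pow_ne_zero _ ht)) ih
      rw [hsymm, Set.union_self, ← pow_mul, ← pow_succ, div_div, ← pow_succ] at this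
      exact this
  refine (key k).mono ?_
  have h2 : (0 : ℝ) < 2 ^ k := by positivity
  rw [div_pow, _root_.one_div_pow]
  have h3 : s₀ ^ 2 ≤ 1 := pow_le_one₀ hs0.le hs1
  have h4 : (2 : ℝ) ^ k ≤ (2 ^ k) ^ 2 := le_self_pow₀ (one_le_pow₀ (by norm_num)) (by norm_num)
  gcongr

/-- The inverse of a unitary is approximated by its own powers, with an exponent polynomial in the
precision: two of the first powers fall into the same cell of a grid on the matrix entries. -/
theorem exists_pow_near_inv (U : unitaryGroup n ℂ) (K : ℕ) (hK : 0 < K) :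
    ∃ p ≤ (4 * Fintype.card n ^ 2 * K + 1) ^ (2 * Fintype.card n ^ 2),
      ‖((U⁻¹ : unitaryGroup n ℂ) : Matrix n n ℂ) - (U ^ p : unitaryGroup n ℂ)‖ ≤ 1 / K := by
  set D := Fintype.card n with hD
  rcases isEmpty_or_nonempty n with hn | hn
  · exact ⟨0, Nat.zero_le _, by rw [Subsingleton.elim (_ - _ : Matrix n n ℂ) 0]; simp⟩
  have hDpos : 0 < D := Fintype.card_pos
  -- The grid has mesh `1 / L` in the real and imaginary parts of the `D ^ 2` entries, so that
  -- unitaries in one cell differ by at most `D ^ 2 * (2 / L) = 1 / K` in norm.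
  set L : ℕ := 2 * D ^ 2 * K with hL
  have hLpos : 0 < L := by positivity
  set M : ℕ := (4 * D ^ 2 * K + 1) ^ (2 * D ^ 2) with hM
  let part : Bool → ℂ → ℝ := fun b z => if b then z.re else z.im
  have hpart : ∀ b z, |part b z| ≤ ‖z‖ := by
    intro b z; cases b
    · exact Complex.abs_im_le_norm z
    · exact Complex.abs_re_le_norm z
  have hfl : ∀ (V : unitaryGroup n ℂ) (x : (n × n) × Bool),
      ⌊L * part x.2 (V x.1.1 x.1.2)⌋ ∈ Finset.Icc (-(L : ℤ)) L := by
    intro V x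
    have h1 : |part x.2 (V x.1.1 x.1.2)| ≤ 1 :=
      (hpart _ _).trans ((norm_entry_le _ _ _).trans (norm_unitary_le V))
    rw [abs_le] at h1
    have hL' : (0 : ℝ) < L := by exact_mod_cast hLpos
    rw [Finset.mem_Icc]
    constructor
    · rw [Int.le_floor]; push_cast; nlinarith
    · rw [← Int.cast_le (R := ℝ)]
      refine (Int.floor_le _).trans ?_
      push_cast; nlinarith
  let f : Fin (M + 1) → ((n × n) × Bool → Finset.Icc (-(L : ℤ)) L) := fun a x =>
    ⟨⌊L * part x.2 ((U ^ (a : ℕ) : unitaryGroup n ℂ) x.1.1 x.1.2)⌋, hfl _ x⟩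
  have hcard : Fintype.card ((n × n) × Bool → Finset.Icc (-(L : ℤ)) L) < Fintype.card
      (Fin (M + 1)) := by
    rw [Fintype.card_fun, Fintype.card_coe, Int.card_Icc, Fintype.card_prod, Fintype.card_prod,
      Fintype.card_bool, Fintype.card_fin, ← hD]
    rw [show ((L : ℤ) + 1 - -(L : ℤ)).toNat = 4 * D ^ 2 * K + 1 by
        rw [show 4 * D ^ 2 * K = L + L by rw [hL]; ring]; omega,
      show D * D * 2 = 2 * D ^ 2 by ring]
    exact Nat.lt_succ_self _
  obtain ⟨a, b, hab, hfab⟩ := Fintype.exists_ne_map_eq_of_card_lt f hcard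
  have main : ∀ a b : Fin (M + 1), (a : ℕ) < b → f a = f b → ∃ p ≤ M,
      ‖((U⁻¹ : unitaryGroup n ℂ) : Matrix n n ℂ) - (U ^ p : unitaryGroup n ℂ)‖ ≤ 1 / K := by
    intro a b hlt hfab
    refine ⟨b - a - 1, by omega, ?_⟩
    have hent : ∀ i j, ‖((U ^ (a : ℕ) : unitaryGroup n ℂ) : Matrix n n ℂ) i j -
        ((U ^ (b : ℕ) : unitaryGroup n ℂ) : Matrix n n ℂ) i j‖ ≤ 2 / L := by
      intro i j
      have hb : ∀ c : Bool, |part c ((U ^ (a : ℕ) : unitaryGroup n ℂ) i j) -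
          part c ((U ^ (b : ℕ) : unitaryGroup n ℂ) i j)| ≤ 1 / L := by
        intro c
        have h1 := congrArg Subtype.val (congrFun hfab ((i, j), c))
        have h2 := Int.abs_sub_lt_one_of_floor_eq_floor h1
        simp only at h2
        have hL' : (0 : ℝ) < L := by exact_mod_cast hLpos
        rw [← mul_sub, abs_mul, abs_of_pos hL'] at h2
        rw [le_div_iff₀ hL']
        linarith
      refine (Complex.norm_le_abs_re_add_abs_im _).trans ?_
      have h1 := hb true
      have h2 := hb false
      simp only [part, if_true, Bool.false_eq_true, if_false] at h1 h2
      rw [Complex.sub_re, Complex.sub_im]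
      calc _ ≤ (1 : ℝ) / L + 1 / L := add_le_add h1 h2
        _ = 2 / L := by ring
    have hnorm : ‖((U ^ (a : ℕ) : unitaryGroup n ℂ) : Matrix n n ℂ) -
        (U ^ (b : ℕ) : unitaryGroup n ℂ)‖ ≤ 1 / K := by
      refine (norm_le_sum_entries _).trans ?_
      calc _ ≤ ∑ i : n, ∑ j : n, (2 : ℝ) / L :=
            Finset.sum_le_sum fun i _ => Finset.sum_le_sum fun j _ => hent i j
        _ = 1 / K := by
            simp only [Finset.sum_const, Finset.card_univ, ← hD, nsmul_eq_mul, hL]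
            push_cast
            have : (D : ℝ) ≠ 0 := by positivity
            field_simp
    have e : U ^ (b : ℕ) = U ^ ((a : ℕ) + 1) * U ^ ((b : ℕ) - a - 1) := by
      rw [← pow_add]; congr 1; omega
    have e2 : U ^ (a : ℕ) = U ^ ((a : ℕ) + 1) * U⁻¹ := by rw [pow_succ]; group
    rw [e, e2, UnitaryGroup.mul_val, UnitaryGroup.mul_val, ← mul_sub,
      CStarRing.norm_coe_unitary_mul] at hnorm
    exact hnorm
  rcases lt_or_gt_of_ne (fun h => hab (Fin.ext h) : (a : ℕ) ≠ b) with h | h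
  · exact main a b h hfab
  · exact main b a h hfab.symm

/-- The union of `A` with its inverses is approximated by words in `A` alone. -/
theorem exists_mem_pow_near {A : Set (unitaryGroup n ℂ)} (h1 : 1 ∈ A) (K : ℕ) (hK : 0 < K) (T : ℕ)
    {U : unitaryGroup n ℂ} (hU : U ∈ (A ∪ A⁻¹) ^ T) :
    ∃ W ∈ A ^ (T * (4 * Fintype.card n ^ 2 * K + 1) ^ (2 * Fintype.card n ^ 2)),
      ‖(U : Matrix n n ℂ) - W‖ ≤ T / K := by
  set M : ℕ := (4 * Fintype.card n ^ 2 * K + 1) ^ (2 * Fintype.card n ^ 2) with hM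
  have hM1 : 1 ≤ M := Nat.one_le_pow _ _ (by omega)
  induction T generalizing U with
  | zero =>
    refine ⟨1, by simp, ?_⟩
    rw [pow_zero, Set.mem_one] at hU
    simp [hU]
  | succ T ih =>
    rw [pow_succ] at hU
    obtain ⟨V, hV, X, hX, rfl⟩ := Set.mem_mul.1 hU
    obtain ⟨W, hW, hVW⟩ := ih hV
    have hX' : ∃ Y ∈ A ^ M, ‖(X : Matrix n n ℂ) - Y‖ ≤ 1 / K := by
      rcases hX with hX | hX
      · exact ⟨X, Set.pow_subset_pow_right h1 hM1 (by simpa using hX), by simp⟩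
      · obtain ⟨p, hp, hpX⟩ := exists_pow_near_inv X⁻¹ K hK
        rw [inv_inv] at hpX
        exact ⟨X⁻¹ ^ p, Set.pow_subset_pow_right h1 hp (Set.pow_mem_pow hX), hpX⟩
    obtain ⟨Y, hY, hXY⟩ := hX'
    refine ⟨W * Y, ?_, (norm_unitary_mul_sub_mul_le _ _ _ _).trans ?_⟩
    · rw [add_mul, one_mul, pow_add]
      exact Set.mul_mem_mul hW hY
    · push_cast
      rw [add_div]
      exact add_le_add hVW hXY

/-- Solovay–Kitaev with a polynomial rate: words of length `R ^ (k + 1)` in a sufficiently dense set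
are `2⁻ᵏ`-dense. -/
theorem exists_isNet_pow (n : Type) [Fintype n] [DecidableEq n] [Nonempty n] :
    ∃ (R : ℕ) (δ : ℝ), 0 < R ∧ 0 < δ ∧ ∀ A : Set (unitaryGroup n ℂ), 1 ∈ A → PhaseClosed A →
      IsNet A δ → ∀ k : ℕ, IsNet (A ^ (R ^ (k + 1))) ((1 / 2) ^ k) := by
  obtain ⟨t, δ, ht, hδ, h⟩ := exists_isNet_union_inv_pow n
  set D := Fintype.card n with hD
  have ht' : 0 < t := Nat.pos_of_ne_zero ht
  refine ⟨t * ((4 * D ^ 2 + 1) * (2 * t)) ^ (2 * D ^ 2), δ, by positivity, hδ,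
    fun A h1 hA hnet k U => ?_⟩
  obtain ⟨V, hV, hUV⟩ := h A hA hnet (k + 1) U
  obtain ⟨W, hW, hVW⟩ := exists_mem_pow_near h1 (2 ^ (k + 1) * t ^ (k + 1)) (by positivity) _ hV
  refine ⟨W, Set.pow_subset_pow_right h1 ?_ hW, ?_⟩
  · rw [mul_pow, ← pow_mul, mul_comm (2 * D ^ 2), pow_mul _ (k + 1) (2 * D ^ 2)]
    refine Nat.mul_le_mul_left _ (Nat.pow_le_pow_left ?_ _)
    rw [mul_pow, mul_pow]
    have h3 : 4 * D ^ 2 + 1 ≤ (4 * D ^ 2 + 1) ^ (k + 1) := Nat.le_self_pow (by simp) _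
    have h4 : 1 ≤ 2 ^ (k + 1) * t ^ (k + 1) := Nat.one_le_iff_ne_zero.2 (by positivity)
    nlinarith
  · have htp : (0 : ℝ) < (t : ℝ) ^ (k + 1) := by positivity
    have e : ((t ^ (k + 1) : ℕ) : ℝ) / ((2 ^ (k + 1) * t ^ (k + 1) : ℕ) : ℝ) =
        (1 / 2) ^ (k + 1) := by
      push_cast
      rw [_root_.one_div_pow]
      field_simp
    rw [e] at hVW
    have := norm_add_le ((U : Matrix n n ℂ) - V) ((V : Matrix n n ℂ) - W)
    rw [sub_add_sub_cancel] at this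
    refine this.trans ((add_le_add hUV hVW).trans_eq ?_)
    ring

end SolovayKitaev

/-! ### Circuits on subregisters -/

section Embedding

variable {p q r : Type} [Fintype p] [DecidableEq p] [Fintype q] [DecidableEq q] [Fintype r]
    [DecidableEq r]

/-- The operator on the register `q` that acts as `M` on the qubits `f i` and as the identity on all
others. -/
def embed (f : p ↪ q) (M : Matrix (Qubits p) (Qubits p) ℂ) : Matrix (Qubits q) (Qubits q) ℂ :=
  fun s t => if ∀ j, (∀ i, f i ≠ j) → s j = t j then M (fun i => s (f i)) (fun i => t (f i)) else 0

theorem applyGate_eq_embed {k : ℕ} (g : unitaryGroup (Qubits (Fin k)) ℂ) (f : Fin k ↪ q) :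
    applyGate g f = embed f (g : Matrix (Qubits (Fin k)) (Qubits (Fin k)) ℂ) := by
  ext s t
  simp [applyGate, embed]

omit [DecidableEq p] [Fintype q] [DecidableEq q] in
theorem splitQubits_bijective (f : p ↪ q) :
    Function.Bijective (fun s : Qubits q =>
      ((fun i => s (f i), fun j => s j.1) : Qubits p × Qubits {j // ∀ i, f i ≠ j})) := by
  classical
  constructor
  · intro s t h
    rw [Prod.mk.injEq] at h
    funext j
    by_cases hj : ∃ i, f i = j
    · obtain ⟨i, rfl⟩ := hj
      exact congrFun h.1 i
    · push Not at hj
      exact congrFun h.2 ⟨j, hj⟩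
  · rintro ⟨a, b⟩
    refine ⟨Function.extend f a fun j => if h : ∀ i, f i ≠ j then b ⟨j, h⟩ else 0, ?_⟩
    refine Prod.ext (funext fun i => by simp [f.injective.extend_apply]) (funext fun j => ?_)
    have hj : ¬ ∃ i, f i = j.1 := by push Not; exact j.2
    simp only [Function.extend_apply' _ _ _ hj, dif_pos j.2]

/-- The splitting of a register into the subregister selected by `f` and the other qubits. -/
def splitQubits (f : p ↪ q) : Qubits q ≃ Qubits p × Qubits {j // ∀ i, f i ≠ j} :=
  Equiv.ofBijective _ (splitQubits_bijective f)

omit [DecidableEq p] in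
theorem embed_eq_submatrix (f : p ↪ q) (M : Matrix (Qubits p) (Qubits p) ℂ) :
    embed f M = (M ⊗ₖ (1 : Matrix (Qubits {j // ∀ i, f i ≠ j}) _ ℂ)).submatrix
      (splitQubits f) (splitQubits f) := by
  ext s t
  simp [embed, splitQubits, kroneckerMap_apply, one_apply, funext_iff]

/-- `embed` as a homomorphism of star algebras. -/
def embedHom (f : p ↪ q) :
    Matrix (Qubits p) (Qubits p) ℂ →⋆ₐ[ℂ] Matrix (Qubits q) (Qubits q) ℂ where
  toFun := embed f
  map_one' := by rw [embed_eq_submatrix, one_kronecker_one, submatrix_one_equiv]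
  map_mul' M N := by
    simp only [embed_eq_submatrix]
    rw [submatrix_mul_equiv, ← mul_kronecker_mul, mul_one]
  map_zero' := by simp [embed_eq_submatrix]
  map_add' M N := by simp only [embed_eq_submatrix, add_kronecker]; rfl
  commutes' c := by
    simp only [embed_eq_submatrix, Algebra.algebraMap_eq_smul_one, smul_kronecker,
      one_kronecker_one, submatrix_smul, Pi.smul_apply, submatrix_one_equiv]
  map_star' M := by
    simp only [embed_eq_submatrix, star_eq_conjTranspose]
    rw [conjTranspose_submatrix, conjTranspose_kronecker, conjTranspose_one]

theorem embedHom_apply (f : p ↪ q) (M : Matrix (Qubits p) (Qubits p) ℂ) :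
    embedHom f M = embed f M := rfl

/-- `embed` on unitaries. -/
def embedUnitary (f : p ↪ q) : unitaryGroup (Qubits p) ℂ →* unitaryGroup (Qubits q) ℂ where
  toFun U := ⟨embed f U, Unitary.map_mem (embedHom f) U.2⟩
  map_one' := Subtype.ext (map_one (embedHom f))
  map_mul' U V := Subtype.ext (map_mul (embedHom f) U.1 V.1)

theorem embedUnitary_coe (f : p ↪ q) (U : unitaryGroup (Qubits p) ℂ) :
    (embedUnitary f U : Matrix (Qubits q) (Qubits q) ℂ) = embed f U := rfl

theorem embedUnitary_phase (f : p ↪ q) (θ : ℝ) :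
    embedUnitary f (phase (Qubits p) θ) = phase (Qubits q) θ := by
  apply Subtype.ext
  rw [embedUnitary_coe, ← embedHom_apply]
  simp [phase]

theorem norm_embedUnitary_sub_le (f : p ↪ q) (U V : unitaryGroup (Qubits p) ℂ) :
    ‖(embedUnitary f U : Matrix (Qubits q) (Qubits q) ℂ) - embedUnitary f V‖ ≤
      ‖(U : Matrix (Qubits p) (Qubits p) ℂ) - V‖ := by
  rw [embedUnitary_coe, embedUnitary_coe, ← embedHom_apply, ← embedHom_apply, ← map_sub]
  exact NonUnitalStarAlgHom.norm_apply_le (embedHom f) _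

omit [DecidableEq p] in
theorem embed_embed (g : p ↪ q) (f : q ↪ r) (M : Matrix (Qubits p) (Qubits p) ℂ) :
    embed f (embed g M) = embed (g.trans f) M := by
  ext s t
  simp only [embed, Function.Embedding.trans_apply, ← ite_and]
  congr 1
  rw [eq_iff_iff]
  constructor
  · rintro ⟨h1, h2⟩ j hj
    by_cases h : ∃ i, f i = j
    · obtain ⟨i, rfl⟩ := h
      exact h2 i fun k hk => hj k (by rw [hk])
    · push Not at h
      exact h1 j h
  · intro h
    exact ⟨fun j hj => h j fun i => hj _, fun i hi => h _ fun k hk => hi k (f.injective hk)⟩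

variable {G : GateSet}

theorem HasCircuit.embed {n : ℕ} {M : Matrix (Qubits p) (Qubits p) ℂ} (h : HasCircuit G n M)
    (f : p ↪ q) : HasCircuit G n (embed f M) := by
  induction h with
  | nil => rw [← embedHom_apply, map_one]; exact .nil
  | cons g hg f' h ih =>
    rw [← embedHom_apply, map_mul, embedHom_apply, embedHom_apply, applyGate_eq_embed, embed_embed,
      ← applyGate_eq_embed]
    exact .cons g hg _ ih

theorem HasCircuit.mul {n m : ℕ} {M N : Matrix (Qubits q) (Qubits q) ℂ} (hM : HasCircuit G n M)
    (hN : HasCircuit G m N) : HasCircuit G (n + m) (M * N) := by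
  induction hM with
  | nil => simpa using hN
  | cons g hg f h ih =>
    rw [mul_assoc, Nat.add_right_comm]
    exact .cons g hg f ih

theorem HasCircuit.mem_unitaryGroup {n : ℕ} {M : Matrix (Qubits q) (Qubits q) ℂ}
    (h : HasCircuit G n M) : M ∈ unitaryGroup (Qubits q) ℂ := by
  induction h with
  | nil => exact one_mem _
  | cons g hg f h ih =>
    rw [applyGate_eq_embed]
    exact mul_mem (embedUnitary f g).2 ih

/-- The unitaries that are, up to a global phase, circuits of at most `L` gates. -/
def circuits (G : GateSet) (q : Type) [Fintype q] [DecidableEq q] (L : ℕ) :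
    Set (unitaryGroup (Qubits q) ℂ) :=
  {U | ∃ (θ : ℝ) (n : ℕ), n ≤ L ∧
    HasCircuit G n ((phase (Qubits q) θ * U : unitaryGroup (Qubits q) ℂ) :
      Matrix (Qubits q) (Qubits q) ℂ)}

theorem phase_add {n : Type} [Fintype n] [DecidableEq n] (θ θ' : ℝ) :
    phase n (θ + θ') = phase n θ * phase n θ' := by
  apply Subtype.ext
  rw [phase_mul_coe]
  simp [phase, add_mul, Complex.exp_add, smul_smul]

theorem one_mem_circuits (L : ℕ) : 1 ∈ circuits G q L :=
  ⟨0, 0, Nat.zero_le _, by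
    have : phase (Qubits q) 0 * 1 = 1 := by apply Subtype.ext; simp [phase]
    rw [this]; exact .nil⟩

theorem circuits_mono {L L' : ℕ} (h : L ≤ L') : circuits G q L ⊆ circuits G q L' :=
  fun _ ⟨θ, n, hn, hc⟩ => ⟨θ, n, hn.trans h, hc⟩

theorem phaseClosed_circuits (L : ℕ) : PhaseClosed (circuits G q L) := by
  rintro θ U ⟨θ', n, hn, hc⟩
  refine ⟨θ' - θ, n, hn, ?_⟩
  rwa [← mul_assoc, ← phase_add, sub_add_cancel]

theorem mul_mem_circuits {L L' : ℕ} {U V : unitaryGroup (Qubits q) ℂ} (hU : U ∈ circuits G q L)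
    (hV : V ∈ circuits G q L') : U * V ∈ circuits G q (L + L') := by
  obtain ⟨θ, n, hn, hc⟩ := hU
  obtain ⟨θ', n', hn', hc'⟩ := hV
  refine ⟨θ + θ', n + n', add_le_add hn hn', ?_⟩
  have : phase (Qubits q) (θ + θ') * (U * V) = (phase _ θ * U) * (phase _ θ' * V) := by
    rw [phase_add, mul_assoc, ← mul_assoc _ U, phase_mul_comm θ' U]; simp only [mul_assoc]
  rw [this]
  exact hc.mul hc'

theorem circuits_pow_subset (L t : ℕ) : circuits G q L ^ t ⊆ circuits G q (t * L) := by
  induction t with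
  | zero =>
    rw [pow_zero, Set.one_subset]
    exact one_mem_circuits _
  | succ t ih =>
    rw [pow_succ, add_mul, one_mul]
    rintro _ ⟨U, hU, V, hV, rfl⟩
    exact mul_mem_circuits (ih hU) hV

theorem embedUnitary_mem_circuits {L : ℕ} {U : unitaryGroup (Qubits p) ℂ} (f : p ↪ q)
    (hU : U ∈ circuits G p L) : embedUnitary f U ∈ circuits G q L := by
  obtain ⟨θ, n, hn, hc⟩ := hU
  refine ⟨θ, n, hn, ?_⟩
  rw [← embedUnitary_phase f, ← map_mul]
  exact hc.embed f

/-- Density of all circuits gives, by compactness of the unitary group, nets of circuits of bounded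
length. -/
theorem GateSet.IsUniversal.exists_isNet_circuits (hG : G.IsUniversal) :
    ∃ n₀ : ℕ, ∀ n ≥ n₀, ∀ δ : ℝ, 0 < δ → ∃ L, IsNet (circuits G (Fin n) L) δ := by
  obtain ⟨n₀, h⟩ := hG
  refine ⟨n₀, fun n hn δ hδ => ?_⟩
  have hpt : ∀ U : unitaryGroup (Qubits (Fin n)) ℂ, ∃ L, ∃ W ∈ circuits G (Fin n) L,
      ‖(U : Matrix (Qubits (Fin n)) (Qubits (Fin n)) ℂ) - W‖ ≤ δ / 2 := by
    intro U
    obtain ⟨M, ⟨z, m, hz, hc⟩, hM⟩ := Metric.mem_closure_iff.1 (h n hn U) (δ / 2) (by positivity)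
    have hzexp : Complex.exp (z.arg * Complex.I) = z := by
      have := Complex.norm_mul_exp_arg_mul_I z
      rwa [hz, Complex.ofReal_one, one_mul] at this
    have hunit : M ∈ unitaryGroup (Qubits (Fin n)) ℂ := by
      have h1 := hc.mem_unitaryGroup
      have h2 := mul_mem (phase (Qubits (Fin n)) (-z.arg)).2 h1
      have h3 : (phase (Qubits (Fin n)) (-z.arg)).1 * (z • M) = M := by
        have h4 : Complex.exp ((-z.arg : ℝ) * Complex.I) * z = 1 := by
          conv_lhs => enter [2]; rw [← hzexp]
          rw [← Complex.exp_add]; simp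
        simp only [phase, smul_mul_assoc, one_mul, smul_smul, h4, one_smul]
      rwa [h3] at h2
    refine ⟨m, ⟨M, hunit⟩, ⟨z.arg, m, le_rfl, ?_⟩, ?_⟩
    · rw [phase_mul_coe, hzexp]
      exact hc
    · rw [← dist_eq_norm]
      exact hM.le
  choose L W hW hUW using hpt
  have hb : TotallyBounded ((unitaryGroup (Qubits (Fin n)) ℂ :
      Set (Matrix (Qubits (Fin n)) (Qubits (Fin n)) ℂ))) := by
    have : ProperSpace (Matrix (Qubits (Fin n)) (Qubits (Fin n)) ℂ) := FiniteDimensional.proper ℂ _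
    have hbd : Bornology.IsBounded ((unitaryGroup (Qubits (Fin n)) ℂ :
        Set (Matrix (Qubits (Fin n)) (Qubits (Fin n)) ℂ))) := by
      rw [isBounded_iff_forall_norm_le]
      exact ⟨1, fun U hU => norm_unitary_le ⟨U, hU⟩⟩
    exact hbd.isCompact_closure.totallyBounded.subset subset_closure
  obtain ⟨t, hts, htf, hcov⟩ := Metric.finite_approx_of_totallyBounded hb (δ / 2) (by positivity)
  classical
  refine ⟨(htf.toFinset.attach).sup fun x => L ⟨x.1, hts (htf.mem_toFinset.1 x.2)⟩, fun U => ?_⟩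
  obtain ⟨V, hV, hUV⟩ := Set.mem_iUnion₂.1 (hcov U.2)
  refine ⟨W ⟨V, hts hV⟩, circuits_mono ?_ (hW ⟨V, hts hV⟩), ?_⟩
  · exact Finset.le_sup (f := fun x : htf.toFinset => L ⟨x.1, hts (htf.mem_toFinset.1 x.2)⟩)
      (Finset.mem_attach _ ⟨V, htf.mem_toFinset.2 hV⟩)
  · have h1 := hUW ⟨V, hts hV⟩
    rw [Metric.mem_ball, dist_eq_norm] at hUV
    have := norm_add_le ((U : Matrix (Qubits (Fin n)) (Qubits (Fin n)) ℂ) - V)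
      (V - (W ⟨V, hts hV⟩ : Matrix (Qubits (Fin n)) (Qubits (Fin n)) ℂ))
    rw [sub_add_sub_cancel] at this
    simp only at h1
    linarith

/-- On some fixed number of qubits, every unitary is approximated to `2⁻ᵏ` by circuits whose length
is exponential in `k`. -/
theorem GateSet.IsUniversal.exists_rate (hG : G.IsUniversal) :
    ∃ m C R : ℕ, 2 ≤ m ∧ ∀ k : ℕ, IsNet (circuits G (Fin m) (C * R ^ (k + 1))) ((1 / 2) ^ k) := by
  obtain ⟨n₀, h⟩ := hG.exists_isNet_circuits
  obtain ⟨R, δ, hR, hδ, hsk⟩ := exists_isNet_pow (Qubits (Fin (max n₀ 2)))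
  obtain ⟨L, hL⟩ := h (max n₀ 2) (le_max_left _ _) δ hδ
  refine ⟨max n₀ 2, L, R, le_max_right _ _, fun k U => ?_⟩
  obtain ⟨W, hW, hUW⟩ := hsk _ (one_mem_circuits L) (phaseClosed_circuits L) hL k U
  exact ⟨W, by rw [mul_comm]; exact circuits_pow_subset _ _ hW, hUW⟩

end Embedding

/-! ### Exact synthesis from two-qubit unitaries -/

section Diagonal

variable {n : Type} [Fintype n] [DecidableEq n]

/-- The diagonal unitary with entries `exp (i φ s)`. -/
def phases (φ : n → ℝ) : unitaryGroup n ℂ :=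
  ⟨diagonal fun s => Complex.exp (φ s * Complex.I), by
    rw [mem_unitaryGroup_iff, star_eq_conjTranspose, diagonal_conjTranspose, diagonal_mul_diagonal,
      ← diagonal_one]
    congr 1
    funext s
    simp [Complex.mul_conj, Complex.normSq_eq_norm_sq, Complex.norm_exp_ofReal_mul_I]⟩

theorem phases_add (φ ψ : n → ℝ) : phases (fun s => φ s + ψ s) = phases φ * phases ψ := by
  apply Subtype.ext
  simp [phases, add_mul, Complex.exp_add]

theorem phases_const (θ : ℝ) : phases (fun _ : n => θ) = phase n θ := by
  apply Subtype.ext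
  simp [phases, phase, smul_one_eq_diagonal]

/-- The unitary that permutes the computational basis. -/
def permUnitary (σ : Equiv.Perm n) : unitaryGroup n ℂ :=
  ⟨(1 : Matrix n n ℂ).submatrix σ id, by
    rw [mem_unitaryGroup_iff, star_eq_conjTranspose, conjTranspose_submatrix, conjTranspose_one,
      submatrix_mul _ _ _ _ _ Function.bijective_id |>.symm, mul_one, submatrix_one_equiv]⟩

theorem permUnitary_mul_phases_mul_inv (σ : Equiv.Perm n) (φ : n → ℝ) :
    permUnitary σ * phases φ * (permUnitary σ)⁻¹ = phases (fun s => φ (σ s)) := by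
  rw [mul_inv_eq_iff_eq_mul]
  apply Subtype.ext
  simp only [UnitaryGroup.mul_val, phases, permUnitary]
  ext i j
  rw [mul_diagonal, diagonal_mul]
  simp only [submatrix_apply, id, one_apply]
  split_ifs with h
  · rw [h]; ring
  · simp

end Diagonal

section Synthesis

variable {q : Type} [Fintype q] [DecidableEq q]

variable (q) in
/-- The unitaries that act on at most two qubits of the register. -/
def twoQubit : Set (unitaryGroup (Qubits q) ℂ) :=
  {U | ∃ (f : Fin 2 ↪ q) (u : unitaryGroup (Qubits (Fin 2)) ℂ), U = embedUnitary f u}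

/-- The selection of two distinct qubits. -/
def pairEmbedding {i j : q} (h : i ≠ j) : Fin 2 ↪ q :=
  ⟨![i, j], by
    intro a b hab
    fin_cases a <;> fin_cases b <;> simp_all [h.symm]⟩

omit [Fintype q] [DecidableEq q] in
@[simp] theorem pairEmbedding_zero {i j : q} (h : i ≠ j) : pairEmbedding h 0 = i := rfl

omit [Fintype q] [DecidableEq q] in
@[simp] theorem pairEmbedding_one {i j : q} (h : i ≠ j) : pairEmbedding h 1 = j := rfl

theorem embedUnitary_mem_twoQubit [Nontrivial q] (f : Fin 1 ↪ q)
    (u : unitaryGroup (Qubits (Fin 1)) ℂ) : embedUnitary f u ∈ twoQubit q := by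
  obtain ⟨i, hi⟩ := exists_ne (f 0)
  refine ⟨pairEmbedding hi.symm, embedUnitary (Fin.castLEEmb (by norm_num)) u, ?_⟩
  apply Subtype.ext
  simp only [embedUnitary_coe]
  rw [embed_embed]
  congr 1
  ext k
  rw [Subsingleton.elim k 0]
  rfl

theorem one_mem_twoQubit [Nontrivial q] : 1 ∈ twoQubit q := by
  obtain ⟨i, j, h⟩ := exists_pair_ne q
  exact ⟨pairEmbedding h, 1, (map_one _).symm⟩

theorem inv_twoQubit : (twoQubit q)⁻¹ = twoQubit q := by
  have h : ∀ U ∈ twoQubit q, U⁻¹ ∈ twoQubit q := by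
    rintro _ ⟨f, u, rfl⟩
    exact ⟨f, u⁻¹, (map_inv _ _).symm⟩
  ext U
  rw [Set.mem_inv]
  exact ⟨fun hU => by simpa using h _ hU, h U⟩

theorem mem_pow_twoQubit_mono [Nontrivial q] {a b : ℕ} (hab : a ≤ b) {U : unitaryGroup (Qubits q) ℂ}
    (hU : U ∈ twoQubit q ^ a) : U ∈ twoQubit q ^ b :=
  Set.pow_subset_pow_right one_mem_twoQubit hab hU

theorem inv_mem_pow_twoQubit {a : ℕ} {U : unitaryGroup (Qubits q) ℂ}
    (hU : U ∈ twoQubit q ^ a) : U⁻¹ ∈ twoQubit q ^ a := by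
  rw [← inv_twoQubit, inv_pow]
  exact Set.inv_mem_inv.2 hU

theorem mul_mem_pow_twoQubit {a b : ℕ} {U V : unitaryGroup (Qubits q) ℂ}
    (hU : U ∈ twoQubit q ^ a) (hV : V ∈ twoQubit q ^ b) : U * V ∈ twoQubit q ^ (a + b) := by
  rw [pow_add]; exact Set.mul_mem_mul hU hV

/-- The eigenvalue of the Pauli `Z` operator on a basis state of a qubit. -/
def pauliZ (b : Fin 2) : ℝ := if b = 0 then 1 else -1

theorem embedUnitary_phases {p : Type} [Fintype p] [DecidableEq p] (f : p ↪ q) (φ : Qubits p → ℝ) :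
    embedUnitary f (phases φ) = phases (fun s => φ (fun i => s (f i))) := by
  apply Subtype.ext
  ext s t
  simp only [embedUnitary_coe, embed, phases, diagonal_apply]
  by_cases h : s = t
  · subst h; simp
  · rw [if_neg h, ite_eq_right_iff]
    intro h1
    rw [if_neg]
    intro h2
    exact h (splitQubits_bijective f |>.1 (Prod.ext h2 (funext fun j => h1 j.1 j.2)))

/-- The permutation of the basis states performed by a `CNOT` with control `i` and target `j`. -/
def cnot {i j : q} (h : i ≠ j) : Equiv.Perm (Qubits q) :=
  Function.Involutive.toPerm (fun s => Function.update s j (s j + s i)) fun s => by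
    simp only [Function.update_self, Function.update_of_ne h, Function.update_idem]
    rw [add_assoc, show s i + s i = 0 by generalize s i = b; fin_cases b <;> rfl, add_zero,
      Function.update_eq_self]

omit [Fintype q] in
theorem cnot_apply {i j : q} (h : i ≠ j) (s : Qubits q) :
    cnot h s = Function.update s j (s j + s i) := rfl

theorem permUnitary_cnot_mem_twoQubit {i j : q} (h : i ≠ j) :
    permUnitary (cnot h) ∈ twoQubit q := by
  refine ⟨pairEmbedding h, permUnitary (cnot (i := (0 : Fin 2)) (j := 1) (by decide)), ?_⟩
  apply Subtype.ext
  ext s t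
  simp only [embedUnitary_coe, embed, permUnitary, submatrix_apply, id, one_apply, ← ite_and]
  congr 1
  rw [eq_iff_iff, cnot_apply, cnot_apply]
  constructor
  · rintro rfl
    refine ⟨fun k hk => ?_, ?_⟩
    · have : k ≠ j := fun h => hk 1 h.symm
      rw [Function.update_of_ne this]
    · funext k
      fin_cases k
      · simp [h]
      · simp
  · rintro ⟨h1, h2⟩
    funext k
    have e0 := congrFun h2 0
    have e1 := congrFun h2 1
    simp at e0 e1
    by_cases hkj : k = j
    · subst hkj; simpa using e1
    · rw [Function.update_of_ne hkj]
      by_cases hki : k = i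
      · rw [hki, e0]
      · refine h1 k fun l => ?_
        fin_cases l
        · exact fun h => hki h.symm
        · exact fun h => hkj h.symm

/-- The mean value of `φ` over the qubit `i`. -/
def bitMean (i : q) (φ : Qubits q → ℝ) (s : Qubits q) : ℝ :=
  (φ (Function.update s i 0) + φ (Function.update s i 1)) / 2

/-- Half the difference of the values of `φ` over the qubit `i`. -/
def bitDiff (i : q) (φ : Qubits q → ℝ) (s : Qubits q) : ℝ :=
  (φ (Function.update s i 0) - φ (Function.update s i 1)) / 2

omit [Fintype q] in
theorem bitMean_add_bitDiff (i : q) (φ : Qubits q → ℝ) (s : Qubits q) :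
    φ s = bitMean i φ s + bitDiff i φ s * pauliZ (s i) := by
  unfold bitMean bitDiff pauliZ
  split_ifs with h
  · rw [← h, Function.update_eq_self]; ring
  · have h1 : s i = 1 := by generalize s i = b at h; fin_cases b <;> simp_all
    rw [← h1, Function.update_eq_self]; ring

omit [Fintype q] in
theorem dependsOn_update {i : q} {S : Finset q} {φ : Qubits q → ℝ}
    (hφ : DependsOn φ (insert i S : Finset q)) (b : Fin 2) :
    DependsOn (fun s => φ (Function.update s i b)) (S : Set q) := by
  intro s t hst
  refine hφ fun k hk => ?_
  by_cases hki : k = i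
  · subst hki; simp
  · rw [Function.update_of_ne hki, Function.update_of_ne hki]
    exact hst k (Finset.mem_of_mem_insert_of_ne (Finset.mem_coe.1 hk) hki)

omit [Fintype q] in
theorem dependsOn_bitMean {i : q} {S : Finset q} {φ : Qubits q → ℝ}
    (hφ : DependsOn φ (insert i S : Finset q)) : DependsOn (bitMean i φ) (S : Set q) := by
  intro s t hst
  unfold bitMean
  have h0 : φ (Function.update s i 0) = φ (Function.update t i 0) := dependsOn_update hφ 0 hst
  have h1 : φ (Function.update s i 1) = φ (Function.update t i 1) := dependsOn_update hφ 1 hst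
  rw [h0, h1]

omit [Fintype q] in
theorem dependsOn_bitDiff {i : q} {S : Finset q} {φ : Qubits q → ℝ}
    (hφ : DependsOn φ (insert i S : Finset q)) : DependsOn (bitDiff i φ) (S : Set q) := by
  intro s t hst
  unfold bitDiff
  have h0 : φ (Function.update s i 0) = φ (Function.update t i 0) := dependsOn_update hφ 0 hst
  have h1 : φ (Function.update s i 1) = φ (Function.update t i 1) := dependsOn_update hφ 1 hst
  rw [h0, h1]

/-- A rotation about the `z` axis of the qubit `j`, by an angle controlled by the qubits in `S`: the
dependence on each control is removed by a `CNOT`, as `Z ⊗ Z` is conjugate to `1 ⊗ Z`. -/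
theorem phases_mul_pauliZ_mem [Nontrivial q] (j : q) (S : Finset q) (hj : j ∉ S) (φ : Qubits q → ℝ)
    (hφ : DependsOn φ (S : Set q)) :
    phases (fun s => φ s * pauliZ (s j)) ∈ twoQubit q ^ (4 ^ S.card) := by
  induction S using Finset.induction_on generalizing φ with
  | empty =>
    have hc : ∀ s, φ s = φ 0 := fun s => hφ (by simp)
    have := embedUnitary_mem_twoQubit (⟨fun _ => j, fun a b _ => Subsingleton.elim a b⟩ : Fin 1 ↪ q)
      (phases fun s => φ 0 * pauliZ (s 0))
    rw [embedUnitary_phases] at this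
    simp only [Finset.card_empty, pow_zero, pow_one]
    rwa [show (fun s => φ s * pauliZ (s j)) = fun s => φ 0 * pauliZ (s j) from
      funext fun s => by rw [hc s]]
  | insert i S hi ih =>
    have hij : i ≠ j := fun h => hj (h ▸ Finset.mem_insert_self i S)
    have hjS : j ∉ S := fun h => hj (Finset.mem_insert_of_mem h)
    have ha := ih hjS _ (dependsOn_bitMean hφ)
    have hb := ih hjS _ (dependsOn_bitDiff hφ)
    have hd : DependsOn (bitDiff i φ) (S : Set q) := dependsOn_bitDiff hφ
    have key : phases (fun s => φ s * pauliZ (s j)) =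
        phases (fun s => bitMean i φ s * pauliZ (s j)) * (permUnitary (cnot hij) *
          phases (fun s => bitDiff i φ s * pauliZ (s j)) * (permUnitary (cnot hij))⁻¹) := by
      rw [permUnitary_mul_phases_mul_inv, ← phases_add]
      congr 1
      funext s
      have h1 : bitDiff i φ (cnot hij s) = bitDiff i φ s := hd fun k hk => by
        rw [cnot_apply, Function.update_of_ne (fun h => hjS (by rw [← h]; exact hk))]
      have h2 : pauliZ (cnot hij s j) = pauliZ (s i) * pauliZ (s j) := by
        rw [cnot_apply, Function.update_self]
        generalize s i = b
        generalize s j = c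
        fin_cases b <;> fin_cases c <;> simp [pauliZ]
      rw [h1, h2, bitMean_add_bitDiff i φ s]
      ring
    rw [key, Finset.card_insert_of_notMem hi]
    have hP : permUnitary (cnot hij) ∈ twoQubit q ^ 1 := by
      rw [pow_one]; exact permUnitary_cnot_mem_twoQubit hij
    refine mem_pow_twoQubit_mono ?_ (mul_mem_pow_twoQubit ha (mul_mem_pow_twoQubit
      (mul_mem_pow_twoQubit hP hb) (inv_mem_pow_twoQubit hP)))
    have := Nat.one_le_pow S.card 4 (by norm_num)
    rw [pow_succ]
    omega

/-- A diagonal unitary is stripped of one qubit at a time: `φ = bitMean + bitDiff * Z`, and the second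
term is a controlled rotation. -/
theorem phases_mem_of_dependsOn [Nontrivial q] (S : Finset q) (φ : Qubits q → ℝ)
    (hφ : DependsOn φ (S : Set q)) : phases φ ∈ twoQubit q ^ (4 ^ S.card) := by
  induction S using Finset.induction_on generalizing φ with
  | empty =>
    have hc : φ = fun _ => φ 0 := funext fun s => hφ (by simp)
    obtain ⟨i, j, h⟩ := exists_pair_ne q
    rw [hc, phases_const, ← embedUnitary_phase (pairEmbedding h)]
    simp only [Finset.card_empty, pow_zero, pow_one]
    exact ⟨_, _, rfl⟩
  | insert i S hi ih =>
    have key : phases φ = phases (bitMean i φ) * phases (fun s => bitDiff i φ s * pauliZ (s i)) := by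
      rw [← phases_add]
      congr 1
      funext s
      exact bitMean_add_bitDiff i φ s
    rw [key, Finset.card_insert_of_notMem hi]
    refine mem_pow_twoQubit_mono ?_ (mul_mem_pow_twoQubit (ih _ (dependsOn_bitMean hφ))
      (phases_mul_pauliZ_mem i S hi _ (dependsOn_bitDiff hφ)))
    rw [pow_succ]
    omega

theorem phases_mem_pow_twoQubit [Nontrivial q] (φ : Qubits q → ℝ) :
    phases φ ∈ twoQubit q ^ (4 ^ Fintype.card q) := by
  rw [← Finset.card_univ]
  exact phases_mem_of_dependsOn _ _ fun s t h => congrArg φ (funext fun i => h i (by simp))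

/-- The Hadamard gate on a single qubit. -/
def hadamardGate : unitaryGroup (Qubits (Fin 1)) ℂ :=
  ⟨of fun s t => (((√2)⁻¹ * if s 0 = 1 then pauliZ (t 0) else 1 : ℝ) : ℂ), by
    have h2 : (√2)⁻¹ * (√2)⁻¹ = (1 / 2 : ℝ) := by
      rw [← mul_inv, Real.mul_self_sqrt (by norm_num)]; norm_num
    rw [mem_unitaryGroup_iff]
    ext s t
    rw [mul_apply, one_apply,
      Fintype.sum_equiv (Equiv.funUnique (Fin 1) (Fin 2)) _
        (fun b => (((√2)⁻¹ * if s 0 = 1 then pauliZ b else 1 : ℝ) : ℂ) *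
          (((√2)⁻¹ * if t 0 = 1 then pauliZ b else 1 : ℝ) : ℂ)) (fun r => by
            simp [star_apply, Equiv.funUnique]), Fin.sum_univ_two]
    have hst : s = t ↔ s 0 = t 0 := ⟨fun h => h ▸ rfl, fun h => funext fun i => by
      rw [Subsingleton.elim i 0, h]⟩
    simp only [hst]
    norm_cast
    generalize s 0 = a
    generalize t 0 = b
    fin_cases a <;> fin_cases b <;> simp [pauliZ, h2] <;> norm_num⟩

/-- The Hadamard gate on the qubit `j` of a register. -/
def hadamard (j : q) : unitaryGroup (Qubits q) ℂ :=
  embedUnitary (⟨fun _ => j, fun a b _ => Subsingleton.elim a b⟩ : Fin 1 ↪ q) hadamardGate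

theorem hadamard_apply (j : q) (s t : Qubits q) :
    (hadamard j : Matrix (Qubits q) (Qubits q) ℂ) s t = if ∀ k, k ≠ j → s k = t k then
      (((√2)⁻¹ * if s j = 1 then pauliZ (t j) else 1 : ℝ) : ℂ) else 0 := by
  rw [hadamard, embedUnitary_coe]
  by_cases h : ∀ k, k ≠ j → s k = t k
  · rw [if_pos h]
    exact if_pos fun k hk => h k fun h' => hk 0 h'.symm
  · rw [if_neg h]
    exact if_neg fun h' => h fun k hk => h' k fun _ h'' => hk h''.symm

theorem hadamard_mulVec (j : q) (v : Qubits q → ℂ) (s : Qubits q) :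
    ((hadamard j : Matrix (Qubits q) (Qubits q) ℂ) *ᵥ v) s =
      ((√2)⁻¹ : ℝ) * (v (Function.update s j 0) + pauliZ (s j) * v (Function.update s j 1)) := by
  have key : ∑ b : Fin 2, (((√2)⁻¹ * if s j = 1 then pauliZ b else 1 : ℝ) : ℂ) *
      v (Function.update s j b) = ((hadamard j : Matrix (Qubits q) (Qubits q) ℂ) *ᵥ v) s := by
    rw [mulVec, dotProduct]
    refine Finset.sum_of_injOn (fun b => Function.update s j b) ?_ (by simp [Set.MapsTo]) ?_ ?_
    · intro a _ b _ hab
      simpa using congrFun hab j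
    · intro t _ ht
      rw [hadamard_apply, if_neg, zero_mul]
      intro h
      refine ht ⟨t j, by simp, ?_⟩
      funext k
      by_cases hk : k = j
      · subst hk; simp
      · simp only [Function.update_of_ne hk]
        exact h k hk
    · intro b _
      have h : ∀ k, k ≠ j → s k = Function.update s j b k := fun k hk => by
        rw [Function.update_of_ne hk]
      simp only [hadamard_apply, if_pos h, Function.update_self]
  rw [← key, Fin.sum_univ_two]
  generalize s j = b
  fin_cases b <;> simp [pauliZ] <;> ring

theorem phases_mulVec {n : Type} [Fintype n] [DecidableEq n] (φ : n → ℝ) (v : n → ℂ) (s : n) :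
    ((phases φ : Matrix n n ℂ) *ᵥ v) s = Complex.exp (φ s * Complex.I) * v s := by
  simp [phases, mulVec_diagonal]

theorem exp_neg_arg_mul (z : ℂ) : Complex.exp ((-z.arg : ℝ) * Complex.I) * z = ‖z‖ := by
  conv_lhs => enter [2]; rw [← Complex.norm_mul_exp_arg_mul_I z]
  rw [mul_left_comm, ← Complex.exp_add]
  simp

/-- Any vector is rotated into the line of the basis state `0…0` one qubit at a time. The amplitudes
of a pair of basis states that differ in the qubit `j` are given the phases `1` and `i`, so that a
Hadamard gate makes their moduli equal; once their phases agree, a second Hadamard gate cancels the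
second amplitude. -/
theorem exists_eliminate_qubits [Nontrivial q] (v : Qubits q → ℂ) (F : Finset q) :
    ∃ W ∈ twoQubit q ^ (F.card * (2 * 4 ^ Fintype.card q + 2)), ∀ s : Qubits q, (∃ i ∈ F, s i = 1) →
      ((W : Matrix (Qubits q) (Qubits q) ℂ) *ᵥ v) s = 0 := by
  induction F using Finset.induction_on with
  | empty => exact ⟨1, by simp, by simp⟩
  | insert j F hj ih =>
    obtain ⟨W, hW, hv⟩ := ih
    set w := (W : Matrix (Qubits q) (Qubits q) ℂ) *ᵥ v with hw
    set φ : Qubits q → ℝ := fun s => -(w s).arg + if s j = 0 then 0 else Real.pi / 2 with hφ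
    set u₁ := (phases φ : Matrix (Qubits q) (Qubits q) ℂ) *ᵥ w with hu₁
    have hu₁' : ∀ s, u₁ s = (if s j = 0 then 1 else Complex.I) * ‖w s‖ := by
      intro s
      rw [hu₁, phases_mulVec, ← exp_neg_arg_mul]
      simp only [hφ]
      split_ifs
      · rw [add_zero, one_mul]
      · rw [Complex.ofReal_add, add_mul, Complex.exp_add]
        push_cast
        rw [Complex.exp_pi_div_two_mul_I]
        ring
    set u₂ := (hadamard j : Matrix (Qubits q) (Qubits q) ℂ) *ᵥ u₁ with hu₂
    have hu₂' : ∀ s, u₂ s = ((√2)⁻¹ : ℝ) * (‖w (Function.update s j 0)‖ +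
        pauliZ (s j) * (Complex.I * ‖w (Function.update s j 1)‖)) := by
      intro s
      rw [hu₂, hadamard_mulVec, hu₁', hu₁']
      simp
    set ψ : Qubits q → ℝ := fun s => -(u₂ s).arg with hψ
    set u₃ := (phases ψ : Matrix (Qubits q) (Qubits q) ℂ) *ᵥ u₂ with hu₃
    have hu₃' : ∀ s, u₃ s = ‖u₂ s‖ := by
      intro s
      rw [hu₃, phases_mulVec, exp_neg_arg_mul]
    refine ⟨hadamard j * phases ψ * hadamard j * phases φ * W, ?_, ?_⟩
    · have hH : hadamard j ∈ twoQubit q ^ 1 := by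
        rw [pow_one]; exact embedUnitary_mem_twoQubit _ _
      rw [Finset.card_insert_of_notMem hj]
      refine mem_pow_twoQubit_mono (le_of_eq ?_) (mul_mem_pow_twoQubit (mul_mem_pow_twoQubit
        (mul_mem_pow_twoQubit (mul_mem_pow_twoQubit hH (phases_mem_pow_twoQubit ψ)) hH)
        (phases_mem_pow_twoQubit φ)) hW)
      ring
    · intro s hs
      simp only [UnitaryGroup.mul_val, ← mulVec_mulVec]
      rw [← hw, ← hu₁, ← hu₂, ← hu₃, hadamard_mulVec, hu₃', hu₃']
      by_cases hsj : s j = 1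
      · have hconj : u₂ (Function.update s j 1) = (starRingEnd ℂ) (u₂ (Function.update s j 0)) := by
          rw [hu₂', hu₂']
          simp [pauliZ]
        rw [hconj, Complex.norm_conj, hsj]
        simp [pauliZ]
      · obtain ⟨i, hi, hsi⟩ := hs
        have hij : i ≠ j := fun h => hsj (h ▸ hsi)
        have hiF : i ∈ F := Finset.mem_of_mem_insert_of_ne hi hij
        have hz : ∀ b, w (Function.update s j b) = 0 := fun b =>
          hv _ ⟨i, hiF, by rw [Function.update_of_ne hij, hsi]⟩
        simp [hu₂', hz]

/-- Complex reflections, the unitaries that fix the complement of a line, are conjugate to a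
diagonal unitary by an elimination. -/
theorem exists_reflection [Nontrivial q] (w : Qubits q → ℂ) (hw : star w ⬝ᵥ w ≠ 0) (θ : ℝ) :
    ∃ R ∈ twoQubit q ^ (2 * (Fintype.card q * (2 * 4 ^ Fintype.card q + 2)) + 4 ^ Fintype.card q),
      ∀ x, (R : Matrix (Qubits q) (Qubits q) ℂ) *ᵥ x =
        x + ((Complex.exp (θ * Complex.I) - 1) * (star w ⬝ᵥ x) / (star w ⬝ᵥ w)) • w := by
  obtain ⟨W, hW, hWw⟩ := exists_eliminate_qubits w Finset.univ
  rw [Finset.card_univ] at hW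
  set c := ((W : Matrix (Qubits q) (Qubits q) ℂ) *ᵥ w) 0 with hc
  have hWw' : (W : Matrix (Qubits q) (Qubits q) ℂ) *ᵥ w = Pi.single 0 c := by
    funext s
    by_cases hs : s = 0
    · rw [hs, Pi.single_eq_same]
    · rw [Pi.single_eq_of_ne hs]
      apply hWw
      by_contra! h
      refine hs (funext fun i => ?_)
      have := h i (Finset.mem_univ i)
      generalize s i = b at this
      fin_cases b <;> simp_all
  have hinv : ∀ x, ((W⁻¹ : unitaryGroup (Qubits q) ℂ) : Matrix (Qubits q) (Qubits q) ℂ) *ᵥ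
      ((W : Matrix (Qubits q) (Qubits q) ℂ) *ᵥ x) = x := by
    intro x
    rw [mulVec_mulVec, ← UnitaryGroup.mul_val, inv_mul_cancel, UnitaryGroup.one_val, one_mulVec]
  have hdot : ∀ x, star w ⬝ᵥ x = star c * ((W : Matrix (Qubits q) (Qubits q) ℂ) *ᵥ x) 0 := by
    intro x
    have h1 : star w ⬝ᵥ x = star ((W : Matrix (Qubits q) (Qubits q) ℂ) *ᵥ w) ⬝ᵥ
        ((W : Matrix (Qubits q) (Qubits q) ℂ) *ᵥ x) := by
      rw [star_mulVec, dotProduct_mulVec, vecMul_vecMul, ← star_eq_conjTranspose,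
        UnitaryGroup.star_mul_self, vecMul_one]
    rw [h1, hWw', ← Pi.single_star, single_dotProduct]
  -- After the elimination, the reflection is the phase `θ` on the basis state `0…0`.
  set φ : Qubits q → ℝ := Pi.single 0 θ with hφ
  refine ⟨W⁻¹ * phases φ * W, mem_pow_twoQubit_mono (le_of_eq (by ring)) (mul_mem_pow_twoQubit
    (mul_mem_pow_twoQubit (inv_mem_pow_twoQubit hW) (phases_mem_pow_twoQubit φ)) hW), fun x => ?_⟩
  have hcne : c ≠ 0 := by
    rintro h
    rw [hdot, h] at hw
    simp at hw
  have hphase : (phases φ : Matrix (Qubits q) (Qubits q) ℂ) *ᵥ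
      ((W : Matrix (Qubits q) (Qubits q) ℂ) *ᵥ x) = (W : Matrix (Qubits q) (Qubits q) ℂ) *ᵥ x +
        ((Complex.exp (θ * Complex.I) - 1) * (star w ⬝ᵥ x) / (star w ⬝ᵥ w)) •
          ((W : Matrix (Qubits q) (Qubits q) ℂ) *ᵥ w) := by
    funext s
    rw [phases_mulVec, hdot w, hdot x, hWw', Pi.add_apply, Pi.smul_apply, Pi.single_eq_same,
      smul_eq_mul]
    by_cases hs : s = 0
    · have hcs : star c ≠ 0 := star_ne_zero.2 hcne
      rw [hs, hφ, Pi.single_eq_same, Pi.single_eq_same]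
      field_simp
      ring
    · rw [hφ, Pi.single_eq_of_ne hs, Pi.single_eq_of_ne hs]
      simp
  rw [UnitaryGroup.mul_val, UnitaryGroup.mul_val, ← mulVec_mulVec, ← mulVec_mulVec, hphase,
    mulVec_add, mulVec_smul, hinv, hinv]

open scoped ComplexOrder in
/-- Every unitary is a product of complex reflections, one for each basis state that it moves: the
reflection along `U e - e` maps `U e` to `e` and fixes every basis state that `U` already fixes. -/
theorem mem_pow_twoQubit_of_fixes [Nontrivial q] {ρ : ℕ}
    (hρ : ∀ w : Qubits q → ℂ, star w ⬝ᵥ w ≠ 0 → ∀ θ : ℝ, ∃ R ∈ twoQubit q ^ ρ,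
      ∀ x, (R : Matrix (Qubits q) (Qubits q) ℂ) *ᵥ x =
        x + ((Complex.exp (θ * Complex.I) - 1) * (star w ⬝ᵥ x) / (star w ⬝ᵥ w)) • w)
    (F : Finset (Qubits q)) (U : unitaryGroup (Qubits q) ℂ)
    (hU : ∀ s ∉ F, (U : Matrix (Qubits q) (Qubits q) ℂ) *ᵥ Pi.single s 1 = Pi.single s 1) :
    U ∈ twoQubit q ^ (F.card * ρ) := by
  induction F using Finset.induction_on generalizing U with
  | empty =>
    have : U = 1 := by
      apply Subtype.ext
      ext s t
      have := congrFun (hU t (by simp)) s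
      rw [mulVec_single_one] at this
      rw [UnitaryGroup.one_val, one_apply]
      simpa [Pi.single_apply] using this
    simp [this]
  | insert s F hs ih =>
    rw [Finset.card_insert_of_notMem hs]
    set x := (U : Matrix (Qubits q) (Qubits q) ℂ) *ᵥ Pi.single s 1 with hx
    set y : Qubits q → ℂ := Pi.single s 1 with hy
    by_cases hxy : x = y
    · refine mem_pow_twoQubit_mono (Nat.mul_le_mul_right _ (Nat.le_succ _)) (ih U fun t ht => ?_)
      by_cases hts : t = s
      · rw [hts]; exact hxy
      · exact hU t (by simp [hts, ht])
    have hdotU : ∀ a b : Qubits q → ℂ, star ((U : Matrix (Qubits q) (Qubits q) ℂ) *ᵥ a) ⬝ᵥ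
        ((U : Matrix (Qubits q) (Qubits q) ℂ) *ᵥ b) = star a ⬝ᵥ b := by
      intro a b
      rw [star_mulVec, dotProduct_mulVec, vecMul_vecMul, ← star_eq_conjTranspose,
        UnitaryGroup.star_mul_self, vecMul_one]
    have hyy : star y ⬝ᵥ y = 1 := by simp [hy]
    have hxx : star x ⬝ᵥ x = 1 := by rw [hx, hdotU, hyy]
    set w := x - y with hw
    set p := star w ⬝ᵥ x with hp
    have hwy : star w ⬝ᵥ y = -(star p) := by
      have h1 : star (star y ⬝ᵥ x) = star x ⬝ᵥ y := by
        rw [← star_dotProduct_star, star_star]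
      rw [hp, hw, star_sub, sub_dotProduct, sub_dotProduct, hyy, hxx, star_sub, h1]
      simp
    have hww : star w ⬝ᵥ w = p + star p := by
      conv_lhs => enter [2]; rw [hw]
      rw [dotProduct_sub, hwy, ← hp]
      ring
    have hww0 : star w ⬝ᵥ w ≠ 0 := by
      rw [Ne, dotProduct_star_self_eq_zero]
      exact sub_ne_zero.2 hxy
    have hp0 : p ≠ 0 := by
      intro h
      rw [hww, h] at hww0
      simp at hww0
    have hω : Complex.exp ((-(star p) / p).arg * Complex.I) = -(star p) / p := by
      have h1 : ‖-(star p) / p‖ = 1 := by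
        rw [norm_div, norm_neg, norm_star, div_self (norm_ne_zero_iff.2 hp0)]
      have := Complex.norm_mul_exp_arg_mul_I (-(star p) / p)
      rwa [h1, Complex.ofReal_one, one_mul] at this
    obtain ⟨R, hR, hRx⟩ := hρ w hww0 (-(star p) / p).arg
    have hRU : R * U ∈ twoQubit q ^ (F.card * ρ) := by
      refine ih _ fun t ht => ?_
      rw [UnitaryGroup.mul_val, ← mulVec_mulVec]
      by_cases hts : t = s
      · rw [hts, ← hx, hRx, hω, ← hp]
        have e : (-(star p) / p - 1) * p / (star w ⬝ᵥ w) = -1 := by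
          rw [div_eq_iff hww0, hww]
          field_simp
          ring
        rw [e, neg_one_smul, hw]
        abel
      · have hUt := hU t (by simp [hts, ht])
        have h1 : star w ⬝ᵥ Pi.single t 1 = 0 := by
          have h2 : star x ⬝ᵥ Pi.single t 1 = 0 := by
            rw [hx, ← hUt, hdotU, hy, ← Pi.single_star]
            simp [Ne.symm hts]
          rw [hw, star_sub, sub_dotProduct, h2, hy, ← Pi.single_star]
          simp [Ne.symm hts]
        rw [hUt, hRx, h1]
        simp
    have : U = R⁻¹ * (R * U) := by group
    rw [this]
    exact mem_pow_twoQubit_mono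
      (le_of_eq (by ring)) (mul_mem_pow_twoQubit (inv_mem_pow_twoQubit hR) hRU)

/-- Every unitary on a register of `n` qubits is a product of `2 ^ (8 * n)` two-qubit unitaries: at
most `2 ^ n` reflections, each of `O(n * 4 ^ n)` of them. -/
theorem mem_pow_twoQubit [Nontrivial q] (U : unitaryGroup (Qubits q) ℂ) :
    U ∈ twoQubit q ^ (2 ^ (8 * Fintype.card q)) := by
  refine mem_pow_twoQubit_mono ?_
    (mem_pow_twoQubit_of_fixes (fun w hw θ => exists_reflection w hw θ) Finset.univ U (by simp))
  rw [Finset.card_univ, Fintype.card_fun, Fintype.card_fin]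
  set n := Fintype.card q
  have hn : 1 ≤ n := Fintype.card_pos
  have h1 : n ≤ 2 ^ n := Nat.lt_two_pow_self.le
  have h4 : 2 ≤ 2 ^ n := Nat.le_self_pow (by omega) 2 |>.trans' le_rfl
  have e4 : (4 : ℕ) ^ n = 2 ^ n * 2 ^ n := by rw [← mul_pow]; rfl
  have e8 : 2 ^ (8 * n) = (2 ^ n) ^ 8 := by rw [← pow_mul, mul_comm]
  rw [e4, e8]
  generalize 2 ^ n = x at *
  calc x * (2 * (n * (2 * (x * x) + 2)) + x * x)
      ≤ x * (2 * (x * (2 * (x * x) + x * x)) + x * (x * x)) := by gcongr <;> nlinarith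
    _ = 7 * x ^ 4 := by ring
    _ ≤ 2 ^ 4 * x ^ 4 := by gcongr; norm_num
    _ ≤ x ^ 4 * x ^ 4 := by gcongr
    _ = x ^ 8 := by ring

omit [DecidableEq q] in
/-- Any two qubits can be joined by `m - 2` others to a subregister of `m` qubits. -/
theorem exists_embedding_extending {m : ℕ} (hm : 2 ≤ m) (hq : m ≤ Fintype.card q) (g : Fin 2 ↪ q) :
    ∃ f : Fin m ↪ q, (Fin.castLEEmb hm).trans f = g := by
  classical
  obtain ⟨t, ht, htm⟩ := Finset.exists_superset_card_eq (s := Finset.univ.map g) (n := m)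
    (by simpa using hm) hq
  obtain ⟨e, he⟩ := Finset.exists_equiv_extend_of_card_eq (α := Fin m) (t := t) (by simp [htm])
    (s := Finset.univ.map (Fin.castLEEmb hm))
    (f := fun i => if h : (i : ℕ) < 2 then g ⟨i, h⟩ else g 0)
    (by
      intro x hx
      simp only [Finset.mem_image, Finset.mem_map, Finset.mem_univ, true_and] at hx
      obtain ⟨_, ⟨i, rfl⟩, rfl⟩ := hx
      apply ht
      simp [Nat.le_of_lt_succ i.2]) (by
      intro a ha b hb hab
      simp only [Finset.coe_map, Set.mem_image] at ha hb
      obtain ⟨a, _, rfl⟩ := ha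
      obtain ⟨b, _, rfl⟩ := hb
      simpa [Nat.le_of_lt_succ a.2, Nat.le_of_lt_succ b.2] using hab)
  refine ⟨e.toEmbedding.trans (Function.Embedding.subtype _), ?_⟩
  ext i
  have := he (Fin.castLEEmb hm i) (by simp)
  simpa [Nat.le_of_lt_succ i.2] using this

/-- Exact synthesis from two-qubit unitaries, followed by the approximation of each of them. -/
theorem GateSet.IsUniversal.exists_circuit_bound {G : GateSet} (hG : G.IsUniversal) (η : ℝ)
    (hη : 0 < η) :
    ∃ m B : ℕ, 2 ≤ m ∧ ∀ (q : Type) [Fintype q] [DecidableEq q], m ≤ Fintype.card q →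
      ∀ U : unitaryGroup (Qubits q) ℂ, ∃ W ∈ circuits G q (2 ^ (B * Fintype.card q)),
        ‖(U : Matrix (Qubits q) (Qubits q) ℂ) - W‖ ≤ η := by
  obtain ⟨m, C, R, hm, hrate⟩ := hG.exists_rate
  obtain ⟨l, hl⟩ := exists_pow_lt_of_lt_one hη (by norm_num : (1 / 2 : ℝ) < 1)
  obtain ⟨c, hc⟩ : ∃ c, C ≤ 2 ^ c := ⟨C, Nat.lt_two_pow_self.le⟩
  obtain ⟨r, hr⟩ : ∃ r, R ≤ 2 ^ r := ⟨R, Nat.lt_two_pow_self.le⟩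
  refine ⟨m, 8 + (c + r * (8 + l + 1)), hm, fun q _ _ hq U => ?_⟩
  have : Nontrivial q := Fintype.one_lt_card_iff_nontrivial.1 (by omega)
  set n := Fintype.card q with hn
  set k := 8 * n + l with hk
  have key : ∀ T : ℕ, ∀ U ∈ twoQubit q ^ T, ∃ W ∈ circuits G q (T * (C * R ^ (k + 1))),
      ‖(U : Matrix (Qubits q) (Qubits q) ℂ) - W‖ ≤ T * (1 / 2) ^ k := by
    intro T
    induction T with
    | zero =>
      intro U hU
      rw [pow_zero, Set.mem_one] at hU
      exact ⟨1, one_mem_circuits _, by simp [hU]⟩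
    | succ T ih =>
      intro U hU
      rw [pow_succ] at hU
      obtain ⟨V, hV, X, ⟨g, u, rfl⟩, rfl⟩ := Set.mem_mul.1 hU
      obtain ⟨W, hW, hVW⟩ := ih V hV
      obtain ⟨f, hf⟩ := exists_embedding_extending hm hq g
      obtain ⟨Y, hY, hXY⟩ := hrate k (embedUnitary (Fin.castLEEmb hm) u)
      refine ⟨W * embedUnitary f Y, ?_, (norm_unitary_mul_sub_mul_le _ _ _ _).trans ?_⟩
      · rw [add_mul, one_mul]
        exact mul_mem_circuits hW (embedUnitary_mem_circuits f hY)
      · have e : embedUnitary g u = embedUnitary f (embedUnitary (Fin.castLEEmb hm) u) := by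
          apply Subtype.ext
          simp only [embedUnitary_coe]
          rw [embed_embed, hf]
        rw [e]
        push_cast
        rw [add_mul, one_mul]
        exact add_le_add hVW ((norm_embedUnitary_sub_le f _ _).trans hXY)
  obtain ⟨W, hW, hUW⟩ := key _ U (mem_pow_twoQubit U)
  have hn1 : 1 ≤ n := by omega
  refine ⟨W, circuits_mono ?_ hW, hUW.trans ?_⟩
  · calc 2 ^ (8 * n) * (C * R ^ (k + 1)) ≤ 2 ^ (8 * n) * (2 ^ c * (2 ^ r) ^ (k + 1)) := by gcongr
      _ = 2 ^ (8 * n + (c + r * (k + 1))) := by rw [← pow_mul, ← pow_add, ← pow_add]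
      _ ≤ 2 ^ ((8 + (c + r * (8 + l + 1))) * n) := by
          apply Nat.pow_le_pow_right (by norm_num)
          have h1 : c ≤ c * n := Nat.le_mul_of_pos_right _ hn1
          have h2 : k + 1 ≤ (8 + l + 1) * n := by rw [hk]; nlinarith
          have h3 : r * (k + 1) ≤ r * ((8 + l + 1) * n) := Nat.mul_le_mul_left _ h2
          nlinarith
  · have e : ((2 ^ (8 * n) : ℕ) : ℝ) * (1 / 2) ^ k = (1 / 2) ^ l := by
      rw [hk, pow_add]
      push_cast
      rw [← mul_assoc, ← mul_pow]
      norm_num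
    rw [e]
    exact hl.le

end Synthesis

/-! ### Polar decomposition, trace norm and diamond norm -/

section TraceNorm

variable {n : Type} [Fintype n] [DecidableEq n]

open scoped ComplexOrder in
/-- The singular value decomposition, in polar form `T = U * (V * diag σ * V†)`. -/
theorem exists_polar (T : Matrix n n ℂ) :
    ∃ U V : unitaryGroup n ℂ, T = U * (V *
      diagonal (fun i => (√((isHermitian_conjTranspose_mul_self T).eigenvalues i) : ℂ)) *
        (V⁻¹ : unitaryGroup n ℂ)) := by
  set hH := isHermitian_conjTranspose_mul_self T with hHdef
  set ev := hH.eigenvalues with hev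
  set V : unitaryGroup n ℂ := hH.eigenvectorUnitary with hV
  have hnn : ∀ i, 0 ≤ ev i := (posSemidef_conjTranspose_mul_self T).eigenvalues_nonneg
  have hVT : ((V⁻¹ : unitaryGroup n ℂ) : Matrix n n ℂ) * (Tᴴ * T) * V =
      diagonal (fun i => (ev i : ℂ)) := by
    have h := hH.spectral_theorem
    rw [Unitary.conjStarAlgAut_apply] at h
    conv_lhs => rw [h]
    rw [← hV]
    have h1 : ((V⁻¹ : unitaryGroup n ℂ) : Matrix n n ℂ) = star (V : Matrix n n ℂ) := rfl
    have h2 := UnitaryGroup.star_mul_self V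
    rw [h1, show ∀ A B C : Matrix n n ℂ, A * (C * B * A) * C = (A * C) * B * (A * C) by
      intros; simp only [mul_assoc], h2]
    simp [Function.comp_def, hev]
  set X : Matrix n n ℂ := T * V with hX
  have hXX : Xᴴ * X = diagonal (fun i => (ev i : ℂ)) := by
    rw [hX, conjTranspose_mul, ← hVT]
    simp only [mul_assoc]; rfl
  have hdot : ∀ i j, star (X.col i) ⬝ᵥ X.col j = if i = j then (ev i : ℂ) else 0 := by
    intro i j
    have := congrFun (congrFun hXX i) j
    rw [diagonal_apply] at this
    rw [← this]
    simp [mul_apply, dotProduct, col]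
  let v : n → EuclideanSpace ℂ n := fun i => WithLp.toLp 2 ((((√(ev i))⁻¹ : ℝ) : ℂ) • X.col i)
  have hv : Orthonormal ℂ (Set.domRestrict {i | ev i ≠ 0} v) := by
    rw [orthonormal_iff_ite]
    rintro ⟨i, hi⟩ ⟨j, hj⟩
    simp only [Set.domRestrict_apply, v, EuclideanSpace.inner_eq_star_dotProduct, Subtype.mk.injEq]
    rw [dotProduct_comm, star_smul, smul_dotProduct, dotProduct_smul, hdot]
    split_ifs with hij
    · subst hij
      have hpos : 0 < ev i := lt_of_le_of_ne (hnn i) (Ne.symm hi)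
      have hs : (√(ev i)) ≠ 0 := (Real.sqrt_pos.2 hpos).ne'
      have h3 : (√(ev i))⁻¹ * ((√(ev i))⁻¹ * ev i) = 1 := by
        field_simp
        rw [Real.sq_sqrt hpos.le]
      simp only [smul_eq_mul, Complex.star_def, Complex.conj_ofReal]
      exact_mod_cast h3
    · simp
  obtain ⟨b, hb⟩ := Orthonormal.exists_orthonormalBasis_extension_of_card_eq (𝕜 := ℂ)
    (finrank_euclideanSpace (ι := n)) hv
  set B : Matrix n n ℂ := of fun i j => b j i with hB
  have hBU : B ∈ unitaryGroup n ℂ := by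
    rw [mem_unitaryGroup_iff', star_eq_conjTranspose]
    ext i j
    have := orthonormal_iff_ite.1 b.orthonormal i j
    rw [EuclideanSpace.inner_eq_star_dotProduct] at this
    rw [one_apply, ← this]
    simp [mul_apply, dotProduct, hB, mul_comm]
  have hXB : X = B * diagonal (fun i => (√(ev i) : ℂ)) := by
    ext k i
    rw [mul_diagonal]
    by_cases hi : ev i = 0
    · have h0 : star (X.col i) ⬝ᵥ X.col i = 0 := by rw [hdot, if_pos rfl, hi]; simp
      have h1 : X.col i = 0 := dotProduct_star_self_eq_zero.1 h0
      have h2 := congrFun h1 k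
      rw [hi]
      simpa [col] using h2
    · have hpos : 0 < ev i := lt_of_le_of_ne (hnn i) (Ne.symm hi)
      have hs : ((√(ev i) : ℝ) : ℂ) ≠ 0 := by exact_mod_cast (Real.sqrt_pos.2 hpos).ne'
      simp only [hB, of_apply, hb i hi, v]
      simp [col]
      field_simp
  refine ⟨⟨B, hBU⟩ * V⁻¹, V, ?_⟩
  have e1 : ((V⁻¹ : unitaryGroup n ℂ) : Matrix n n ℂ) * V = 1 := UnitaryGroup.star_mul_self V
  have e2 : (V : Matrix n n ℂ) * (V⁻¹ : unitaryGroup n ℂ) = 1 := by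
    rw [← UnitaryGroup.mul_val, mul_inv_cancel]; rfl
  rw [UnitaryGroup.mul_val, show ∀ A C D E F : Matrix n n ℂ, A * C * (D * E * F) =
    A * (C * D) * E * F by intros; simp only [mul_assoc], e1, mul_one]
  simp only
  rw [← hXB, hX, mul_assoc, e2, mul_one]

/-- Half of trace-norm duality: the supremum of `|tr (W M)|` over unitaries `W` is attained. -/
theorem exists_trace_eq_traceNorm (M : Matrix n n ℂ) :
    ∃ W : unitaryGroup n ℂ, (W * M : Matrix n n ℂ).trace = traceNorm M := by
  obtain ⟨U, V, h⟩ := exists_polar M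
  refine ⟨U⁻¹, ?_⟩
  have e1 : ((U⁻¹ : unitaryGroup n ℂ) : Matrix n n ℂ) * U = 1 := UnitaryGroup.star_mul_self U
  have e2 : ((V⁻¹ : unitaryGroup n ℂ) : Matrix n n ℂ) * V = 1 := UnitaryGroup.star_mul_self V
  conv_lhs => rw [h]
  rw [← mul_assoc, e1, one_mul, trace_mul_comm, ← mul_assoc, e2, one_mul, trace_diagonal, traceNorm]
  push_cast
  rfl

theorem traceNorm_nonneg (M : Matrix n n ℂ) : 0 ≤ traceNorm M :=
  Finset.sum_nonneg fun _ _ => Real.sqrt_nonneg _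

/-- The other half of trace-norm duality, Hölder's inequality. -/
theorem norm_trace_mul_le (B M : Matrix n n ℂ) : ‖(B * M).trace‖ ≤ ‖B‖ * traceNorm M := by
  obtain ⟨U, V, h⟩ := exists_polar M
  set σ : n → ℝ := fun i => √((isHermitian_conjTranspose_mul_self M).eigenvalues i) with hσ
  have e : (B * M).trace = ∑ i, (((V⁻¹ : unitaryGroup n ℂ) : Matrix n n ℂ) * (B * U * V)) i i *
      σ i := by
    conv_lhs => rw [h]
    rw [show ∀ A C D E F : Matrix n n ℂ, A * (C * (D * E * F)) = (A * C * D * E) * F by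
      intros; simp only [mul_assoc], trace_mul_comm, ← mul_assoc]
    simp only [trace, diag_apply, mul_diagonal, hσ]
  rw [e, traceNorm, Finset.mul_sum]
  refine norm_sum_le_of_le _ fun i _ => ?_
  rw [norm_mul, Complex.norm_real, Real.norm_of_nonneg (Real.sqrt_nonneg _)]
  refine mul_le_mul_of_nonneg_right ((norm_entry_le _ i i).trans ?_) (Real.sqrt_nonneg _)
  rw [CStarRing.norm_coe_unitary_mul, CStarRing.norm_mul_coe_unitary,
    CStarRing.norm_mul_coe_unitary]

end TraceNorm

section Diamond

variable {A₀ A₁ Z₀ Z₁ n : Type} [Fintype A₀] [Fintype A₁] [Fintype Z₀] [Fintype Z₁] [Fintype n]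
  [DecidableEq A₀] [DecidableEq A₁] [DecidableEq Z₀] [DecidableEq Z₁] [DecidableEq n]

/-- The separation of the traced-out systems `Z₀` and `Z₁` from `A₀`, `A₁` and an ancilla. -/
def environmentEquiv (A₀ A₁ Z₀ Z₁ : Type) (k : ℕ) :
    ((A₀ × Z₀) × (A₁ × Z₁)) × Fin k ≃ ((A₀ × A₁) × Fin k) × (Z₀ × Z₁) where
  toFun s := (((s.1.1.1, s.1.2.1), s.2), (s.1.1.2, s.1.2.2))
  invFun p := (((p.1.1.1, p.2.1), (p.1.1.2, p.2.2)), p.1.2)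
  left_inv _ := rfl
  right_inv _ := rfl

/-- An observable on `A₀ A₁` and the ancilla, acting trivially on `Z₀` and `Z₁`. -/
def extendObservable (Z₀ Z₁ : Type) [DecidableEq Z₀] [DecidableEq Z₁] {k : ℕ}
    (W : Matrix ((A₀ × A₁) × Fin k) ((A₀ × A₁) × Fin k) ℂ) :
    Matrix (((A₀ × Z₀) × (A₁ × Z₁)) × Fin k) (((A₀ × Z₀) × (A₁ × Z₁)) × Fin k) ℂ :=
  (W ⊗ₖ (1 : Matrix (Z₀ × Z₁) (Z₀ × Z₁) ℂ)).submatrix (environmentEquiv A₀ A₁ Z₀ Z₁ k)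
    (environmentEquiv A₀ A₁ Z₀ Z₁ k)

theorem extendObservable_mem_unitaryGroup {k : ℕ}
    (W : unitaryGroup ((A₀ × A₁) × Fin k) ℂ) :
    extendObservable Z₀ Z₁ (W : Matrix ((A₀ × A₁) × Fin k) ((A₀ × A₁) × Fin k) ℂ) ∈
      unitaryGroup (((A₀ × Z₀) × (A₁ × Z₁)) × Fin k) ℂ := by
  have h := kronecker_mem_unitary W.2 (one_mem (unitary (Matrix (Z₀ × Z₁) (Z₀ × Z₁) ℂ)))
  rw [Unitary.mem_iff] at h
  rw [mem_unitaryGroup_iff, extendObservable, star_eq_conjTranspose, conjTranspose_submatrix,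
    submatrix_mul_equiv]
  have h2 := h.2
  rw [star_eq_conjTranspose] at h2
  rw [h2, submatrix_one_equiv]

omit [DecidableEq A₀] [DecidableEq A₁] [DecidableEq n] in
/-- In the Heisenberg picture, the partial trace becomes `extendObservable`. -/
theorem trace_mul_amplify {k : ℕ} (K : Matrix ((A₀ × Z₀) × (A₁ × Z₁)) n ℂ)
    (W : Matrix ((A₀ × A₁) × Fin k) ((A₀ × A₁) × Fin k) ℂ) (X : Matrix (n × Fin k) (n × Fin k) ℂ) :
    (W * amplify (traceOut ∘ₗ conjMap K) k X).trace =
      ((K ⊗ₖ (1 : Matrix (Fin k) (Fin k) ℂ))ᴴ * extendObservable Z₀ Z₁ W *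
        (K ⊗ₖ (1 : Matrix (Fin k) (Fin k) ℂ)) * X).trace := by
  set Y := (K ⊗ₖ (1 : Matrix (Fin k) (Fin k) ℂ)) * X *
      (K ⊗ₖ (1 : Matrix (Fin k) (Fin k) ℂ))ᴴ with hY
  set e := environmentEquiv A₀ A₁ Z₀ Z₁ k with he
  have hYent : ∀ s t, Y s t = (K * (of fun i j => X (i, s.2) (j, t.2)) * Kᴴ) s.1 t.1 := by
    intro s t
    simp only [hY, mul_apply, conjTranspose_apply, kroneckerMap_apply, Fintype.sum_prod_type,
      one_apply, of_apply]
    simp [Finset.sum_mul, apply_ite (starRingEnd ℂ)]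
  have hamp : ∀ p r, amplify (traceOut ∘ₗ conjMap K) k X p r = ∑ z, Y (e.symm (p, z))
      (e.symm (r, z)) := by
    intro p r
    simp only [hYent, Fintype.sum_prod_type]
    rfl
  have htr : (W * amplify (traceOut ∘ₗ conjMap K) k X).trace =
      (extendObservable Z₀ Z₁ W * Y).trace := by
    have hR : (extendObservable Z₀ Z₁ W * Y).trace = ∑ p, ∑ z, ∑ r, ∑ z',
        extendObservable Z₀ Z₁ W (e.symm (p, z)) (e.symm (r, z')) *
          Y (e.symm (r, z')) (e.symm (p, z)) := by
      simp only [trace, diag_apply, mul_apply]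
      rw [← e.symm.sum_comp, Fintype.sum_prod_type]
      refine Finset.sum_congr rfl fun p _ => Finset.sum_congr rfl fun z _ => ?_
      rw [← e.symm.sum_comp, Fintype.sum_prod_type]
    rw [hR]
    simp only [trace, diag_apply, mul_apply]
    refine Finset.sum_congr rfl fun p _ => ?_
    rw [Finset.sum_comm]
    refine Finset.sum_congr rfl fun r _ => ?_
    rw [hamp, Finset.mul_sum]
    refine Finset.sum_congr rfl fun z _ => ?_
    simp [extendObservable, ← he, one_apply]
  rw [htr, hY, ← Matrix.mul_assoc, trace_mul_comm]
  simp only [Matrix.mul_assoc]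

theorem norm_le_of_conjTranspose_mul_self {m : Type} [Fintype m] [DecidableEq m] (D : Matrix m n ℂ)
    (η : ℝ) (hη : 0 ≤ η) (h : Dᴴ * D = (η : ℂ) • 1) : ‖D‖ ≤ √η := by
  apply Real.le_sqrt_of_sq_le
  rw [sq, ← l2_opNorm_conjTranspose_mul_self, h, norm_smul, Complex.norm_real,
    Real.norm_of_nonneg hη]
  have : ‖(1 : Matrix n n ℂ)‖ ≤ 1 := norm_unitary_le 1
  nlinarith

/-- Channels with Stinespring operators close to each other are close in diamond norm. Only `K'` has to
be an isometry; the difference is assumed to be a multiple of one. -/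
theorem diamondNorm_sub_le (K K' : Matrix ((A₀ × Z₀) × (A₁ × Z₁)) n ℂ) (hK' : K'ᴴ * K' = 1)
    (η : ℝ) (hη : 0 ≤ η) (h : (K - K')ᴴ * (K - K') = (η : ℂ) • 1) :
    diamondNorm (traceOut ∘ₗ conjMap K - traceOut ∘ₗ conjMap K') ≤
      ENNReal.ofReal (√η * (2 + √η)) := by
  refine iSup_le fun k => iSup_le fun X => iSup_le fun hX => ENNReal.ofReal_le_ofReal ?_
  have hamp : amplify (traceOut ∘ₗ conjMap K - traceOut ∘ₗ conjMap K') k X =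
      amplify (traceOut ∘ₗ conjMap K) k X - amplify (traceOut ∘ₗ conjMap K') k X := by
    ext p r
    rfl
  obtain ⟨W, hW⟩ := exists_trace_eq_traceNorm
    (amplify (traceOut ∘ₗ conjMap K - traceOut ∘ₗ conjMap K') k X)
  set Q := K ⊗ₖ (1 : Matrix (Fin k) (Fin k) ℂ) with hQ
  set Q' := K' ⊗ₖ (1 : Matrix (Fin k) (Fin k) ℂ) with hQ'
  set O := extendObservable Z₀ Z₁ (W : Matrix ((A₀ × A₁) × Fin k) ((A₀ × A₁) × Fin k) ℂ) with hO
  have hkey : ((Qᴴ * O * (Q - Q') + (Q - Q')ᴴ * O * Q') * X).trace =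
      (traceNorm (amplify (traceOut ∘ₗ conjMap K - traceOut ∘ₗ conjMap K') k X) : ℂ) := by
    rw [← hW, hamp, mul_sub, trace_sub, trace_mul_amplify, trace_mul_amplify, ← trace_sub,
      ← sub_mul,
      conjTranspose_sub]
    congr 2
    simp only [hQ, hQ', hO, Matrix.mul_sub, Matrix.sub_mul]
    abel
  have hn : traceNorm (amplify (traceOut ∘ₗ conjMap K - traceOut ∘ₗ conjMap K') k X) =
      ‖((Qᴴ * O * (Q - Q') + (Q - Q')ᴴ * O * Q') * X).trace‖ := by
    rw [hkey, Complex.norm_real, Real.norm_of_nonneg (traceNorm_nonneg _)]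
  have hs : 0 ≤ √η := Real.sqrt_nonneg _
  have hD : ‖Q - Q'‖ ≤ √η := by
    refine norm_le_of_conjTranspose_mul_self _ η hη ?_
    have : Q - Q' = (K - K') ⊗ₖ (1 : Matrix (Fin k) (Fin k) ℂ) := by
      rw [hQ, hQ']; ext s t; simp [kroneckerMap_apply, sub_mul]
    rw [this, conjTranspose_kronecker, ← mul_kronecker_mul, h, conjTranspose_one, mul_one,
      smul_kronecker, one_kronecker_one]
  have hQ'n : ‖Q'‖ ≤ 1 := by
    have := norm_le_of_conjTranspose_mul_self Q' 1 zero_le_one (by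
      rw [hQ', conjTranspose_kronecker, ← mul_kronecker_mul, hK', conjTranspose_one, mul_one,
        one_kronecker_one]; simp)
    simpa using this
  have hQn : ‖Q‖ ≤ 1 + √η := by
    have := norm_add_le (Q - Q') Q'
    rw [sub_add_cancel] at this
    linarith
  have hOn : ‖O‖ ≤ 1 := norm_unitary_le ⟨O, extendObservable_mem_unitaryGroup W⟩
  have b1 : ‖Qᴴ * O * (Q - Q')‖ ≤ (1 + √η) * 1 * √η := by
    refine (l2_opNorm_mul _ _).trans ?_
    refine mul_le_mul ((l2_opNorm_mul _ _).trans ?_) hD (norm_nonneg _) (by positivity)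
    rw [l2_opNorm_conjTranspose]
    gcongr
  have b2 : ‖(Q - Q')ᴴ * O * Q'‖ ≤ √η * 1 * 1 := by
    refine (l2_opNorm_mul _ _).trans ?_
    refine mul_le_mul ((l2_opNorm_mul _ _).trans ?_) hQ'n (norm_nonneg _) (by positivity)
    rw [l2_opNorm_conjTranspose]
    gcongr
  rw [hn]
  refine (norm_trace_mul_le _ _).trans ?_
  calc _ ≤ ((1 + √η) * 1 * √η + √η * 1 * 1) * 1 :=
        mul_le_mul ((norm_add_le _ _).trans (add_le_add b1 b2)) hX (traceNorm_nonneg _)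
          (by positivity)
    _ = √η * (2 + √η) := by ring

end Diamond

/-! ### Port-based teleportation -/

section Ports

theorem IsIsometry.kronecker {m n m' n' : Type} [Fintype m] [Fintype m'] [DecidableEq n]
    [DecidableEq n']
    {V : Matrix m n ℂ} {V' : Matrix m' n' ℂ} (h : IsIsometry V) (h' : IsIsometry V')
    [Fintype n] [Fintype n'] : IsIsometry (V ⊗ₖ V') := by
  unfold IsIsometry at *
  rw [conjTranspose_kronecker, ← mul_kronecker_mul, h, h', one_kronecker_one]

theorem isIsometry_one {n : Type} [Fintype n] [DecidableEq n] : IsIsometry (1 : Matrix n n ℂ) := by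
  simp [IsIsometry]

theorem IsIsometry.submatrix {m n m' n' : Type} [Fintype m] [Fintype m'] [DecidableEq n]
    [DecidableEq n']
    {V : Matrix m n ℂ} (h : IsIsometry V) (e : m' ≃ m) (f : n' ≃ n) :
    IsIsometry (V.submatrix e f) := by
  unfold IsIsometry at *
  rw [conjTranspose_submatrix, submatrix_mul_equiv, h, submatrix_one_equiv]

theorem IsIsometry.apply {m n : Type} [Fintype m] [DecidableEq n] {V : Matrix m n ℂ}
    (h : IsIsometry V)
    (i j : n) : ∑ k, star (V k i) * V k j = if i = j then 1 else 0 := by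
  have := congrFun (congrFun h i) j
  rw [one_apply] at this
  rw [← this]
  simp [mul_apply]

variable {J : Type} [Fintype J] [DecidableEq J] (j₀ : J)

/-- The family of port systems is split into the system at the port `j` and the others, which are
relabelled by the ports other than `j₀`. -/
def portEquiv (Y : Type) (j : J) : (J → Y) ≃ Y × ({l // l ≠ j₀} → Y) :=
  ((Equiv.swap j₀ j).arrowCongr (Equiv.refl Y)).trans (Equiv.funSplitAt j₀ Y)

omit [Fintype J] in
theorem portEquiv_apply {Y : Type} (j : J) (y : J → Y) :
    portEquiv j₀ Y j y = (y j, fun l : {l // l ≠ j₀} => y (Equiv.swap j₀ j l)) := by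
  simp [portEquiv, Equiv.arrowCongr, Equiv.funSplitAt, Equiv.piSplitAt, Function.comp_def]

theorem prod_eq_mul_prod_ports (j : J) (g : J → ℂ) :
    ∏ l, g l = g j * ∏ l : {l // l ≠ j₀}, g (Equiv.swap j₀ j l) := by
  rw [← Equiv.prod_comp (Equiv.swap j₀ j), Fintype.prod_eq_mul_prod_subtype_ne _ j₀,
    Equiv.swap_apply_left]

theorem sum_sum_prod_eq_prod_sum_sum {L Y₀ Y₁ : Type} [Fintype L] [DecidableEq L] [Fintype Y₀]
    [Fintype Y₁] (f : L → Y₀ → Y₁ → ℂ) :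
    ∑ y₀ : L → Y₀, ∑ y₁ : L → Y₁, ∏ l, f l (y₀ l) (y₁ l) = ∏ l, ∑ y : Y₀ × Y₁, f l y.1 y.2 := by
  rw [Finset.prod_univ_sum, Fintype.piFinset_univ, ← Fintype.sum_prod_type',
    ← (Equiv.arrowProdEquivProdArrow L (fun _ => Y₀) (fun _ => Y₁)).sum_comp]
  rfl

/-- The column index of the controlled isometry: the port read from the register `C` is selected. -/
def selectEquiv {X Y Y' B C : Type} (ε : Y' ≃ (J → Y)) (e : C ≃ B × J) :
    (X × Y') × C ≃ (X × Y) × (({l // l ≠ j₀} → Y) × (B × J)) where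
  toFun s := ((s.1.1, (portEquiv j₀ Y (e s.2).2 (ε s.1.2)).1),
    ((portEquiv j₀ Y (e s.2).2 (ε s.1.2)).2, e s.2))
  invFun p := ((p.1.1, ε.symm ((portEquiv j₀ Y p.2.2.2).symm (p.1.2, p.2.1))), e.symm p.2.2)
  left_inv s := by simp
  right_inv p := by simp

/-- The row index of the controlled isometry: the unused ports join the discarded system. -/
def discardEquiv {A Z Z' R : Type} (ζ : Z' ≃ Z × R) : A × Z' ≃ (A × Z) × R :=
  ((Equiv.refl A).prodCongr ζ).trans (Equiv.prodAssoc A Z R).symm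

/-- The isometry `W` applied to the port that is named in the register `C`. -/
def portControlled {A X Y Y' Z Z' B C : Type} [DecidableEq Y] [DecidableEq B]
    (ε : Y' ≃ (J → Y)) (e : C ≃ B × J) (ζ : Z' ≃ Z × (({l // l ≠ j₀} → Y) × (B × J)))
    (W : Matrix (A × Z) (X × Y) ℂ) : Matrix (A × Z') ((X × Y') × C) ℂ :=
  (W ⊗ₖ (1 : Matrix (({l // l ≠ j₀} → Y) × (B × J)) _ ℂ)).submatrix (discardEquiv ζ)
    (selectEquiv j₀ ε e)

theorem IsIsometry.portControlled {A X Y Y' Z Z' B C : Type} [DecidableEq Y] [DecidableEq B]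
    [Fintype A] [Fintype X] [Fintype Y] [Fintype Y'] [Fintype Z] [Fintype Z'] [Fintype B]
      [Fintype C]
    [DecidableEq X] [DecidableEq Y'] [DecidableEq C]
    (ε : Y' ≃ (J → Y)) (e : C ≃ B × J) (ζ : Z' ≃ Z × (({l // l ≠ j₀} → Y) × (B × J)))
    {W : Matrix (A × Z) (X × Y) ℂ} (hW : IsIsometry W) : IsIsometry (portControlled j₀ ε e ζ W) :=
  (hW.kronecker isIsometry_one).submatrix _ _

/-- The amplitude of each basis state in `E` EPR pairs. -/
def eprAmplitude (E : ℕ) : ℂ := ((((√2 : ℝ) ^ E)⁻¹ : ℝ) : ℂ)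

theorem star_eprAmplitude (E : ℕ) : star (eprAmplitude E) = eprAmplitude E := Complex.conj_ofReal _

theorem eprAmplitude_mul_self (E : ℕ) : eprAmplitude E * eprAmplitude E = (2 ^ E : ℂ)⁻¹ := by
  rw [eprAmplitude, ← Complex.ofReal_mul, ← mul_inv, ← mul_pow, Real.mul_self_sqrt (by norm_num)]
  simp

/-- An isometry applied to one half of EPR pairs leaves the other half maximally mixed. -/
theorem IsIsometry.sum_epr {m n : Type} [Fintype m] [DecidableEq n] {V : Matrix m n ℂ}
    (h : IsIsometry V) (E : ℕ) (i j : n) :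
    ∑ k, star (eprAmplitude E * V k i) * (eprAmplitude E * V k j) =
      if i = j then (2 ^ E : ℂ)⁻¹ else 0 := by
  have h1 : ∀ k, star (eprAmplitude E * V k i) * (eprAmplitude E * V k j) =
      (2 ^ E : ℂ)⁻¹ * (star (V k i) * V k j) := fun k => by
    rw [← eprAmplitude_mul_self, star_mul, star_eprAmplitude]
    ring
  simp only [h1, ← Finset.mul_sum, h.apply, mul_ite, mul_one, mul_zero]

/-- The version of `IsIsometry.sum_epr` for a family of EPR pairs indexed by the ports. -/
theorem IsIsometry.sum_prod_epr {L Y₀ Y₁ n : Type} [Fintype L] [DecidableEq L] [Fintype Y₀]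
    [Fintype Y₁] [DecidableEq n] {V : Matrix (Y₀ × Y₁) n ℂ} (h : IsIsometry V) (E : ℕ)
    (t t' : L → n) :
    ∑ y₀ : L → Y₀, ∑ y₁ : L → Y₁, star (∏ l, eprAmplitude E * V (y₀ l, y₁ l) (t l)) *
      ∏ l, eprAmplitude E * V (y₀ l, y₁ l) (t' l) =
      if t = t' then ((2 ^ E : ℂ)⁻¹) ^ Fintype.card L else 0 := by
  simp only [star_prod, ← Finset.prod_mul_distrib]
  rw [sum_sum_prod_eq_prod_sum_sum (fun l y₀ y₁ => star (eprAmplitude E * V (y₀, y₁) (t l)) *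
      (eprAmplitude E * V (y₀, y₁) (t' l)))]
  simp only [h.sum_epr]
  split_ifs with ht
  · simp [ht]
  · obtain ⟨l, hl⟩ := Function.ne_iff.1 ht
    exact Finset.prod_eq_zero (Finset.mem_univ l) (if_neg hl)

/-- The operator `V` on one half of `E` EPR pairs; the other half, with a blank register, is encoded
in the register `C`. -/
def eprHalf {C X I : Type} {E : ℕ} (e : C ≃ Qubits (Fin E) × J)
    (V : Matrix X (I × Qubits (Fin E)) ℂ) :
    Matrix (C × X) I ℂ :=
  of fun s i => if (e s.1).2 = j₀ then eprAmplitude E * V s.2 (i, (e s.1).1) else 0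

/-- For each port, the operator `V` on one half of `E` EPR pairs; the other halves, with a blank
register, are encoded in the register `C`. -/
def eprPorts {C Y₀ Y₁ Y₀' Y₁' : Type} {E : ℕ} (e : C ≃ (J → Qubits (Fin E)) × J)
    (ε₀ : Y₀' ≃ (J → Y₀)) (ε₁ : Y₁' ≃ (J → Y₁)) (V : Matrix (Y₀ × Y₁) (Qubits (Fin E)) ℂ) :
    Matrix (C × (Y₀' × Y₁')) Unit ℂ :=
  of fun s _ => if (e s.1).2 = j₀ then
    ∏ l, eprAmplitude E * V (ε₀ s.2.1 l, ε₁ s.2.2 l) ((e s.1).1 l) else 0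

section Gram

variable {E : ℕ}

omit [Fintype J] in
theorem sum_star_eprHalf_mul {C X I : Type} [DecidableEq C] [Fintype X] [DecidableEq I]
    (e : C ≃ Qubits (Fin E) × J) {V : Matrix X (I × Qubits (Fin E)) ℂ} (h : IsIsometry V)
    (c c' : C) (i i' : I) :
    ∑ x, star (eprHalf j₀ e V (c, x) i) * eprHalf j₀ e V (c', x) i' =
      if i = i' ∧ c = c' ∧ (e c).2 = j₀ then (2 ^ E : ℂ)⁻¹ else 0 := by
  simp only [eprHalf, of_apply]
  by_cases hc : (e c).2 = j₀
  · by_cases hc' : (e c').2 = j₀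
    · simp only [hc, hc', if_true, h.sum_epr, Prod.mk.injEq]
      refine if_congr (and_congr_right' ?_) rfl rfl
      rw [and_true, ← e.injective.eq_iff, Prod.ext_iff, hc, hc', and_iff_left rfl]
    · have : c ≠ c' := fun h => hc' (h ▸ hc)
      simp [hc', this]
  · simp [hc]

theorem sum_star_eprPorts_mul {C Y₀ Y₁ Y₀' Y₁' : Type} [DecidableEq C] [Fintype Y₀] [Fintype Y₁]
    [Fintype Y₀']
    [Fintype Y₁'] (e : C ≃ (J → Qubits (Fin E)) × J)
    (ε₀ : Y₀' ≃ (J → Y₀)) (ε₁ : Y₁' ≃ (J → Y₁)) {V : Matrix (Y₀ × Y₁) (Qubits (Fin E)) ℂ}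
    (h : IsIsometry V) (c c' : C) (u : Unit) :
    ∑ y, star (eprPorts j₀ e ε₀ ε₁ V (c, y) u) * eprPorts j₀ e ε₀ ε₁ V (c', y) u =
      if c = c' ∧ (e c).2 = j₀ then ((2 ^ E : ℂ)⁻¹) ^ Fintype.card J else 0 := by
  simp only [eprPorts, of_apply]
  by_cases hc : (e c).2 = j₀
  · by_cases hc' : (e c').2 = j₀
    · simp only [hc, hc', if_true, and_true]
      have h1 : c = c' ↔ (e c).1 = (e c').1 := by
        rw [← e.injective.eq_iff, Prod.ext_iff, hc, hc', and_iff_left rfl]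
      rw [if_congr h1 rfl rfl, ← h.sum_prod_epr E, Fintype.sum_prod_type, ← Equiv.sum_comp ε₀]
      exact Finset.sum_congr rfl fun y₀ _ => Equiv.sum_comp ε₁ (fun y₁ =>
        star (∏ l, eprAmplitude E * V (ε₀ y₀ l, y₁ l) ((e c).1 l)) *
          ∏ l, eprAmplitude E * V (ε₀ y₀ l, y₁ l) ((e c').1 l))
    · have : c ≠ c' := fun h => hc' (h ▸ hc)
      simp [hc', this]
  · simp [hc]

theorem sum_ite_register {C B : Type} [Fintype C] [Fintype B] (e : C ≃ B × J) (f : C → ℂ) :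
    ∑ c, (if (e c).2 = j₀ then f c else 0) = ∑ b, f (e.symm (b, j₀)) := by
  rw [← Equiv.sum_comp e.symm, Fintype.sum_prod_type]
  simp

theorem isIsometry_eprHalf {C X I : Type} [Fintype C] [Fintype X] [DecidableEq I]
    (e : C ≃ Qubits (Fin E) × J) {V : Matrix X (I × Qubits (Fin E)) ℂ} (h : IsIsometry V) :
    IsIsometry (eprHalf j₀ e V) := by
  classical
  ext i i'
  simp only [mul_apply, Fintype.sum_prod_type, conjTranspose_apply]
  simp only [sum_star_eprHalf_mul j₀ e h, true_and, one_apply]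
  split_ifs with hi
  · simp only [hi, true_and, sum_ite_register j₀ e fun _ => (2 ^ E : ℂ)⁻¹]
    simp
  · simp [hi]

theorem isIsometry_eprPorts {C Y₀ Y₁ Y₀' Y₁' : Type} [Fintype C] [Fintype Y₀] [Fintype Y₁]
    [Fintype Y₀'] [Fintype Y₁'] (e : C ≃ (J → Qubits (Fin E)) × J)
    (ε₀ : Y₀' ≃ (J → Y₀)) (ε₁ : Y₁' ≃ (J → Y₁)) {V : Matrix (Y₀ × Y₁) (Qubits (Fin E)) ℂ}
    (h : IsIsometry V) : IsIsometry (eprPorts j₀ e ε₀ ε₁ V) := by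
  classical
  ext u u'
  rw [mul_apply, Fintype.sum_prod_type]
  simp only [conjTranspose_apply]
  simp only [sum_star_eprPorts_mul j₀ e ε₀ ε₁ h, true_and, one_apply]
  rw [sum_ite_register j₀ e fun _ => ((2 ^ E : ℂ)⁻¹) ^ Fintype.card J]
  simp

end Gram

variable {d₀ d₁ : ℕ} {ι : Type} {E : ℕ} (P : NonlocalProtocol d₀ d₁ ι E) {a b : ℕ}
  (eL : Qubits (Fin a) ≃ Qubits (Fin E) × J) (eR : Qubits (Fin b) ≃ (J → Qubits (Fin E)) × J)

/-- The local processing for port-based teleportation. The left shares `E` EPR pairs with itself and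
applies the first operation of the protocol to one half; the right prepares, for each port `j : J`,
the state obtained by applying its first operation to one half of `E` EPR pairs. The other halves
enter the interaction, together with blank registers in which the interaction writes the port. After
it, both sides continue with the systems at that port. -/
def portProcessing : LocalProcessing d₀ d₁ ι a b where
  x₀ := P.x₀
  x₁ := P.x₁
  y₀ := Fintype.card (J → Fin P.y₀)
  y₁ := Fintype.card (J → Fin P.y₁)
  z₀ := Fintype.card (Fin P.z₀ × (({l // l ≠ j₀} → Fin P.y₀) × (Qubits (Fin E) × J)))
  z₁ := Fintype.card (Fin P.z₁ × (({l // l ≠ j₀} → Fin P.y₁) × ((J → Qubits (Fin E)) × J)))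
  VL := eprHalf j₀ eL P.VL
  VR x := eprPorts j₀ eR (Fintype.equivFin _).symm (Fintype.equivFin _).symm (P.VR x)
  WL x := portControlled j₀ (Fintype.equivFin _).symm eL (Fintype.equivFin _).symm (P.WL x)
  WR x := portControlled j₀ (Fintype.equivFin _).symm eR (Fintype.equivFin _).symm (P.WR x)
  isometry_VL := isIsometry_eprHalf j₀ eL P.isometry_VL
  isometry_VR x := isIsometry_eprPorts j₀ eR _ _ (P.isometry_VR x)
  isometry_WL x := (P.isometry_WL x).portControlled j₀ _ _ _
  isometry_WR x := (P.isometry_WR x).portControlled j₀ _ _ _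

end Ports

/-! ### Local processing around an arbitrary operator -/

namespace LocalProcessing

variable {d₀ d₁ : ℕ} {ι : Type} {a b : ℕ} (L : LocalProcessing d₀ d₁ ι a b)

/-- The regrouping of all systems for the exchange. -/
def regroupEquiv :
    ((Fin L.x₀ × Fin L.y₀) × Qubits (Fin a)) × ((Fin L.x₁ × Fin L.y₁) × Qubits (Fin b)) ≃
    Qubits (Fin a ⊕ Fin b) × ((Fin L.x₀ × Fin L.x₁) × (Fin L.y₀ × Fin L.y₁)) where
  toFun s := (Sum.elim s.1.2 s.2.2, ((s.1.1.1, s.2.1.1), (s.1.1.2, s.2.1.2)))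
  invFun p := (((p.2.1.1, p.2.2.1), fun i => p.1 (Sum.inl i)),
    ((p.2.1.2, p.2.2.2), fun i => p.1 (Sum.inr i)))
  left_inv s := by simp
  right_inv p := by
    refine Prod.ext (funext fun i => ?_) rfl
    cases i <;> rfl

/-- `LocalProcessing.total` with an arbitrary operator `O` in place of the interaction unitary. -/
def totalWith (O : Matrix (Qubits (Fin a ⊕ Fin b)) (Qubits (Fin a ⊕ Fin b)) ℂ) (x : ι) :
    Matrix ((Fin d₀ × Fin L.z₀) × (Fin d₁ × Fin L.z₁)) (Fin d₀ × Fin d₁) ℂ :=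
  (L.WL x ⊗ₖ L.WR x) * ((O ⊗ₖ (1 : Matrix ((Fin L.x₀ × Fin L.x₁) × (Fin L.y₀ × Fin L.y₁))
      ((Fin L.x₀ × Fin L.x₁) × (Fin L.y₀ × Fin L.y₁)) ℂ)) *
        L.prepared x).submatrix L.regroupEquiv id

theorem total_eq_totalWith (V : unitaryGroup (Qubits (Fin a ⊕ Fin b)) ℂ) (x : ι) :
    L.total V x = L.totalWith V x := rfl

theorem totalWith_sub (O O' : Matrix (Qubits (Fin a ⊕ Fin b)) (Qubits (Fin a ⊕ Fin b)) ℂ) (x : ι) :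
    L.totalWith (O - O') x = L.totalWith O x - L.totalWith O' x := by
  have h : (O - O') ⊗ₖ (1 : Matrix ((Fin L.x₀ × Fin L.x₁) × (Fin L.y₀ × Fin L.y₁))
      ((Fin L.x₀ × Fin L.x₁) × (Fin L.y₀ × Fin L.y₁)) ℂ) = O ⊗ₖ 1 - O' ⊗ₖ 1 := by
    ext i j
    simp [sub_mul]
  simp only [totalWith, h, Matrix.sub_mul, ← Matrix.mul_sub]
  rfl

theorem conjTranspose_totalWith_mul_self
    (O : Matrix (Qubits (Fin a ⊕ Fin b)) (Qubits (Fin a ⊕ Fin b)) ℂ) (x : ι)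
      (i i' : Fin d₀ × Fin d₁) :
    ((L.totalWith O x)ᴴ * L.totalWith O x) i i' =
      ∑ r, ∑ q, ∑ q', star (O r q) * O r q' *
        ∑ y, star (L.prepared x (q, y) i) * L.prepared x (q', y) i' := by
  have h := (L.isometry_WL x).kronecker (L.isometry_WR x)
  rw [totalWith, conjTranspose_mul, Matrix.mul_assoc, ← Matrix.mul_assoc (_ᴴ) (_ ⊗ₖ _), h,
    Matrix.one_mul, conjTranspose_submatrix, submatrix_mul_equiv, submatrix_id_id, mul_apply,
    Fintype.sum_prod_type]
  refine Finset.sum_congr rfl fun r _ => ?_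
  have h1 : ∀ y i, ((O ⊗ₖ (1 : Matrix ((Fin L.x₀ × Fin L.x₁) × (Fin L.y₀ × Fin L.y₁))
      ((Fin L.x₀ × Fin L.x₁) × (Fin L.y₀ × Fin L.y₁)) ℂ)) * L.prepared x) (r, y) i =
      ∑ q, O r q * L.prepared x (q, y) i := fun y i => by
    rw [mul_apply, Fintype.sum_prod_type]
    simp [one_apply]
  simp only [conjTranspose_apply, h1, star_sum, Finset.sum_mul_sum]
  rw [Finset.sum_comm]
  refine Finset.sum_congr rfl fun q _ => ?_
  rw [Finset.sum_comm]
  refine Finset.sum_congr rfl fun q' _ => ?_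
  rw [Finset.mul_sum]
  refine Finset.sum_congr rfl fun y _ => ?_
  rw [star_mul]
  ring

end LocalProcessing

section Ports

variable {J : Type} [Fintype J] [DecidableEq J] (j₀ : J)
variable {d₀ d₁ : ℕ} {ι : Type} {E : ℕ} (P : NonlocalProtocol d₀ d₁ ι E) {a b : ℕ}
  (eL : Qubits (Fin a) ≃ Qubits (Fin E) × J) (eR : Qubits (Fin b) ≃ (J → Qubits (Fin E)) × J)

/-- The prepared state is maximally mixed on the registers to be teleported, blank on the port
registers, and isometric in the input: the partial inner product over all other systems is the
reduced density matrix, for any two inputs. -/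
theorem sum_star_prepared_mul (x : ι) (q q' : Qubits (Fin a ⊕ Fin b)) (i i' : Fin d₀ × Fin d₁) :
    ∑ y, star ((portProcessing j₀ P eL eR).prepared x (q, y) i) *
        (portProcessing j₀ P eL eR).prepared x (q', y) i' =
      if i = i' ∧ q = q' ∧ (eL fun s => q (Sum.inl s)).2 = j₀ ∧ (eR fun s => q (Sum.inr s)).2 = j₀
      then (2 ^ E : ℂ)⁻¹ * ((2 ^ E : ℂ)⁻¹) ^ Fintype.card J else 0 := by
  have h := P.isometry_VL
  have h' := P.isometry_VR x
  have h1 := sum_star_eprHalf_mul j₀ eL h (fun s => q (Sum.inl s)) (fun s => q' (Sum.inl s)) i i'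
  have h2 := sum_star_eprPorts_mul j₀ eR (Fintype.equivFin _).symm (Fintype.equivFin _).symm h'
    (fun s => q (Sum.inr s)) (fun s => q' (Sum.inr s)) ()
  have h3 : q = q' ↔ (fun s => q (Sum.inl s)) = (fun s => q' (Sum.inl s)) ∧
      (fun s => q (Sum.inr s)) = (fun s => q' (Sum.inr s)) := by
    constructor
    · rintro rfl; exact ⟨rfl, rfl⟩
    · rintro ⟨hl, hr⟩
      funext s
      cases s with
      | inl s => exact congrFun hl s
      | inr s => exact congrFun hr s
  refine Eq.trans ?_ ((congrArg₂ (· * ·) h1 h2).trans ?_)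
  · rw [Finset.sum_mul_sum, Fintype.sum_prod_type]
    refine Finset.sum_congr rfl fun y₀ _ => Finset.sum_congr rfl fun y₁ _ => ?_
    exact (congrArg₂ (· * ·) (star_mul' _ _) rfl).trans (mul_mul_mul_comm _ _ _ _)
  · rw [ite_zero_mul_ite_zero]
    exact if_congr (by rw [h3]; tauto) rfl rfl

/-- The basis state with the contents `p` in the registers to be teleported and blank registers for
the port. -/
def blankBasis (p : Qubits (Fin E) × (J → Qubits (Fin E))) : Qubits (Fin a ⊕ Fin b) :=
  Sum.elim (eL.symm (p.1, j₀)) (eR.symm (p.2, j₀))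

/-- As the prepared state is maximally mixed on the teleported registers, the norm of the total
operator is an average over columns. -/
theorem conjTranspose_totalWith_portProcessing
    (O : Matrix (Qubits (Fin a ⊕ Fin b)) (Qubits (Fin a ⊕ Fin b)) ℂ) (x : ι) :
    ((portProcessing j₀ P eL eR).totalWith O x)ᴴ * (portProcessing j₀ P eL eR).totalWith O x =
      (((2 ^ E : ℝ)⁻¹ ^ (Fintype.card J + 1) *
        ∑ p, ∑ r, ‖O r (blankBasis j₀ eL eR p)‖ ^ 2 : ℝ) : ℂ) • 1 := by
  ext i i'
  rw [LocalProcessing.conjTranspose_totalWith_mul_self]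
  simp only [sum_star_prepared_mul]
  have h1 : ∀ r q q' : Qubits (Fin a ⊕ Fin b), star (O r q) * O r q' *
      (if i = i' ∧ q = q' ∧ (eL fun s => q (Sum.inl s)).2 = j₀ ∧ (eR fun s => q (Sum.inr s)).2 = j₀
      then (2 ^ E : ℂ)⁻¹ * ((2 ^ E : ℂ)⁻¹) ^ Fintype.card J else 0) =
      if q = q' then if (eR fun s => q (Sum.inr s)).2 = j₀ then
        if (eL fun s => q (Sum.inl s)).2 = j₀ then
        if i = i' then (2 ^ E : ℂ)⁻¹ ^ (Fintype.card J + 1) * (‖O r q‖ ^ 2 : ℝ) else 0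
          else 0 else 0 else 0 := fun r q q' => by
    by_cases hq : q = q'
    · subst hq
      rw [pow_succ', mul_comm (star (O r q)), show O r q * star (O r q) = (‖O r q‖ ^ 2 : ℝ) by
        push_cast; exact Complex.mul_conj' _]
      simp only [← ite_and, mul_ite, mul_zero, true_and]
      refine if_congr (by tauto) (by ring) rfl
    · simp [hq]
  simp only [h1, Finset.sum_ite_eq, Finset.mem_univ, if_true]
  have h2 : ∀ f : Qubits (Fin a ⊕ Fin b) → ℂ,
      ∑ q, (if (eR fun s => q (Sum.inr s)).2 = j₀ then
        if (eL fun s => q (Sum.inl s)).2 = j₀ then f q else 0 else 0) =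
        ∑ p, f (blankBasis j₀ eL eR p) := fun f => by
    rw [← (Equiv.sumArrowEquivProdArrow (Fin a) (Fin b) (Fin 2)).symm.sum_comp,
      Fintype.sum_prod_type, Fintype.sum_prod_type]
    have h3 := fun cL => sum_ite_register j₀ eR fun cR => if (eL cL).2 = j₀ then
      f (Sum.elim cL cR) else 0
    refine (Fintype.sum_congr _ _ h3).trans ?_
    rw [Finset.sum_comm]
    have h4 := fun t => sum_ite_register j₀ eL fun cL => f (Sum.elim cL (eR.symm (t, j₀)))
    refine (Fintype.sum_congr _ _ h4).trans ?_
    rw [Finset.sum_comm]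
    rfl
  simp only [h2]
  rw [Finset.sum_comm, Matrix.smul_apply, one_apply]
  split_ifs
  · push_cast
    simp only [← Finset.mul_sum]
    simp
  · simp

end Ports

/-! ### Unitary approximation of an operator that is nearly an isometry -/

section Polar

variable {n : Type} [Fintype n] [DecidableEq n]

omit [Fintype n] [DecidableEq n] in
theorem ofReal_sum_norm_sq_col {m : Type} [Fintype m] (A : Matrix m n ℂ) (p : n) :
    ((∑ q, ‖A q p‖ ^ 2 : ℝ) : ℂ) = (Aᴴ * A) p p := by
  rw [mul_apply]
  push_cast
  exact Finset.sum_congr rfl fun q _ => (Complex.conj_mul' _).symm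

theorem sum_norm_sq_col_le (A : Matrix n n ℂ) (p : n) : ∑ q, ‖A q p‖ ^ 2 ≤ ‖A‖ ^ 2 := by
  have h := norm_entry_le (Aᴴ * A) p p
  rw [← ofReal_sum_norm_sq_col, ← star_eq_conjTranspose, CStarRing.norm_star_mul_self,
    Complex.norm_real, ← pow_two] at h
  exact (le_abs_self _).trans h

theorem sum_norm_sq_unitary_mul_col (U : unitaryGroup n ℂ) (A : Matrix n n ℂ) (p : n) :
    ∑ q, ‖((U : Matrix n n ℂ) * A) q p‖ ^ 2 = ∑ q, ‖A q p‖ ^ 2 := by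
  have h : (((U : Matrix n n ℂ) * A)ᴴ * ((U : Matrix n n ℂ) * A)) = Aᴴ * A := by
    rw [conjTranspose_mul, Matrix.mul_assoc, ← Matrix.mul_assoc (_ᴴ) _ A,
      ← star_eq_conjTranspose (U : Matrix n n ℂ),
      UnitaryGroup.star_mul_self, Matrix.one_mul]
  apply Complex.ofReal_injective
  rw [ofReal_sum_norm_sq_col, ofReal_sum_norm_sq_col, h]

omit [DecidableEq n] in
theorem sum_norm_sq_sub_col_le (A B C : Matrix n n ℂ) (p : n) :
    ∑ q, ‖(A - C) q p‖ ^ 2 ≤ 2 * ∑ q, ‖(A - B) q p‖ ^ 2 + 2 * ∑ q, ‖(B - C) q p‖ ^ 2 := by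
  rw [Finset.mul_sum, Finset.mul_sum, ← Finset.sum_add_distrib]
  refine Finset.sum_le_sum fun q _ => ?_
  have h : ‖(A - C) q p‖ ≤ ‖(A - B) q p‖ + ‖(B - C) q p‖ := by
    rw [show (A - C) q p = (A - B) q p + (B - C) q p by simp]
    exact norm_add_le _ _
  nlinarith [norm_nonneg ((A - C) q p), sq_nonneg (‖(A - B) q p‖ - ‖(B - C) q p‖)]

/-- The unitary factor `U` of the polar decomposition `T = U R` satisfies
`(U - T)† (U - T) = (1 - R) ^ 2 ≤ (1 - R ^ 2) ^ 2 = (1 - T† T) ^ 2`. -/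
theorem exists_unitary_sum_norm_sq_col_le (T : Matrix n n ℂ) :
    ∃ U : unitaryGroup n ℂ, ∀ p,
      ∑ q, ‖((U : Matrix n n ℂ) - T) q p‖ ^ 2 ≤ ∑ q, ‖(1 - Tᴴ * T) q p‖ ^ 2 := by
  obtain ⟨U, V, hT⟩ := exists_polar T
  set σ : n → ℝ := fun i => √((isHermitian_conjTranspose_mul_self T).eigenvalues i) with hσ
  have hσ0 : ∀ i, 0 ≤ σ i := fun i => Real.sqrt_nonneg _
  have hVV : (V : Matrix n n ℂ) * ((V⁻¹ : unitaryGroup n ℂ) : Matrix n n ℂ) = 1 := by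
    rw [← UnitaryGroup.mul_val, mul_inv_cancel]; rfl
  have hVV' : ((V⁻¹ : unitaryGroup n ℂ) : Matrix n n ℂ) * (V : Matrix n n ℂ) = 1 := by
    rw [← UnitaryGroup.mul_val, inv_mul_cancel]; rfl
  have hUU : (U : Matrix n n ℂ)ᴴ * U = 1 := UnitaryGroup.star_mul_self U
  have hVs : (((V⁻¹ : unitaryGroup n ℂ) : Matrix n n ℂ))ᴴ = V := by
    change ((V : Matrix n n ℂ)ᴴ)ᴴ = V
    rw [conjTranspose_conjTranspose]
  have hVs' : ((V : Matrix n n ℂ))ᴴ = ((V⁻¹ : unitaryGroup n ℂ) : Matrix n n ℂ) := rfl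
  have hd : ∀ f : n → ℂ, (1 : Matrix n n ℂ) - V * diagonal f * ((V⁻¹ : unitaryGroup n ℂ) :
      Matrix n n ℂ) =
      V * (diagonal (fun i => 1 - f i) * ((V⁻¹ : unitaryGroup n ℂ) : Matrix n n ℂ)) := fun f => by
    rw [show (diagonal fun i => 1 - f i) = 1 - diagonal f by
      rw [← diagonal_one, diagonal_sub], Matrix.sub_mul, Matrix.one_mul, Matrix.mul_sub, hVV,
        Matrix.mul_assoc]
  have h1 : (U : Matrix n n ℂ) - T = U * (1 - V * diagonal (fun i => (σ i : ℂ)) *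
      ((V⁻¹ : unitaryGroup n ℂ) : Matrix n n ℂ)) := by
    rw [Matrix.mul_sub, Matrix.mul_one, ← hT]
  have h2 : Tᴴ * T = V * diagonal (fun i => (σ i : ℂ) * σ i) * ((V⁻¹ : unitaryGroup n ℂ) :
      Matrix n n ℂ) := by
    conv_lhs => rw [hT]
    rw [conjTranspose_mul, conjTranspose_mul, conjTranspose_mul, hVs, hVs', diagonal_conjTranspose]
    simp only [Matrix.mul_assoc]
    rw [← Matrix.mul_assoc (U : Matrix n n ℂ)ᴴ, hUU, Matrix.one_mul,
      ← Matrix.mul_assoc ((V⁻¹ : unitaryGroup n ℂ) : Matrix n n ℂ) (V : Matrix n n ℂ), hVV',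
        Matrix.one_mul,
      ← Matrix.mul_assoc (diagonal _), diagonal_mul_diagonal]
    congr 3
    ext i
    simp [hσ]
  refine ⟨U, fun p => ?_⟩
  rw [h1, sum_norm_sq_unitary_mul_col, h2, hd, hd, sum_norm_sq_unitary_mul_col,
    sum_norm_sq_unitary_mul_col]
  refine Finset.sum_le_sum fun q _ => ?_
  rw [diagonal_mul, diagonal_mul, norm_mul, norm_mul, mul_pow, mul_pow]
  refine mul_le_mul_of_nonneg_right ?_ (sq_nonneg _)
  rw [← Complex.ofReal_one, ← Complex.ofReal_mul, ← Complex.ofReal_sub, ← Complex.ofReal_sub,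
    Complex.norm_real, Complex.norm_real, Real.norm_eq_abs, Real.norm_eq_abs, sq_abs, sq_abs]
  have := hσ0 q
  nlinarith [mul_nonneg (mul_nonneg (sq_nonneg (1 - σ q)) this) (by linarith : (0:ℝ) ≤ 2 + σ q)]

end Polar

/-! ### The operator of port-based teleportation -/

section PortMatrix

variable {Q J : Type} [Fintype Q] [DecidableEq Q] [Fintype J] [DecidableEq J] (j₀ : J)

omit [Fintype J] [Fintype Q] [DecidableEq Q] in
theorem portEquiv_snd_eq_iff (j : J) (s t : J → Q) :
    (portEquiv j₀ Q j s).2 = (portEquiv j₀ Q j t).2 ↔ ∀ l, l ≠ j → s l = t l := by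
  rw [portEquiv_apply, portEquiv_apply]
  constructor
  · intro h l hl
    have h1 : Equiv.swap j₀ j l ≠ j₀ := fun h2 => hl (by
      rwa [Equiv.swap_apply_eq_iff, Equiv.swap_apply_left] at h2)
    simpa using congrFun h ⟨_, h1⟩
  · intro h
    funext l
    refine h _ fun h2 => l.2 ?_
    rwa [Equiv.swap_apply_eq_iff, Equiv.swap_apply_right] at h2

theorem sum_ite_portEquiv_snd (j : J) (v : {l // l ≠ j₀} → Q) :
    ∑ t : J → Q, (if (portEquiv j₀ Q j t).2 = v then (1 : ℝ) else 0) = Fintype.card Q := by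
  rw [(portEquiv j₀ Q j).sum_comp (fun p => if p.2 = v then (1 : ℝ) else 0), Fintype.sum_prod_type]
  simp

theorem card_mul_sum_ite_eq {j j' : J} (hj : j' ≠ j) :
    (Fintype.card Q : ℝ) * ∑ t : J → Q, (if t j = t j' then (1 : ℝ) else 0) =
      (Fintype.card Q : ℝ) ^ Fintype.card J := by
  have h2 : ∀ t : J → Q, (if t j = t j' then (1 : ℝ) else 0) =
      if (portEquiv j Q j t).1 = (portEquiv j Q j t).2 ⟨j', hj⟩ then 1 else 0 := by
    intro t
    simp [portEquiv_apply]
  rw [Fintype.sum_congr _ _ h2,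
    (portEquiv j Q j).sum_comp (fun p => if p.1 = p.2 ⟨j', hj⟩ then (1 : ℝ) else 0),
    Fintype.sum_prod_type, Finset.sum_comm]
  have h3 := Fintype.card_congr (portEquiv j Q j)
  rw [Fintype.card_prod, Fintype.card_fun] at h3
  simp only [Finset.sum_ite_eq', Finset.mem_univ, if_true, Finset.sum_const, Finset.card_univ]
  rw [nsmul_one, ← Nat.cast_mul, ← h3]
  push_cast
  rfl

/-- Up to the factor `card Q`, the projection onto the maximally entangled state of the register `Q`
and the port `j` has an entry `1` between the contents `p'` and `p` if this holds, and `0`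
otherwise. -/
def PortMatch (j : J) (p' p : Q × (J → Q)) : Prop :=
  p'.1 = p'.2 j ∧ p.1 = p.2 j ∧ (portEquiv j₀ Q j p'.2).2 = (portEquiv j₀ Q j p.2).2

instance (j : J) (p' p : Q × (J → Q)) : Decidable (PortMatch j₀ j p' p) := by
  unfold PortMatch
  infer_instance

theorem sum_portMatch_self (j : J) :
    ∑ p : Q × (J → Q), (if PortMatch j₀ j p p then (1 : ℝ) else 0) =
      (Fintype.card Q : ℝ) ^ Fintype.card J := by
  rw [Fintype.sum_prod_type, Finset.sum_comm]
  simp [PortMatch]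

theorem sum_portMatch (j : J) :
    ∑ p : Q × (J → Q), ∑ p' : Q × (J → Q), (if PortMatch j₀ j p' p then (1 : ℝ) else 0) =
      (Fintype.card Q : ℝ) ^ (Fintype.card J + 1) := by
  have h : ∀ p : Q × (J → Q), ∑ p' : Q × (J → Q), (if PortMatch j₀ j p' p then (1 : ℝ) else 0) =
      if p.1 = p.2 j then (Fintype.card Q : ℝ) else 0 := fun p => by
    rw [Fintype.sum_prod_type, Finset.sum_comm,
      ← sum_ite_portEquiv_snd j₀ j (portEquiv j₀ Q j p.2).2]
    simp only [PortMatch, ite_and, Finset.sum_ite_eq', Finset.mem_univ, if_true]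
    split_ifs <;> simp
  rw [Fintype.sum_congr _ _ h, Fintype.sum_prod_type, Finset.sum_comm]
  simp [pow_succ]

theorem card_sq_mul_sum_portMatch_mul {j j' : J} (hj : j' ≠ j) :
    (Fintype.card Q : ℝ) ^ 2 * ∑ p : Q × (J → Q), ∑ p' : Q × (J → Q),
      (if PortMatch j₀ j p' p then (1 : ℝ) else 0) * (if PortMatch j₀ j' p' p then (1 : ℝ) else 0) =
      (Fintype.card Q : ℝ) ^ (Fintype.card J + 1) := by
  have h : ∀ p p' : Q × (J → Q), (if PortMatch j₀ j p' p then (1 : ℝ) else 0) *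
      (if PortMatch j₀ j' p' p then (1 : ℝ) else 0) =
      if p' = p then if p.2 j = p.1 ∧ p.2 j = p.2 j' then 1 else 0 else 0 := fun p p' => by
    rw [ite_zero_mul_ite_zero, mul_one, ← ite_and]
    refine if_congr ⟨?_, ?_⟩ rfl rfl
    · rintro ⟨⟨h1, h2, h3⟩, h4, h5, h6⟩
      rw [portEquiv_snd_eq_iff] at h3 h6
      have h7 := h6 j hj.symm
      refine ⟨Prod.ext (by rw [h1, h2, h7]) (funext fun l => ?_), h2.symm, by rw [← h2, h5]⟩
      by_cases hl : l = j
      · rw [hl, h7]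
      · exact h3 l hl
    · rintro ⟨rfl, h1, h2⟩
      exact ⟨⟨h1.symm, h1.symm, rfl⟩, by rw [← h1, h2], by rw [← h1, h2], rfl⟩
  simp only [h, Finset.sum_ite_eq', Finset.mem_univ, if_true]
  rw [Fintype.sum_prod_type, Finset.sum_comm]
  simp only [ite_and, Finset.sum_ite_eq, Finset.mem_univ, if_true]
  rw [pow_two, mul_assoc, card_mul_sum_ite_eq hj, pow_succ, mul_comm]

/-- The deviation from the identity, in the Frobenius norm, of the uniform mixture of the port
projections scaled to have mean eigenvalue `1`. The projections for different ports are
uncorrelated in the maximally mixed state, so that the variance of the mixture is at most that of a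
single projection divided by the number of ports. -/
theorem sum_sq_sub_portMatch_le [Nonempty Q] :
    ∑ p : Q × (J → Q), ∑ p' : Q × (J → Q), ((if p' = p then (1 : ℝ) else 0) -
        Fintype.card Q / Fintype.card J * ∑ j, if PortMatch j₀ j p' p then (1 : ℝ) else 0) ^ 2 ≤
      (Fintype.card Q : ℝ) ^ (Fintype.card J + 1) * ((Fintype.card Q : ℝ) ^ 2 / Fintype.card J) := by
  have : Nonempty J := ⟨j₀⟩
  set d : ℝ := (Fintype.card Q : ℝ) with hd
  set N : ℝ := (Fintype.card J : ℝ) with hN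
  have hd0 : 0 < d := by rw [hd]; exact_mod_cast Fintype.card_pos
  have hN0 : 0 < N := by rw [hN]; exact_mod_cast Fintype.card_pos
  set M : J → Q × (J → Q) → Q × (J → Q) → ℝ := fun j p' p => if PortMatch j₀ j p' p then 1 else 0
    with hM
  set D := d ^ (Fintype.card J + 1) with hD
  have h1 : ∑ p : Q × (J → Q), ∑ p' : Q × (J → Q), ((if p' = p then (1 : ℝ) else 0) -
        d / N * ∑ j, M j p' p) ^ 2 =
      ∑ p : Q × (J → Q), (1 : ℝ) - 2 * (d / N) * ∑ j, ∑ p, M j p p +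
        (d / N) ^ 2 * ∑ j, ∑ j', ∑ p, ∑ p', M j p' p * M j' p' p := by
    have h2 : ∀ p p' : Q × (J → Q), ((if p' = p then (1 : ℝ) else 0) - d / N * ∑ j, M j p' p) ^ 2 =
        (if p' = p then (1 - 2 * (d / N) * ∑ j, M j p p) else 0) +
          (d / N) ^ 2 * ∑ j, ∑ j', M j p' p * M j' p' p := fun p p' => by
      rw [← Finset.sum_mul_sum]
      split_ifs with h
      · subst h; ring
      · ring
    simp only [h2, Finset.sum_add_distrib, Finset.sum_ite_eq', Finset.mem_univ, if_true,
      Finset.sum_sub_distrib, ← Finset.mul_sum]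
    congr 2
    · rw [Finset.sum_comm]
    · rw [Finset.sum_congr rfl fun p _ => Finset.sum_comm, Finset.sum_comm]
      refine Finset.sum_congr rfl fun j _ => ?_
      rw [Finset.sum_congr rfl fun p _ => Finset.sum_comm, Finset.sum_comm]
      simp only [Finset.mul_sum]
      exact (Finset.sum_congr rfl fun _ _ => Finset.sum_comm).trans Finset.sum_comm
  have h3 : ∀ j j', d ^ 2 * ∑ p, ∑ p', M j p' p * M j' p' p ≤ D + if j' =
      j then d ^ 2 * D else 0 := by
    intro j j'
    split_ifs with hj
    · subst hj
      simp only [hM, ← ite_and, mul_ite, mul_one, mul_zero, and_self]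
      rw [sum_portMatch]
      have : 0 ≤ D := by positivity
      linarith
    · rw [card_sq_mul_sum_portMatch_mul j₀ hj, add_zero]
  have h4 : d ^ 2 * ∑ j, ∑ j', ∑ p, ∑ p', M j p' p * M j' p' p ≤ N * (N * D + d ^ 2 * D) := by
    rw [Finset.mul_sum]
    simp only [Finset.mul_sum _ _ (d ^ 2)]
    refine (Finset.sum_le_sum fun j _ => Finset.sum_le_sum fun j' _ => ?_).trans (b :=
      ∑ j : J, ∑ j' : J, (D + if j' = j then d ^ 2 * D else 0)) ?_
    · simpa only [Finset.mul_sum] using h3 j j'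
    · simp only [Finset.sum_add_distrib, Finset.sum_ite_eq', Finset.mem_univ, if_true,
        Finset.sum_const, Finset.card_univ, nsmul_eq_mul, ← hN]
      exact le_of_eq (by ring)
  rw [h1]
  have h5 : ∀ j, ∑ p, M j p p = d ^ Fintype.card J := sum_portMatch_self j₀
  have h6 : ∑ p : Q × (J → Q), (1 : ℝ) = D := by
    simp [hD, hd, pow_succ, mul_comm]
  have h7 : (d / N) ^ 2 * ∑ j, ∑ j', ∑ p, ∑ p', M j p' p * M j' p' p ≤ D + D * (d ^ 2 / N) := by
    rw [div_pow, div_mul_eq_mul_div, div_le_iff₀ (by positivity)]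
    refine h4.trans (le_of_eq ?_)
    field_simp
  have h8 : 2 * (d / N) * ∑ j, ∑ p, M j p p = 2 * D := by
    simp only [h5, Finset.sum_const, Finset.card_univ, nsmul_eq_mul, ← hN, hD, pow_succ]
    field_simp
  rw [h6, h8]
  linarith

/-- The operator that port-based teleportation ideally applies to the registers
`(Q × J) × ((J → Q) × J)`. From blank port registers it produces the superposition, over all ports
`j`, of the projections onto the maximally entangled state of `Q` and the `j`-th port, with `j`
written into both port registers. It is scaled by `card Q / √(card J)`, so that the projections have
entries `1 / √(card J)` and `T† T` has mean eigenvalue `1` on the blank port registers; it is only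
approximately an isometry there, and vanishes on the other port registers. -/
def portMatrix : Matrix ((Q × J) × ((J → Q) × J)) ((Q × J) × ((J → Q) × J)) ℂ :=
  of fun r q => if (r.1.2 = r.2.2 ∧ r.1.1 = r.2.1 r.1.2) ∧ (q.1.2 = j₀ ∧ q.2.2 = j₀) ∧
    q.1.1 = q.2.1 r.1.2 ∧ (portEquiv j₀ Q r.1.2 r.2.1).2 = (portEquiv j₀ Q r.1.2 q.2.1).2 then
      (((√(Fintype.card J : ℝ))⁻¹ : ℝ) : ℂ) else 0

theorem conjTranspose_portMatrix_mul_self_apply (q q' : (Q × J) × ((J → Q) × J)) :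
    ((portMatrix (Q := Q) j₀)ᴴ * portMatrix (Q := Q) j₀) q' q =
      if (q'.1.2 = j₀ ∧ q'.2.2 = j₀) ∧ (q.1.2 = j₀ ∧ q.2.2 = j₀) then
        ((Fintype.card Q / Fintype.card J * ∑ j, if PortMatch j₀ j (q'.1.1, q'.2.1) (q.1.1, q.2.1)
          then (1 : ℝ) else 0 : ℝ) : ℂ) else 0 := by
  have h1 : ∀ r : (Q × J) × ((J → Q) × J), (star (portMatrix j₀ r q') * portMatrix j₀ r q : ℂ) =
      ((if r.1.2 = r.2.2 then if r.1.1 = r.2.1 r.1.2 then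
        if (q'.1.2 = j₀ ∧ q'.2.2 = j₀) ∧ (q.1.2 = j₀ ∧ q.2.2 = j₀) then
        if PortMatch j₀ r.1.2 (q'.1.1, q'.2.1) (q.1.1, q.2.1) then
        if (portEquiv j₀ Q r.1.2 r.2.1).2 = (portEquiv j₀ Q r.1.2 q.2.1).2 then
        (Fintype.card J : ℝ)⁻¹ else 0 else 0 else 0 else 0 else 0 : ℝ) : ℂ) := fun r => by
    have hc : (((√(Fintype.card J : ℝ))⁻¹ : ℝ) : ℂ) * (((√(Fintype.card J : ℝ))⁻¹ : ℝ) : ℂ) =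
        (((Fintype.card J : ℝ)⁻¹ : ℝ) : ℂ) := by
      rw [← Complex.ofReal_mul, ← mul_inv, Real.mul_self_sqrt (Nat.cast_nonneg _)]
    simp only [portMatrix, of_apply, apply_ite star, star_zero, Complex.star_def,
      Complex.conj_ofReal,
      ite_zero_mul_ite_zero, hc, ← ite_and, apply_ite Complex.ofReal, Complex.ofReal_zero]
    refine if_congr ⟨?_, ?_⟩ rfl rfl
    · rintro ⟨⟨⟨h1, h2⟩, h3, h4, h5⟩, -, h6, h7, h8⟩
      exact ⟨h1, h2, ⟨h3, h6⟩, ⟨h4, h7, h5.symm.trans h8⟩, h8⟩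
    · rintro ⟨h1, h2, ⟨h3, h6⟩, ⟨h4, h7, h5⟩, h8⟩
      exact ⟨⟨⟨h1, h2⟩, h3, h4, h8.trans h5.symm⟩, ⟨h1, h2⟩, h6, h7, h8⟩
  simp only [mul_apply, conjTranspose_apply, h1, ← Complex.ofReal_sum, Fintype.sum_prod_type]
  rw [← Complex.ofReal_zero, ← apply_ite Complex.ofReal]
  congr 1
  split_ifs with h
  · have h2 : ∀ j (t : J → Q), ∑ b : Q, ∑ j' : J, (if j = j' then if b = t j then
        if PortMatch j₀ j (q'.1.1, q'.2.1) (q.1.1, q.2.1) then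
        if (portEquiv j₀ Q j t).2 = (portEquiv j₀ Q j q.2.1).2 then
        (Fintype.card J : ℝ)⁻¹ else 0 else 0 else 0 else 0) =
        (Fintype.card J : ℝ)⁻¹ * (if PortMatch j₀ j (q'.1.1, q'.2.1) (q.1.1, q.2.1) then 1 else 0) *
          (if (portEquiv j₀ Q j t).2 = (portEquiv j₀ Q j q.2.1).2 then 1 else 0) := fun j t => by
      simp only [Finset.sum_ite_eq, Finset.sum_ite_eq', Finset.mem_univ, if_true]
      split_ifs <;> simp
    rw [Finset.sum_comm, Finset.mul_sum]
    refine Finset.sum_congr rfl fun j _ => ?_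
    rw [Finset.sum_comm, Fintype.sum_congr _ _ (h2 j), ← Finset.mul_sum, sum_ite_portEquiv_snd]
    ring
  · simp

end PortMatrix

/-! ### The port operator reproduces the protocol -/

/-- An operator that differs from `K'` by a normalised state of discarded systems performs the same
channel. -/
theorem traceOut_comp_conjMap_eq_of_mul {A₀ A₁ Z₀ Z₁ Z₀' Z₁' R₀ R₁ n : Type} [Fintype Z₀]
    [Fintype Z₁] [Fintype Z₀'] [Fintype Z₁'] [Fintype R₀] [Fintype R₁] [Fintype n]
    (ζ₀ : Z₀' ≃ Z₀ × R₀) (ζ₁ : Z₁' ≃ Z₁ × R₁) (K : Matrix ((A₀ × Z₀') × (A₁ × Z₁')) n ℂ)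
    (K' : Matrix ((A₀ × Z₀) × (A₁ × Z₁)) n ℂ) (w : R₀ → R₁ → ℂ)
    (hw : ∑ r₀, ∑ r₁, w r₀ r₁ * star (w r₀ r₁) = 1)
    (hK : ∀ a₀ z₀ a₁ z₁ i, K ((a₀, z₀), (a₁, z₁)) i =
      K' ((a₀, (ζ₀ z₀).1), (a₁, (ζ₁ z₁).1)) i * w (ζ₀ z₀).2 (ζ₁ z₁).2) :
    traceOut ∘ₗ conjMap K = traceOut ∘ₗ conjMap K' := by
  refine LinearMap.ext fun ρ => Matrix.ext fun i j => ?_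
  have h1 : ∀ z₀ z₁, conjMap K ρ ((i.1, z₀), (i.2, z₁)) ((j.1, z₀), (j.2, z₁)) =
      conjMap K' ρ ((i.1, (ζ₀ z₀).1), (i.2, (ζ₁ z₁).1)) ((j.1, (ζ₀ z₀).1), (j.2, (ζ₁ z₁).1)) *
        (w (ζ₀ z₀).2 (ζ₁ z₁).2 * star (w (ζ₀ z₀).2 (ζ₁ z₁).2)) := by
    intro z₀ z₁
    simp only [conjMap, LinearMap.coe_mk, AddHom.coe_mk, mul_apply, conjTranspose_apply, hK,
      Finset.sum_mul, star_mul]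
    exact Finset.sum_congr rfl fun _ _ => Finset.sum_congr rfl fun _ _ => by ring
  simp only [LinearMap.comp_apply, traceOut, LinearMap.coe_mk, AddHom.coe_mk, of_apply, h1]
  rw [ζ₀.sum_comp (fun p => ∑ z₁, conjMap K' ρ ((i.1, p.1), (i.2, (ζ₁ z₁).1))
    ((j.1, p.1), (j.2, (ζ₁ z₁).1)) * (w p.2 (ζ₁ z₁).2 * star (w p.2 (ζ₁ z₁).2)))]
  have h2 := fun p : Z₀ × R₀ => ζ₁.sum_comp (fun p' => conjMap K' ρ ((i.1, p.1), (i.2, p'.1))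
    ((j.1, p.1), (j.2, p'.1)) * (w p.2 p'.2 * star (w p.2 p'.2)))
  rw [Fintype.sum_congr _ _ h2, Fintype.sum_prod_type]
  refine Finset.sum_congr rfl fun z₀ _ => ?_
  simp only [Fintype.sum_prod_type]
  rw [Finset.sum_comm]
  refine Finset.sum_congr rfl fun z₁ _ => ?_
  simp only [← Finset.mul_sum, hw, mul_one]

section Ports

variable {J : Type} [Fintype J] [DecidableEq J] (j₀ : J)
variable {d₀ d₁ : ℕ} {ι : Type} {E : ℕ} (P : NonlocalProtocol d₀ d₁ ι E) {a b : ℕ}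
  (eL : Qubits (Fin a) ≃ Qubits (Fin E) × J) (eR : Qubits (Fin b) ≃ (J → Qubits (Fin E)) × J)

theorem sum_eq_sum_of_ite {C B T R S M : Type} [Fintype C] [Fintype B] [Fintype T] [Fintype R]
    [Fintype S] [DecidableEq R] [DecidableEq S] [AddCommMonoid M]
    (e : C ≃ (B × R) × (T × S)) {F : C → M} (ρ : R) (σ : S) (g : B × T → M)
    (h : ∀ c, F c = if (e c).2.2 = σ then if (e c).1.2 = ρ then g ((e c).1.1, (e c).2.1) else 0
      else 0) :
    ∑ c, F c = ∑ p, g p := by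
  rw [← e.symm.sum_comp, Fintype.sum_prod_type, Fintype.sum_prod_type, Fintype.sum_prod_type]
  simp only [h, Equiv.apply_symm_apply]
  refine Finset.sum_congr rfl fun b _ => ?_
  rw [Fintype.sum_congr _ _ fun r => Fintype.sum_prod_type _, Finset.sum_comm]
  simp only [Finset.sum_ite_eq', Finset.mem_univ, if_true]

/-- The contents of all registers that enter the interaction. -/
def registersEquiv : Qubits (Fin a ⊕ Fin b) ≃
    (Qubits (Fin E) × J) × ((J → Qubits (Fin E)) × J) :=
  (Equiv.sumArrowEquivProdArrow (Fin a) (Fin b) (Fin 2)).trans (eL.prodCongr eR)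

/-- The port matrix as an operator on qubits. -/
def portOperator : Matrix (Qubits (Fin a ⊕ Fin b)) (Qubits (Fin a ⊕ Fin b)) ℂ :=
  (portMatrix j₀).submatrix (registersEquiv eL eR) (registersEquiv eL eR)

omit [Fintype J] [DecidableEq J] in
theorem registersEquiv_blankBasis (p : Qubits (Fin E) × (J → Qubits (Fin E))) :
    registersEquiv eL eR (blankBasis j₀ eL eR p) = ((p.1, j₀), (p.2, j₀)) :=
  Prod.ext (eL.apply_symm_apply _) (eR.apply_symm_apply _)

/-- The port operator is nearly isometric on the blank basis states, on average. -/
theorem sum_norm_sq_portOperator_le :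
    ∑ p, ∑ r, ‖(1 - (portOperator j₀ eL eR)ᴴ * portOperator j₀ eL eR) r
        (blankBasis j₀ eL eR p)‖ ^ 2 ≤
      (2 ^ E : ℝ) ^ (Fintype.card J + 1) * ((2 ^ E : ℝ) ^ 2 / Fintype.card J) := by
  have h1 := sum_sq_sub_portMatch_le (Q := Qubits (Fin E)) j₀
  have hc : (Fintype.card (Qubits (Fin E)) : ℝ) = 2 ^ E := by simp
  rw [hc] at h1
  refine le_trans (le_of_eq (Finset.sum_congr rfl fun p _ => ?_)) h1
  refine sum_eq_sum_of_ite (registersEquiv eL eR) j₀ j₀ (fun p' =>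
      ((if p' = p then (1 : ℝ) else 0) -
    2 ^ E / Fintype.card J * ∑ j, if PortMatch j₀ j p' p then (1 : ℝ) else 0) ^ 2) fun r => ?_
  have h3 : (1 - (portOperator j₀ eL eR)ᴴ * portOperator j₀ eL eR) =
      (1 - (portMatrix (Q := Qubits (Fin E)) j₀)ᴴ * portMatrix (Q := Qubits (Fin E)) j₀).submatrix
        (registersEquiv eL eR)
        (registersEquiv eL eR) := by
    rw [submatrix_sub, Pi.sub_apply, Pi.sub_apply, submatrix_one_equiv, portOperator,
      conjTranspose_submatrix, submatrix_mul_equiv]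
  rw [h3, submatrix_apply, registersEquiv_blankBasis, Matrix.sub_apply,
    conjTranspose_portMatrix_mul_self_apply, hc, one_apply]
  generalize registersEquiv eL eR r = s
  obtain ⟨⟨b', j₁⟩, ⟨t', j₂⟩⟩ := s
  by_cases h1 : j₁ = j₀
  · by_cases h2 : j₂ = j₀
    · simp only [h1, h2, if_true, and_self, and_true, Prod.ext_iff]
      rw [← Complex.ofReal_one, ← Complex.ofReal_zero, ← apply_ite Complex.ofReal,
        ← Complex.ofReal_sub, Complex.norm_real, Real.norm_eq_abs, sq_abs]
    · simp [h2]
  · simp [h1]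

/-- The state that the discarded systems are left in. -/
def portResidue (x : ι) (r₀ : ({l // l ≠ j₀} → Fin P.y₀) × (Qubits (Fin E) × J))
    (r₁ : ({l // l ≠ j₀} → Fin P.y₁) × ((J → Qubits (Fin E)) × J)) : ℂ :=
  if r₀.2.2 = r₁.2.2 ∧ r₀.2.1 = r₁.2.1 r₀.2.2 then
    (((√(Fintype.card J : ℝ))⁻¹ : ℝ) : ℂ) * eprAmplitude E *
      ∏ l, eprAmplitude E * P.VR x (r₀.1 l, r₁.1 l) ((portEquiv j₀ _ r₀.2.2 r₁.2.1).2 l)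
  else 0

/-- The state of the discarded systems is normalised. -/
theorem sum_portResidue_mul_star (x : ι) :
    ∑ r₀, ∑ r₁, portResidue j₀ P x r₀ r₁ * star (portResidue j₀ P x r₀ r₁) = 1 := by
  have : Nonempty J := ⟨j₀⟩
  have h1 : ∀ r₀ r₁, portResidue j₀ P x r₀ r₁ * star (portResidue j₀ P x r₀ r₁) =
      if r₀.2.2 = r₁.2.2 then if r₀.2.1 = r₁.2.1 r₀.2.2 then
        ((Fintype.card J : ℂ)⁻¹ * (2 ^ E : ℂ)⁻¹) *
          (star (∏ l, eprAmplitude E * P.VR x (r₀.1 l, r₁.1 l)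
            ((portEquiv j₀ _ r₀.2.2 r₁.2.1).2 l)) *
          ∏ l, eprAmplitude E * P.VR x (r₀.1 l, r₁.1 l) ((portEquiv j₀ _ r₀.2.2 r₁.2.1).2 l))
        else 0 else 0 := fun r₀ r₁ => by
    have hc : (((√(Fintype.card J : ℝ))⁻¹ : ℝ) : ℂ) * (((√(Fintype.card J : ℝ))⁻¹ : ℝ) : ℂ) =
        (Fintype.card J : ℂ)⁻¹ := by
      rw [← Complex.ofReal_mul, ← mul_inv, Real.mul_self_sqrt (Nat.cast_nonneg _)]
      push_cast
      rfl
    rw [portResidue, ← ite_and]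
    split_ifs
    · rw [star_mul', star_mul', star_eprAmplitude, ← hc, ← eprAmplitude_mul_self, Complex.star_def,
        Complex.conj_ofReal]
      ring
    · simp
  have h2 := fun t t' => (P.isometry_VR x).sum_prod_epr (L := {l // l ≠ j₀}) E t t'
  have h3 : ∀ j : J, ∑ t : J → Qubits (Fin E), ∑ y₀ : {l // l ≠ j₀} → Fin P.y₀,
      ∑ y₁ : {l // l ≠ j₀} → Fin P.y₁, ((Fintype.card J : ℂ)⁻¹ * (2 ^ E : ℂ)⁻¹) *
          (star (∏ l, eprAmplitude E * P.VR x (y₀ l, y₁ l) ((portEquiv j₀ _ j t).2 l)) *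
          ∏ l, eprAmplitude E * P.VR x (y₀ l, y₁ l) ((portEquiv j₀ _ j t).2 l)) =
      (Fintype.card J : ℂ)⁻¹ := fun j => by
    simp only [← Finset.mul_sum, h2, if_true]
    rw [Finset.sum_const, Finset.card_univ, Fintype.card_congr (portEquiv j₀ (Qubits (Fin E)) j)]
    simp
  simp only [h1, Fintype.sum_prod_type]
  have h4 : ∀ (y₀ : {l // l ≠ j₀} → Fin P.y₀) (j : J), (∑ b : Qubits (Fin E),
      ∑ y₁ : {l // l ≠ j₀} → Fin P.y₁, ∑ t : J → Qubits (Fin E), ∑ j₂ : J,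
      if j = j₂ then if b = t j then ((Fintype.card J : ℂ)⁻¹ * (2 ^ E : ℂ)⁻¹) *
          (star (∏ l, eprAmplitude E * P.VR x (y₀ l, y₁ l) ((portEquiv j₀ _ j t).2 l)) *
          ∏ l, eprAmplitude E * P.VR x (y₀ l, y₁ l) ((portEquiv j₀ _ j t).2 l)) else 0 else 0) =
      ∑ t : J → Qubits (Fin E), ∑ y₁ : {l // l ≠ j₀} → Fin P.y₁,
        ((Fintype.card J : ℂ)⁻¹ * (2 ^ E : ℂ)⁻¹) *
          (star (∏ l, eprAmplitude E * P.VR x (y₀ l, y₁ l) ((portEquiv j₀ _ j t).2 l)) *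
          ∏ l, eprAmplitude E * P.VR x (y₀ l, y₁ l) ((portEquiv j₀ _ j t).2 l)) := by
    intro y₀ j
    rw [Finset.sum_comm, Finset.sum_comm (s := (Finset.univ : Finset (J → Qubits (Fin E))))]
    refine Finset.sum_congr rfl fun y₁ _ => ?_
    rw [Finset.sum_comm]
    simp only [Finset.sum_ite_eq, Finset.sum_ite_eq', Finset.mem_univ, if_true]
  rw [Fintype.sum_congr _ _ fun y₀ => Finset.sum_comm]
  simp only [h4]
  rw [Finset.sum_comm, Fintype.sum_congr _ _ fun j => Finset.sum_comm]
  simp only [h3]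
  simp

/-- The state of the protocol after its exchange is the contraction of the two first operations along
the EPR pairs. -/
theorem NonlocalProtocol.exchanged_apply (x : ι) (u₀ : Fin P.x₀ × Fin P.y₀)
    (u₁ : Fin P.x₁ × Fin P.y₁) (i : Fin d₀ × Fin d₁) :
    P.exchanged x (u₀, u₁) i = ∑ b, eprAmplitude E * P.VL (u₀.1, u₁.1) (i, b) *
      P.VR x (u₀.2, u₁.2) b := by
  simp only [NonlocalProtocol.exchanged, NonlocalProtocol.firstRound, submatrix_apply, mul_apply,
    attachEPR, Fintype.sum_prod_type, kroneckerMap_apply, id, mul_ite, mul_zero, ite_and]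
  have h1 : ∀ x₁ y₁, (∑ x₂, ∑ x₃, if (x₁, y₁) = i then
      if x₂ = x₃ then P.VL (u₀.1, u₁.1) ((x₁, y₁), x₂) * P.VR x (u₀.2, u₁.2) x₃ *
        (((√2 : ℝ) ^ E)⁻¹ : ℝ) else 0 else 0 : ℂ) = if (x₁, y₁) = i then
        ∑ b, eprAmplitude E * P.VL (u₀.1, u₁.1) ((x₁, y₁), b) * P.VR x (u₀.2, u₁.2) b else 0 := by
    intro x₁ y₁
    split_ifs
    · refine Finset.sum_congr rfl fun b _ => ?_
      rw [Finset.sum_ite_eq, if_pos (Finset.mem_univ _), eprAmplitude]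
      ring
    · simp
  simp only [h1]
  rw [← Fintype.sum_prod_type' (f := fun x₁ y₁ => if (x₁, y₁) = i then
        ∑ b, eprAmplitude E * P.VL (u₀.1, u₁.1) ((x₁, y₁), b) * P.VR x (u₀.2, u₁.2) b else 0)]
  simp

/-- The port matrix on a product state with blank port registers: for each port `j`, the register and
the `j`-th port are contracted with each other, the other ports are left alone. -/
theorem sum_portMatrix_mul (r : (Qubits (Fin E) × J) × ((J → Qubits (Fin E)) × J))
    (f : Qubits (Fin E) → ℂ) (g : J → Qubits (Fin E) → ℂ) :
    ∑ q, portMatrix j₀ r q * ((if q.1.2 = j₀ then f q.1.1 else 0) *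
      (if q.2.2 = j₀ then ∏ l, g l (q.2.1 l) else 0)) =
    if r.1.2 = r.2.2 ∧ r.1.1 = r.2.1 r.1.2 then (((√(Fintype.card J : ℝ))⁻¹ : ℝ) : ℂ) *
      (∑ b, f b * g r.1.2 b) * ∏ l : {l // l ≠ j₀}, g (Equiv.swap j₀ r.1.2 l)
        ((portEquiv j₀ _ r.1.2 r.2.1).2 l) else 0 := by
  obtain ⟨⟨b', j⟩, ⟨t', j₂⟩⟩ := r
  have h1 := sum_eq_sum_of_ite (Equiv.refl _) (F := fun q :
      (Qubits (Fin E) × J) × ((J → Qubits (Fin E)) × J) =>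
      portMatrix j₀ ((b', j), (t', j₂)) q * ((if q.1.2 = j₀ then f q.1.1 else 0) *
      (if q.2.2 = j₀ then ∏ l, g l (q.2.1 l) else 0))) j₀ j₀ (fun p :
        Qubits (Fin E) × (J → Qubits (Fin E)) =>
        if j = j₂ ∧ b' = t' j then if p.1 = p.2 j then
        if (portEquiv j₀ _ j t').2 = (portEquiv j₀ _ j p.2).2 then (((√(Fintype.card J : ℝ))⁻¹ :
          ℝ) : ℂ) *
        (f p.1 * ∏ l, g l (p.2 l)) else 0 else 0 else 0) fun q => by
    simp only [portMatrix, of_apply, Equiv.refl_apply]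
    by_cases h1 : q.2.2 = j₀
    · by_cases h2 : q.1.2 = j₀
      · simp only [h1, h2, if_true, ite_mul, zero_mul, true_and, and_self]
        by_cases hA : j = j₂ ∧ b' = t' j
        · by_cases hB : q.1.1 = q.2.1 j
          · simp only [hA, hB, true_and, and_self, if_true]
          · simp [hB]
        · simp [hA]
      · simp [h2]
    · simp [h1]
  refine h1.trans ?_
  rw [Fintype.sum_prod_type]
  split_ifs with h
  · rw [mul_assoc, Finset.sum_mul, Finset.mul_sum]
    refine Finset.sum_congr rfl fun b _ => ?_
    rw [← (portEquiv j₀ _ j).symm.sum_comp]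
    have h2 : ∀ p, (portEquiv j₀ (Qubits (Fin E)) j).symm p j = p.1 := fun p =>
      congrArg Prod.fst ((portEquiv_apply j₀ j _).symm.trans (Equiv.apply_symm_apply _ p))
    have h3 : ∀ p (l : {l // l ≠ j₀}),
        (portEquiv j₀ (Qubits (Fin E)) j).symm p (Equiv.swap j₀ j l) = p.2 l :=
      fun p l => congrFun (congrArg Prod.snd
        ((portEquiv_apply j₀ j _).symm.trans (Equiv.apply_symm_apply _ p))) l
    simp only [prod_eq_mul_prod_ports j₀ j, h2, h3, Equiv.apply_symm_apply]
    rw [Fintype.sum_prod_type, Finset.sum_comm]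
    simp only [Finset.sum_ite_eq, Finset.mem_univ, if_true]
    ring
  · simp

theorem ite_mul_eq_exchanged_mul_portResidue (x : ι) (x₀ : Fin P.x₀) (x₁ : Fin P.x₁)
    (y₀ : J → Fin P.y₀) (y₁ : J → Fin P.y₁) (j₁ j₂ : J) (b' : Qubits (Fin E))
    (t' : J → Qubits (Fin E)) (i : Fin d₀ × Fin d₁) :
    (if j₁ = j₂ ∧ b' = t' j₁ then (((√(Fintype.card J : ℝ))⁻¹ : ℝ) : ℂ) *
      (∑ b, eprAmplitude E * P.VL (x₀, x₁) (i, b) * (eprAmplitude E * P.VR x (y₀ j₁, y₁ j₁) b)) *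
        ∏ l : {l // l ≠ j₀}, eprAmplitude E * P.VR x (y₀ (Equiv.swap j₀ j₁ l),
          y₁ (Equiv.swap j₀ j₁ l))
          ((portEquiv j₀ _ j₁ t').2 l) else 0) =
    P.exchanged x ((x₀, (portEquiv j₀ _ j₁ y₀).1), (x₁, (portEquiv j₀ _ j₂ y₁).1)) i *
      portResidue j₀ P x ((portEquiv j₀ _ j₁ y₀).2, (b', j₁))
        ((portEquiv j₀ _ j₂ y₁).2, (t', j₂)) := by
  rw [portResidue, NonlocalProtocol.exchanged_apply]
  split_ifs with h
  · obtain ⟨rfl, -⟩ := h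
    simp only [portEquiv_apply j₀ j₁ y₀, portEquiv_apply j₀ j₁ y₁]
    have h1 : ∑ b, eprAmplitude E * P.VL (x₀, x₁) (i, b) *
        (eprAmplitude E * P.VR x (y₀ j₁, y₁ j₁) b) =
        eprAmplitude E * ∑ b, eprAmplitude E * P.VL (x₀, x₁) (i, b) * P.VR x (y₀ j₁, y₁ j₁) b := by
      rw [Finset.mul_sum]
      exact Finset.sum_congr rfl fun b _ => by ring
    rw [h1]
    ring
  · simp

/-- After the port operator, the systems at the selected ports are in the state of the protocol after
its exchange, and all remaining systems are in a fixed state, whatever the input. -/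
theorem exchanged_portOperator (x : ι) (s) (i : Fin d₀ × Fin d₁) :
    (((portOperator j₀ eL eR ⊗ₖ (1 :
      Matrix ((Fin (portProcessing j₀ P eL eR).x₀ × Fin (portProcessing j₀ P eL eR).x₁) ×
        (Fin (portProcessing j₀ P eL eR).y₀ × Fin (portProcessing j₀ P eL eR).y₁))
          ((Fin (portProcessing j₀ P eL eR).x₀ × Fin (portProcessing j₀ P eL eR).x₁) ×
            (Fin (portProcessing j₀ P eL eR).y₀ × Fin (portProcessing j₀ P eL eR).y₁)) ℂ)) *
      (portProcessing j₀ P eL eR).prepared x).submatrix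
        (portProcessing j₀ P eL eR).regroupEquiv id) s i =
    P.exchanged x ((selectEquiv j₀ (Fintype.equivFin (J → Fin P.y₀)).symm eL s.1).1,
      (selectEquiv j₀ (Fintype.equivFin (J → Fin P.y₁)).symm eR s.2).1) i *
    portResidue j₀ P x (selectEquiv j₀ (Fintype.equivFin (J → Fin P.y₀)).symm eL s.1).2
      (selectEquiv j₀ (Fintype.equivFin (J → Fin P.y₁)).symm eR s.2).2 := by
  obtain ⟨⟨⟨x₀, y₀⟩, cL⟩, ⟨⟨x₁, y₁⟩, cR⟩⟩ := s
  rw [submatrix_apply, mul_apply, Fintype.sum_prod_type]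
  let F : (Qubits (Fin E) × J) × ((J → Qubits (Fin E)) × J) → ℂ :=
      (fun q => portMatrix j₀ (eL cL, eR cR) q *
        ((if q.1.2 = j₀ then eprAmplitude E * P.VL (x₀, x₁) (i, q.1.1) else 0) *
        (if q.2.2 = j₀ then ∏ l, (fun l b => eprAmplitude E *
          P.VR x ((Fintype.equivFin (J → Fin P.y₀)).symm y₀ l,
            (Fintype.equivFin (J → Fin P.y₁)).symm y₁ l) b) l (q.2.1 l) else 0)))
  have h1 : ∀ q, ∑ y,
      (portOperator j₀ eL eR ⊗ₖ (1 :
        Matrix ((Fin (portProcessing j₀ P eL eR).x₀ × Fin (portProcessing j₀ P eL eR).x₁) ×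
          (Fin (portProcessing j₀ P eL eR).y₀ × Fin (portProcessing j₀ P eL eR).y₁))
            ((Fin (portProcessing j₀ P eL eR).x₀ × Fin (portProcessing j₀ P eL eR).x₁) ×
              (Fin (portProcessing j₀ P eL eR).y₀ × Fin (portProcessing j₀ P eL eR).y₁)) ℂ))
      ((portProcessing j₀ P eL eR).regroupEquiv (((x₀, y₀), cL), ((x₁, y₁), cR))) (q, y) *
        (portProcessing j₀ P eL eR).prepared x (q, y) i =
      F (registersEquiv eL eR q) := fun q => by
    refine (Fintype.sum_eq_single ((x₀, x₁), (y₀, y₁)) fun y hy => ?_).trans ?_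
    · refine mul_eq_zero_of_left (mul_eq_zero_of_right _ (one_apply_ne hy.symm)) _
    · refine congrArg₂ (· * ·) ((congrArg₂ (· * ·) rfl (one_apply_eq _)).trans (mul_one _)) rfl
  refine ((Fintype.sum_congr _ _ h1).trans (Equiv.sum_comp (registersEquiv eL eR) F)).trans ?_
  refine (sum_portMatrix_mul j₀ (eL cL, eR cR) (fun b => eprAmplitude E * P.VL (x₀, x₁) (i, b))
    (fun l b => eprAmplitude E * P.VR x ((Fintype.equivFin (J → Fin P.y₀)).symm y₀ l,
            (Fintype.equivFin (J → Fin P.y₁)).symm y₁ l) b)).trans ?_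
  exact ite_mul_eq_exchanged_mul_portResidue j₀ P x x₀ x₁ _ _ (eL cL).2 (eR cR).2 (eL cL).1
    (eR cR).1 i

theorem portControlled_apply_selectEquiv_symm {A X Y Y' Z Z' B C : Type} [DecidableEq Y]
    [DecidableEq B]
    (ε : Y' ≃ (J → Y)) (e : C ≃ B × J) (ζ : Z' ≃ Z × (({l // l ≠ j₀} → Y) × (B × J)))
    (W : Matrix (A × Z) (X × Y) ℂ) (a : A) (z : Z') (r) :
    portControlled j₀ ε e ζ W (a, z) ((selectEquiv j₀ ε e).symm r) =
      if r.2 = (ζ z).2 then W (a, (ζ z).1) r.1 else 0 := by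
  have h : portControlled j₀ ε e ζ W (a, z) ((selectEquiv j₀ ε e).symm r) =
      W (a, (ζ z).1) (selectEquiv j₀ ε e ((selectEquiv j₀ ε e).symm r)).1 *
        (1 : Matrix (({l // l ≠ j₀} → Y) × (B × J)) _ ℂ) (ζ z).2
          (selectEquiv j₀ ε e ((selectEquiv j₀ ε e).symm r)).2 := rfl
  rw [h, Equiv.apply_symm_apply, one_apply, mul_ite, mul_one, mul_zero]
  exact if_congr eq_comm rfl rfl

/-- The controlled operators act on the selected ports and leave everything else to the discarded
systems. -/
theorem portControlled_kronecker_mul_apply {A₀ A₁ X₀ X₁ Y₀ Y₁ Y₀' Y₁' Z₀ Z₁ Z₀' Z₁' B₀ B₁ C₀ C₁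
    n : Type}
    [Fintype X₀] [Fintype X₁] [Fintype Y₀] [Fintype Y₁] [Fintype Y₀'] [Fintype Y₁'] [Fintype B₀]
    [Fintype B₁] [Fintype C₀] [Fintype C₁] [DecidableEq Y₀] [DecidableEq Y₁] [DecidableEq B₀]
    [DecidableEq B₁] (ε₀ : Y₀' ≃ (J → Y₀)) (e₀ : C₀ ≃ B₀ × J)
    (ζ₀ : Z₀' ≃ Z₀ × (({l // l ≠ j₀} → Y₀) × (B₀ × J))) (ε₁ : Y₁' ≃ (J → Y₁)) (e₁ : C₁ ≃ B₁ × J)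
    (ζ₁ : Z₁' ≃ Z₁ × (({l // l ≠ j₀} → Y₁) × (B₁ × J)))
    (W₀ : Matrix (A₀ × Z₀) (X₀ × Y₀) ℂ) (W₁ : Matrix (A₁ × Z₁) (X₁ × Y₁) ℂ)
    (M : Matrix (((X₀ × Y₀') × C₀) × ((X₁ × Y₁') × C₁)) n ℂ)
    (N : Matrix ((X₀ × Y₀) × (X₁ × Y₁)) n ℂ)
    (w : ({l // l ≠ j₀} → Y₀) × (B₀ × J) → ({l // l ≠ j₀} → Y₁) × (B₁ × J) → ℂ)
    (hM : ∀ s i, M s i = N ((selectEquiv j₀ ε₀ e₀ s.1).1, (selectEquiv j₀ ε₁ e₁ s.2).1) i *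
      w (selectEquiv j₀ ε₀ e₀ s.1).2 (selectEquiv j₀ ε₁ e₁ s.2).2) (a₀ : A₀) (z₀ : Z₀') (a₁ : A₁)
    (z₁ : Z₁') (i : n) :
    ((portControlled j₀ ε₀ e₀ ζ₀ W₀ ⊗ₖ portControlled j₀ ε₁ e₁ ζ₁ W₁) * M) ((a₀, z₀), (a₁, z₁)) i =
      ((W₀ ⊗ₖ W₁) * N) ((a₀, (ζ₀ z₀).1), (a₁, (ζ₁ z₁).1)) i * w (ζ₀ z₀).2 (ζ₁ z₁).2 := by
  rw [mul_apply, mul_apply,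
    ← ((selectEquiv j₀ ε₀ e₀).prodCongr (selectEquiv j₀ ε₁ e₁)).symm.sum_comp,
    Finset.sum_mul]
  refine sum_eq_sum_of_ite (Equiv.refl _) (ζ₀ z₀).2 (ζ₁ z₁).2 (fun u : (X₀ × Y₀) × (X₁ × Y₁) =>
    (W₀ ⊗ₖ W₁) ((a₀, (ζ₀ z₀).1), (a₁, (ζ₁ z₁).1)) u * N u i * w (ζ₀ z₀).2 (ζ₁ z₁).2) fun r => ?_
  obtain ⟨r₀, r₁⟩ := r
  change portControlled j₀ ε₀ e₀ ζ₀ W₀ (a₀, z₀) ((selectEquiv j₀ ε₀ e₀).symm r₀) *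
    portControlled j₀ ε₁ e₁ ζ₁ W₁ (a₁, z₁) ((selectEquiv j₀ ε₁ e₁).symm r₁) *
    M ((selectEquiv j₀ ε₀ e₀).symm r₀, (selectEquiv j₀ ε₁ e₁).symm r₁) i = _
  rw [hM, portControlled_apply_selectEquiv_symm, portControlled_apply_selectEquiv_symm]
  simp only [Equiv.apply_symm_apply, Equiv.refl_apply, kroneckerMap_apply]
  by_cases h1 : r₁.2 = (ζ₁ z₁).2
  · by_cases h0 : r₀.2 = (ζ₀ z₀).2
    · simp only [h0, h1, if_true]
      ring
    · simp [h0]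
  · simp [h1]

/-- With the ideal port operator in place of the interaction, the local processing performs exactly
the channel of the protocol. -/
theorem channel_totalWith_portOperator (x : ι) :
    traceOut ∘ₗ conjMap ((portProcessing j₀ P eL eR).totalWith (portOperator j₀ eL eR) x) =
      P.channel x := by
  refine traceOut_comp_conjMap_eq_of_mul (Fintype.equivFin _).symm (Fintype.equivFin _).symm _ _
    (portResidue j₀ P x) (sum_portResidue_mul_star j₀ P x) fun a₀ z₀ a₁ z₁ i => ?_
  exact portControlled_kronecker_mul_apply j₀ _ _ _ _ _ _ _ _ _ _ _
    (exchanged_portOperator j₀ P eL eR x) a₀ z₀ a₁ z₁ i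

end Ports

/-! ### The complexity bound -/

/-- The interaction matters only up to a global phase. -/
theorem LocalProcessing.channel_phase_mul {d₀ d₁ : ℕ} {ι : Type} {a b : ℕ}
    (L : LocalProcessing d₀ d₁ ι a b) (θ : ℝ) (V : unitaryGroup (Qubits (Fin a ⊕ Fin b)) ℂ)
      (x : ι) :
    L.channel (phase (Qubits (Fin a ⊕ Fin b)) θ * V) x = L.channel V x := by
  obtain ⟨z, hz, hzV⟩ : ∃ z : ℂ, z * star z = 1 ∧
      ((phase (Qubits (Fin a ⊕ Fin b)) θ * V : unitaryGroup (Qubits (Fin a ⊕ Fin b)) ℂ) :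
        Matrix (Qubits (Fin a ⊕ Fin b)) (Qubits (Fin a ⊕ Fin b)) ℂ) = z • V := by
    refine ⟨_, ?_, phase_mul_coe θ V⟩
    rw [Complex.star_def, Complex.mul_conj', Complex.norm_exp_ofReal_mul_I]
    simp
  have h1 : L.total (phase (Qubits (Fin a ⊕ Fin b)) θ * V) x = z • L.total V x := by
    rw [L.total_eq_totalWith, hzV, L.total_eq_totalWith, LocalProcessing.totalWith,
      LocalProcessing.totalWith, smul_kronecker, Matrix.smul_mul,
        ← Matrix.mul_smul (L.WL x ⊗ₖ L.WR x)]
    rfl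
  have h2 : conjMap (z • L.total V x) = conjMap (L.total V x) := by
    ext ρ : 1
    simp only [conjMap, LinearMap.coe_mk, AddHom.coe_mk, conjTranspose_smul, Matrix.smul_mul,
      Matrix.mul_smul, smul_smul, hz, one_smul, mul_comm (star z)]
  rw [LocalProcessing.channel, h1, h2, LocalProcessing.channel]

section Ports

variable {J : Type} [Fintype J] [DecidableEq J] (j₀ : J)
variable {d₀ d₁ : ℕ} {ι : Type} {E : ℕ} (P : NonlocalProtocol d₀ d₁ ι E) {a b : ℕ}
  (eL : Qubits (Fin a) ≃ Qubits (Fin E) × J) (eR : Qubits (Fin b) ≃ (J → Qubits (Fin E)) × J)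

/-- Port-based teleportation with `N` ports costs an error that tends to `0` with `4 ^ E / N`. The
unitary `U` depends only on the registers and not on the protocol. -/
theorem exists_unitary_diamondNorm_portProcessing_le :
    ∃ U : unitaryGroup (Qubits (Fin a ⊕ Fin b)) ℂ, ∀ {d₀ d₁ : ℕ} {ι : Type}
      (P : NonlocalProtocol d₀ d₁ ι E) (W : unitaryGroup (Qubits (Fin a ⊕ Fin b)) ℂ) (x : ι)
        (η : ℝ),
      2 * ‖(U : Matrix (Qubits (Fin a ⊕ Fin b)) (Qubits (Fin a ⊕ Fin b)) ℂ) - W‖ ^ 2 +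
        2 * ((2 ^ E : ℝ) ^ 2 / Fintype.card J) ≤ η →
      diamondNorm (P.channel x - (portProcessing j₀ P eL eR).channel W x) ≤
        ENNReal.ofReal (√η * (2 + √η)) := by
  obtain ⟨U, hU⟩ := exists_unitary_sum_norm_sq_col_le (portOperator j₀ eL eR)
  refine ⟨U, fun P W x η hη => ?_⟩
  set D : ℝ := (2 ^ E : ℝ) ^ (Fintype.card J + 1) with hD
  have hD0 : 0 < D := by positivity
  have hDi : (2 ^ E : ℝ)⁻¹ ^ (Fintype.card J + 1) = D⁻¹ := by rw [hD, inv_pow]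
  have hcard : (Fintype.card (Qubits (Fin E) × (J → Qubits (Fin E))) : ℝ) = D := by
    rw [hD, pow_succ, mul_comm]
    simp
  set L := portProcessing j₀ P eL eR with hL
  set T := portOperator j₀ eL eR with hT
  set η' : ℝ := D⁻¹ * ∑ p, ∑ r, ‖(T - W) r (blankBasis j₀ eL eR p)‖ ^ 2 with hη'
  have h1 : (L.totalWith W x)ᴴ * L.totalWith W x = 1 := by
    rw [conjTranspose_totalWith_portProcessing, hDi]
    have h2 : ∀ p, ∑ r, ‖(W : Matrix (Qubits (Fin a ⊕ Fin b)) (Qubits (Fin a ⊕ Fin b)) ℂ) r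
        (blankBasis j₀ eL eR p)‖ ^ 2 = 1 := fun p => by
      have := sum_norm_sq_unitary_mul_col W 1 (blankBasis j₀ eL eR p)
      rw [Matrix.mul_one] at this
      rw [this]
      simp [one_apply, apply_ite norm, ite_pow]
    simp only [h2]
    rw [Finset.sum_const, Finset.card_univ, nsmul_one, hcard, inv_mul_cancel₀ hD0.ne']
    simp
  have h3 : (L.totalWith T x - L.totalWith W x)ᴴ * (L.totalWith T x - L.totalWith W x) =
      (η' : ℂ) • 1 := by
    rw [← LocalProcessing.totalWith_sub, conjTranspose_totalWith_portProcessing, hDi]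
  have h4 : η' ≤ η := by
    refine le_trans ?_ hη
    rw [hη', inv_mul_le_iff₀ hD0]
    have h5 : ∀ p, ∑ r, ‖(T - W) r (blankBasis j₀ eL eR p)‖ ^ 2 ≤
        2 * ∑ r, ‖(1 - Tᴴ * T) r (blankBasis j₀ eL eR p)‖ ^ 2 + 2 *
          ‖(U : Matrix (Qubits (Fin a ⊕ Fin b)) (Qubits (Fin a ⊕ Fin b)) ℂ) - W‖ ^ 2 := fun p => by
      refine (sum_norm_sq_sub_col_le T U W _).trans (add_le_add ?_ ?_)
      · refine mul_le_mul_of_nonneg_left (le_trans (le_of_eq ?_) (hU _)) zero_le_two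
        refine Finset.sum_congr rfl fun q _ => ?_
        rw [Matrix.sub_apply, Matrix.sub_apply, norm_sub_rev]
      · exact mul_le_mul_of_nonneg_left (sum_norm_sq_col_le _ _) zero_le_two
    refine (Finset.sum_le_sum fun p _ => h5 p).trans ?_
    rw [Finset.sum_add_distrib, ← Finset.mul_sum, Finset.sum_const, Finset.card_univ, nsmul_eq_mul,
      hcard]
    have h6 := sum_norm_sq_portOperator_le j₀ eL eR
    rw [← hD] at h6
    nlinarith
  have h7 := diamondNorm_sub_le (L.totalWith T x) (L.totalWith W x) h1 η' (by positivity) h3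
  rw [hL, channel_totalWith_portOperator] at h7
  refine h7.trans (ENNReal.ofReal_le_ofReal ?_)
  have := Real.sqrt_le_sqrt h4
  gcongr

end Ports

/-- A register of `E + k` qubits consists of `E` qubits and the name of a port. -/
def leftRegister (E k : ℕ) : Qubits (Fin (E + k)) ≃ Qubits (Fin E) × Qubits (Fin k) :=
  (finSumFinEquiv.symm.arrowCongr (Equiv.refl _)).trans (Equiv.sumArrowEquivProdArrow _ _ _)

/-- A register of `2 ^ k * E + k` qubits consists of `E` qubits for each port and the name of a
port. -/
def rightRegister (E k : ℕ) :
    Qubits (Fin (2 ^ k * E + k)) ≃ (Qubits (Fin k) → Qubits (Fin E)) × Qubits (Fin k) :=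
  (leftRegister (2 ^ k * E) k).trans (Equiv.prodCongr
    (((finProdFinEquiv.symm.trans
      ((Fintype.equivFinOfCardEq (by simp)).symm.prodCongr (Equiv.refl _))).arrowCongr
      (Equiv.refl _)).trans (Equiv.curry (Qubits (Fin k)) (Fin E) (Fin 2))) (Equiv.refl _))

theorem interactionComplexity_le {G : GateSet} {ε : ℝ} {d₀ d₁ : ℕ} {ι : Type} {U : Task d₀ d₁ ι}
    {a b n : ℕ} {V : unitaryGroup (Qubits (Fin a ⊕ Fin b)) ℂ} (hV : V ∈ interactionClass ε U a b)
    (hc : HasCircuit G n (V : Matrix (Qubits (Fin a ⊕ Fin b)) (Qubits (Fin a ⊕ Fin b)) ℂ)) :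
    interactionComplexity G ε U ≤ n :=
  (iInf_le_of_le a <| iInf_le_of_le b <| iInf_le_of_le V <| iInf_le_of_le hV le_rfl).trans
    (iInf_le_of_le n <| iInf_le_of_le hc le_rfl)

theorem diamondNorm_zero {m n : Type} [Fintype m] [DecidableEq m] [Fintype n] [DecidableEq n] :
    diamondNorm (0 : Matrix n n ℂ →ₗ[ℂ] Matrix m m ℂ) = 0 := by
  refine le_antisymm (iSup_le fun k => iSup_le fun X => iSup_le fun _ => ?_) bot_le
  obtain ⟨W, hW⟩ := exists_trace_eq_traceNorm
    (amplify (0 : Matrix n n ℂ →ₗ[ℂ] Matrix m m ℂ) k X)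
  have h1 : amplify (0 : Matrix n n ℂ →ₗ[ℂ] Matrix m m ℂ) k X = 0 := rfl
  rw [h1] at hW ⊢
  have h2 : traceNorm (0 : Matrix (m × Fin k) (m × Fin k) ℂ) = 0 := by
    simpa using hW.symm
  simp [h2]

/-- Without EPR pairs, one port is enough and the interaction is trivial. -/
theorem interactionComplexity_eq_zero (G : GateSet) (ε : ℝ) {d₀ d₁ : ℕ} {ι : Type}
    {U : Task d₀ d₁ ι}
    (P : NonlocalProtocol d₀ d₁ ι 0) (hP : P.Completes U) : interactionComplexity G ε U = 0 := by
  have : IsEmpty (Fin (0 + 0) ⊕ Fin (2 ^ 0 * 0 + 0)) := inferInstanceAs (IsEmpty (Fin 0 ⊕ Fin 0))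
  have hT : portOperator (fun _ => 0) (leftRegister 0 0) (rightRegister 0 0) = 1 := by
    ext r q
    rw [Subsingleton.elim r q, one_apply_eq, portOperator, submatrix_apply, portMatrix, of_apply,
      if_pos ⟨⟨Subsingleton.elim _ _, Subsingleton.elim _ _⟩, ⟨Subsingleton.elim _ _,
        Subsingleton.elim _ _⟩, Subsingleton.elim _ _, rfl⟩]
    simp
  refine nonpos_iff_eq_zero.1 ((interactionComplexity_le (a := 0 + 0) (b := 2 ^ 0 * 0 + 0) (n := 0)
    (V := 1) ⟨portProcessing (fun _ => 0) P (leftRegister 0 0) (rightRegister 0 0), fun x => ?_⟩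
    HasCircuit.nil).trans le_rfl)
  have h1 : (portProcessing (fun _ => 0) P (leftRegister 0 0) (rightRegister 0 0)).channel 1 x =
      U.channel x := by
    rw [← hP x, ← channel_totalWith_portOperator (fun _ => 0) P (leftRegister 0 0)
      (rightRegister 0 0) x, hT]
    rfl
  rw [h1, sub_self, diamondNorm_zero]
  exact bot_le

/-- The complexity is at most `2 ^ (B * n)`, where the interaction acts on
`n = (E + k) + (2 ^ k * E + k)` qubits for `k = 2 * E + k₀`, that is, with `2 ^ k` ports. -/
theorem exists_interactionComplexity_le {G : GateSet} (hG : G.IsUniversal) {ε : ℝ} (hε : 0 < ε) :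
    ∃ k₀ B : ℕ, ∀ (d₀ d₁ : ℕ) (ι : Type) (U : Task d₀ d₁ ι) (E : ℕ)
      (P : NonlocalProtocol d₀ d₁ ι E),
      P.Completes U → interactionComplexity G ε U ≤
        ((2 ^ (B * (E + (2 * E + k₀) + (2 ^ (2 * E + k₀) * E + (2 * E + k₀)))) : ℕ) : ℕ∞) := by
  -- `η` bounds both the teleportation error `4 ^ E / 2 ^ k` and the squared error of the circuit.
  obtain ⟨η, hη0, hη⟩ : ∃ η : ℝ, 0 < η ∧ √(4 * η) * (2 + √(4 * η)) ≤ ε := by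
    have hδ : 0 < min 1 (ε / 3) := by positivity
    refine ⟨min 1 (ε / 3) ^ 2 / 4, by positivity, ?_⟩
    rw [mul_div_cancel₀ _ (by norm_num : (4 : ℝ) ≠ 0), Real.sqrt_sq hδ.le]
    nlinarith [min_le_left 1 (ε / 3), min_le_right 1 (ε / 3)]
  obtain ⟨m, B, hm, hB⟩ := hG.exists_circuit_bound (√η) (Real.sqrt_pos.2 hη0)
  obtain ⟨k₁, hk₁⟩ := exists_pow_lt_of_lt_one hη0 (by norm_num : (1 / 2 : ℝ) < 1)
  refine ⟨max m k₁, B, fun d₀ d₁ ι U E P hP => ?_⟩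
  -- `2 * E` makes up for `4 ^ E`, `k₁` brings the error below `η`, and `m` ensures that there are
  -- enough qubits for `exists_circuit_bound`.
  set k := 2 * E + max m k₁ with hk
  have hN : (2 ^ E : ℝ) ^ 2 / Fintype.card (Qubits (Fin k)) ≤ η := by
    have h1 : (Fintype.card (Qubits (Fin k)) : ℝ) = 2 ^ k := by simp
    have h2 : ((2 : ℝ) ^ E) ^ 2 / 2 ^ k = (1 / 2) ^ max m k₁ := by
      rw [hk, pow_add, ← pow_mul, mul_comm E 2, div_mul_eq_div_div,
        div_self (by positivity), one_div,
        one_div, inv_pow]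
    rw [h1, h2]
    exact (pow_le_pow_of_le_one (by norm_num) (by norm_num) (le_max_right _ _)).trans hk₁.le
  obtain ⟨V, hV⟩ := exists_unitary_diamondNorm_portProcessing_le (fun _ => 0) (leftRegister E k)
    (rightRegister E k)
  obtain ⟨W, ⟨θ, n, hn, hc⟩, hW⟩ := hB (Fin (E + k) ⊕ Fin (2 ^ k * E + k)) (by simp; omega) V
  -- The unitary of the circuit itself, phase included, serves as the interaction, so that the circuit
  -- is exact for it.
  refine (interactionComplexity_le (V := phase _ θ * W) ⟨portProcessing (fun _ =>
      0) P (leftRegister E k)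
    (rightRegister E k), fun x => ?_⟩ hc).trans ?_
  · rw [LocalProcessing.channel_phase_mul, ← hP x]
    refine (hV P W x (4 * η) ?_).trans (ENNReal.ofReal_le_ofReal hη)
    have h1 := pow_le_pow_left₀ (norm_nonneg _) hW 2
    rw [Real.sq_sqrt hη0.le] at h1
    linarith
  · have h2 : Fintype.card (Fin (E + k) ⊕ Fin (2 ^ k * E + k)) = E + k + (2 ^ k * E + k) := by simp
    rw [h2] at hn
    exact_mod_cast hn

/-- The number of qubits of the interaction is exponential in `E`. -/
theorem exponent_le (B k₀ : ℕ) {E : ℕ} (hE : 1 ≤ E) :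
    B * (E + (2 * E + k₀) + (2 ^ (2 * E + k₀) * E + (2 * E + k₀))) ≤ 2 ^ ((B + k₀ + 5) * E) := by
  set k := 2 * E + k₀ with hk
  have h1 : k < 2 ^ k := Nat.lt_two_pow_self
  have h2 : E < 2 ^ E := Nat.lt_two_pow_self
  have h3 : B < 2 ^ B := Nat.lt_two_pow_self
  have h4 : E + k + (2 ^ k * E + k) ≤ 2 ^ k * 2 ^ (E + 2) := by
    calc E + k + (2 ^ k * E + k) ≤ 2 ^ k * (E + 3) := by
          have : E ≤ k := by omega
          nlinarith
      _ ≤ 2 ^ k * 2 ^ (E + 2) := Nat.mul_le_mul_left _ (by rw [pow_add]; omega)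
  calc B * (E + k + (2 ^ k * E + k)) ≤ 2 ^ B * (2 ^ k * 2 ^ (E + 2)) := Nat.mul_le_mul h3.le h4
    _ = 2 ^ (B + (k + (E + 2))) := by rw [pow_add 2 B, pow_add 2 k]
    _ ≤ 2 ^ ((B + k₀ + 5) * E) := Nat.pow_le_pow_right two_pos (by
          have : B + k₀ ≤ (B + k₀) * E := Nat.le_mul_of_pos_right _ hE
          rw [hk, add_mul]
          omega)

end NLQC

end

theorem lemma1 (G : NLQC.GateSet) (hG : G.IsUniversal) (ε : ℝ) (hε : 0 < ε) :
    ∃ c : ℝ, 0 < c ∧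
      ∀ (d₀ d₁ : ℕ) (ι : Type) (U : NLQC.Task d₀ d₁ ι) (E : ℕ)
        (P : NLQC.NonlocalProtocol d₀ d₁ ι E), P.Completes U →
        ∃ C : ℕ, NLQC.interactionComplexity G ε U = C ∧
          (2 ≤ C → c * Real.logb 2 (Real.logb 2 C) ≤ E) := by
  obtain ⟨k₀, B, h⟩ := NLQC.exists_interactionComplexity_le hG hε
  refine ⟨((B + k₀ + 5 : ℕ) : ℝ)⁻¹, by positivity, fun d₀ d₁ ι U E P hP => ?_⟩
  -- For `E = 0` a bound `log₂ log₂ C ≤ O(E)` needs `C ≤ 2`, which the general bound does not give.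
  rcases Nat.eq_zero_or_pos E with rfl | hE
  · exact ⟨0, NLQC.interactionComplexity_eq_zero G ε P hP, fun h2 => absurd h2 (by norm_num)⟩
  have h1 := (h d₀ d₁ ι U E P hP).trans (Nat.cast_le.2
    (Nat.pow_le_pow_right two_pos (NLQC.exponent_le B k₀ hE)))
  obtain ⟨C, hC⟩ := ENat.ne_top_iff_exists.1 (ne_top_of_le_ne_top (ENat.natCast_ne_top _) h1)
  refine ⟨C, hC.symm, fun h2 => ?_⟩
  rw [← hC, Nat.cast_le] at h1
  have h3 : (2 : ℝ) ≤ C := by exact_mod_cast h2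
  have h4 : Real.logb 2 C ≤ 2 ^ ((B + k₀ + 5) * E) := by
    rw [Real.logb_le_iff_le_rpow one_lt_two (by linarith)]
    exact_mod_cast h1
  have h5 : 0 < Real.logb 2 C := Real.logb_pos one_lt_two (by linarith)
  have h6 : Real.logb 2 (Real.logb 2 C) ≤ ((B + k₀ + 5) * E : ℕ) := by
    rw [Real.logb_le_iff_le_rpow one_lt_two h5, Real.rpow_natCast]
    exact h4
  rw [inv_mul_le_iff₀ (by positivity)]
  exact_mod_cast h6
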